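/- Let $N\ge 3$ and consider the system of $N$ or $N+1$ nearly parallel filaments $\Psi_j(t,\sigma)\in\mathbb C$, $t,\sigma\in\mathbb R$, $$i\partial_t\Psi_j+\Gamma_j\partial_\sigma^2\Psi_j+\sum_{k\ne j}\Gamma_k\frac{\Psi_j-\Psi_k}{|\Psi_j-\Psi_k|^2}=0,\qquad \Psi_j(0,\sigma)=\Psi_{j,0}(\sigma),\tag{1}$$ where $j,k$ range over $\{1,\dots,N\}$ (polygon without its center) or over $\{0,1,\dots,N\}$ (polygon with its center), with $\Gamma_j=1$ for $1\le j\le N$ and, if the center is included, a real circulation $\Gamma_0$. Let $X_j(t)=e^{i(\omega t+\theta_0+2\pi j/N)}$, $1\le j\le N$ ($\theta_0\in\mathbb R$), and $X_0(t)=0$, be the regular polygon of radius $1$ rotating with angular velocity $\omega=\frac{N-1}{2}$ (without center), respectively $\omega=\frac{N-1}{2}+\Gamma_0$ (with center), and assume $\omega>0$. There is an absolute constant $\eta_1>0$ (independent of $N$, $\Gamma_0$, $\omega$ and of the data) such that the following holds. Let $\Psi_{j,0}(\sigma)=X_j(0)\Phi_0(\sigma)$, where $\Phi_0:\mathbb R\to\mathbb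 C$ is continuous with a weak derivative and $$\mathcal E(\Phi_0)=\frac12\int_{\mathbb R}|\partial_\sigma\Phi_0|^2\,d\sigma+\frac\omega2\int_{\mathbb R}\left(|\Phi_0|^2-1-\ln|\Phi_0|^2\right)d\sigma\le\eta_1\sqrt\omega .$$ (In particular $\mathcal E(\Phi_0)\le\eta_1$ suffices whenever $\omega\ge1$, as is always the case without the center.) Then there is a unique global weak solution $(\Psi_j)_j$ of (1) of the form $\Psi_j(t,\sigma)=X_j(t)\Phi(t,\sigma)$, $t\in\mathbb R$, with $\Phi-\Phi_0\in C(\mathbb R,H^1(\mathbb R))$. Moreover, for all $j\ne k$, $$\frac34\le\frac{|\Psi_j(t,\sigma)-\Psi_k(t,\sigma)|}{|X_j(t)-X_k(t)|}\le\frac54,\qquad t,\sigma\in\mathbb R.$$ If $\Phi_0(\sigma)\to1$ as $|\sigma|\to\infty$, then $\Psi_j(t,\sigma)\to X_j(t)$ as $|\sigma|\to\infty$ for all $t$ and $j$; and if $\Phi_0\in 1+H^1(\mathbb R)$, then $\Psi_j-X_j\in C(\mathbb R,H^1(\mathbb R))$ for all $j$. -/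

import Mathlib

open MeasureTheory Filter Topology
open scoped ENNReal

noncomputable section

/-- Test functions on the line: real-valued, smooth, compactly supported. -/
def IsTestFunction (φ : ℝ → ℝ) : Prop :=
  ContDiff ℝ (⊤ : ℕ∞) φ ∧ HasCompactSupport φ

/-- `g` is the weak (distributional) derivative of `f` on the line. -/
def HasWeakDeriv (f g : ℝ → ℂ) : Prop :=
  LocallyIntegrable f volume ∧ LocallyIntegrable g volume ∧
    ∀ φ : ℝ → ℝ, IsTestFunction φ → ∫ σ, f σ * ((deriv φ σ : ℝ) : ℂ) = -∫ σ, g σ * (φ σ : ℂ)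

/-- `f`, with weak derivative `g`, is (the continuous representative of) an element
of `H¹(ℝ; ℂ)`. -/
def IsH1Pair (f g : ℝ → ℂ) : Prop :=
  Continuous f ∧ MemLp f 2 volume ∧ HasWeakDeriv f g ∧ MemLp g 2 volume

/-- The Sobolev space `H¹(ℝ; ℂ)`; functions are represented by their continuous
representatives. -/
def MemH1 (f : ℝ → ℂ) : Prop :=
  ∃ g : ℝ → ℂ, IsH1Pair f g

/-- `v ∈ C(ℝ, H¹(ℝ; ℂ))`: each `v t` is in `H¹`, and `t ↦ v t` is continuous for the
`H¹` norm; here `w t` is the weak derivative of `v t`. -/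
def ContinuousInH1 (v : ℝ → ℝ → ℂ) : Prop :=
  ∃ w : ℝ → ℝ → ℂ, (∀ t, IsH1Pair (v t) (w t)) ∧
    ∀ t₀, Tendsto
      (fun t => eLpNorm (v t - v t₀) 2 volume + eLpNorm (w t - w t₀) 2 volume)
      (𝓝 t₀) (𝓝 0)

/-- The potential `|z|² - 1 - ln |z|²`, with value `+∞` at `z = 0`. -/
def potential (z : ℂ) : ℝ≥0∞ :=
  if z = 0 then ⊤ else ENNReal.ofReal (‖z‖ ^ 2 - 1 - Real.log (‖z‖ ^ 2))

/-- The energy `½ ∫ |f'|² + (ω/2) ∫ (|f|² - 1 - ln |f|²)`, with values in `[0, ∞]`, of a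
function `f` with weak derivative `f'`. -/
def energy (ω : ℝ) (f f' : ℝ → ℂ) : ℝ≥0∞ :=
  ENNReal.ofReal (1 / 2) * (∫⁻ σ, ‖f' σ‖ₑ ^ 2) +
    ENNReal.ofReal (ω / 2) * (∫⁻ σ, potential (f σ))

/-- The interaction term `∑_{k ≠ j} Γ_k (z_j - z_k) / |z_j - z_k|²`. -/
def interaction {ι : Type*} [Fintype ι] [DecidableEq ι] (Γ : ι → ℝ) (z : ι → ℂ) (j : ι) : ℂ :=
  ∑ k ∈ Finset.univ.erase j, (Γ k : ℂ) * ((z j - z k) / ((‖z j - z k‖ ^ 2 : ℝ) : ℂ))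

/-- `Ψ` (with `Ψ j t σ` the position of filament `j`) is a global solution, for `t ∈ ℝ`, of
`i ∂ₜ Ψ_j + Γ_j ∂²_σ Ψ_j + ∑_{k ≠ j} Γ_k (Ψ_j - Ψ_k) / |Ψ_j - Ψ_k|² = 0`, `Ψ_j(0) = Ψ₀_j`.
The equation is understood in the sense of distributions in `σ` and integrated in `t`; for the
interaction term to be a well-defined distribution, the filaments must not collide
on a set of positive measure and the term must be locally integrable on `ℝ × ℝ`. -/
structure IsFilamentSolution {ι : Type*} [Fintype ι] [DecidableEq ι] (Γ : ι → ℝ)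
    (Ψ₀ : ι → ℝ → ℂ) (Ψ : ι → ℝ → ℝ → ℂ) : Prop where
  continuous : ∀ j, Continuous (fun p : ℝ × ℝ => Ψ j p.1 p.2)
  initial : ∀ j σ, Ψ j 0 σ = Ψ₀ j σ
  no_collision : ∀ j k, j ≠ k → ∀ᵐ p : ℝ × ℝ, Ψ j p.1 p.2 ≠ Ψ k p.1 p.2
  locallyIntegrable : ∀ j,
    LocallyIntegrable (fun p : ℝ × ℝ => interaction Γ (fun k => Ψ k p.1 p.2) j) volume
  equation : ∀ j, ∀ φ : ℝ → ℝ, IsTestFunction φ → ∀ t : ℝ,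
    Complex.I * ((∫ σ, Ψ j t σ * (φ σ : ℂ)) - ∫ σ, Ψ₀ j σ * (φ σ : ℂ)) +
      ∫ s in (0 : ℝ)..t,
        ((Γ j : ℂ) * (∫ σ, Ψ j s σ * ((iteratedDeriv 2 φ σ : ℝ) : ℂ)) +
          ∫ σ, interaction Γ (fun k => Ψ k s σ) j * (φ σ : ℂ)) = 0

/-- Circulations: `1` at the vertices `j ≥ 1`, and `Γ₀` at the centre `j = 0`. -/
def circulation (Γ₀ : ℝ) (j : ℕ) : ℝ :=
  if j = 0 then Γ₀ else 1

/-- The angular velocity of the regular rotating `N`-gon of radius `1` with unit circulations at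
the vertices, `J` being the set of indices of the vortices: it is `(N - 1) / 2` without the
centre, and `(N - 1) / 2 + Γ₀` with the centre (`0 ∈ J`), which has circulation `Γ₀`. -/
def angularVelocity (N : ℕ) (J : Finset ℕ) (Γ₀ : ℝ) : ℝ :=
  ((N : ℝ) - 1) / 2 + if 0 ∈ J then Γ₀ else 0

/-- The regular `N`-gon of radius `1` rotating with angular velocity `ω`: the centre is
`X_0(t) = 0` and the vertices are `X_j(t) = exp (i (ω t + θ₀ + 2 π j / N))`, `1 ≤ j ≤ N`. -/
def rotatingPolygon (N : ℕ) (ω θ₀ : ℝ) (j : ℕ) (t : ℝ) : ℂ :=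
  if j = 0 then 0
  else Complex.exp (((ω * t + θ₀ + 2 * Real.pi * (j : ℝ) / (N : ℝ) : ℝ) : ℂ) * Complex.I)

/-- `Ψ_j(t, σ) = X_j(t) Φ(t, σ)` for all `j`, for some `Φ` with `Φ - Φ₀ ∈ C(ℝ, H¹(ℝ))`. -/
def IsDilationRotation {ι : Type*} (X : ι → ℝ → ℂ) (Φ₀ : ℝ → ℂ) (Ψ : ι → ℝ → ℝ → ℂ) : Prop :=
  ∃ Φ : ℝ → ℝ → ℂ, (∀ j t σ, Ψ j t σ = X j t * Φ t σ) ∧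
    ContinuousInH1 (fun t σ => Φ t σ - Φ₀ σ)

end

/-! The system collapses to one equation. Multiplying all positions by `z` multiplies the
interaction of a configuration by `z / |z|²`, and the polygon is a relative equilibrium: the
interaction at `X_j` is `ω X_j`. Since `X_j' = iω X_j`, the ansatz `Ψ_j = X_j Φ` turns the equation
of every vertex into `i Φ_t + Φ_σσ + ω (Φ / |Φ|² - Φ) = 0`. For the centre `X_0 = 0` and the
equation is trivial, so `Γ₀` enters only through `ω`. This is a Hamiltonian Schrödinger equation
whose energy is the given one.

Small energy keeps `|Φ|` away from `0`. A finite energy makes `Φ` Hölder continuous of exponent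
`1/2`, so a deviation of `|Φ|` from `1` by more than `1/4` at one point persists, halved, on an
interval of length proportional to `1/E`. It costs potential energy proportional to `ω/E`, which
exceeds `E` if `E ≤ √ω / 200` (`FiniteEnergy.abs_norm_sub_one_le`). Hence the force may be modified
for `|z| < 1/2` so as to become globally Lipschitz, with a potential no larger than the original one
and still at least `(ω/2)(|z| - 1)²`. The energy, once conserved, guarantees that the modification
is never felt.

The modified equation is solved for `v = Φ - Φ₀` in `H¹`, in an abstract setting with two operators
`J` (inclusion in `L²`) and `D` (derivative). Replacing `J* J v'` by `(J* J + ε) v'` gives an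
ordinary differential equation with Lipschitz right-hand side which conserves the energy exactly;
energy bounds give a modulus of continuity in `L²` independent of `ε`, and weak limits along an
ultrafilter give a weak solution with energy at most the initial one
(`SemilinearData.exists_weakSolution`). Weak solutions are unique by a mollified `L²` estimate and
Grönwall (`EnergySpace.norm_sq_mollified_le`). Solving backwards from time `t` then turns the energy
inequality into an equality, and conservation upgrades weak to strong continuity in `H¹`
(`SemilinearData.exists_continuous_weakSolution`).

Uniqueness among filament solutions does not presuppose energy conservation for the competitor. At a
time where it agrees with the constructed solution, continuity in `H¹` keeps `|Φ| ≥ 1/2` for a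
while; there it solves the modified equation, so the two agree nearby, and the set of times of
agreement is open and closed. -/

/-! ### Global flows of Lipschitz fields and Grönwall's inequality. -/

/-- Integration gains a factor `1 / c` in the norm weighted by `exp (c |t|)`, which makes the Picard
map a contraction on the whole line. -/
theorem abs_integral_exp_mul_abs_le {c : ℝ} (hc : 0 < c) (t : ℝ) :
    |∫ s in (0 : ℝ)..t, Real.exp (c * |s|)| ≤ Real.exp (c * |t|) / c := by
  have key : ∀ t : ℝ, 0 ≤ t →
      |∫ s in (0 : ℝ)..t, Real.exp (c * |s|)| ≤ Real.exp (c * |t|) / c := by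
    intro t ht
    have h : ∫ s in (0 : ℝ)..t, Real.exp (c * |s|) = (Real.exp (c * t) - 1) / c := by
      have h1 : ∫ s in (0 : ℝ)..t, Real.exp (c * |s|) = ∫ s in (0 : ℝ)..t, Real.exp (c * s) := by
        apply intervalIntegral.integral_congr
        intro s hs
        rw [Set.uIcc_of_le ht] at hs
        simp only [abs_of_nonneg hs.1]
      rw [h1, intervalIntegral.integral_comp_mul_left (fun s => Real.exp s) hc.ne', integral_exp]
      simp only [mul_zero, Real.exp_zero, smul_eq_mul]
      field_simp
    have h2 : 1 ≤ Real.exp (c * t) := Real.one_le_exp (by positivity)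
    rw [h, abs_of_nonneg (by apply div_nonneg <;> linarith), abs_of_nonneg ht]
    gcongr
    linarith
  rcases le_total 0 t with ht | ht
  · exact key t ht
  · have h := key (-t) (by linarith)
    have h1 : ∫ s in (0 : ℝ)..(-t), Real.exp (c * |s|) =
        -∫ s in (0 : ℝ)..t, Real.exp (c * |s|) := by
      rw [← intervalIntegral.integral_symm]
      have := intervalIntegral.integral_comp_neg (a := 0) (b := -t)
        (fun s => Real.exp (c * |s|))
      simpa using this
    rwa [h1, abs_neg, abs_neg] at h

/-- A globally Lipschitz autonomous differential equation has global solutions. -/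
theorem LipschitzWith.exists_global_integralCurve {E : Type*} [NormedAddCommGroup E]
    [NormedSpace ℝ E] [CompleteSpace E] {f : E → E} {K : NNReal} (hf : LipschitzWith K f) (x₀ : E) :
    ∃ α : ℝ → E, α 0 = x₀ ∧ ∀ t, HasDerivAt α (f (α t)) t := by
  -- `K / c` will be the contraction constant.
  obtain ⟨c, hc, hKc⟩ : ∃ c : ℝ, 0 < c ∧ (K : ℝ) / c ≤ 1 / 2 := by
    refine ⟨2 * K + 1, by positivity, ?_⟩
    rw [div_le_div_iff₀ (by positivity) (by norm_num)]
    linarith [K.coe_nonneg]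
  have hcont : ∀ y : BoundedContinuousFunction ℝ E,
      Continuous fun s => f (Real.exp (c * |s|) • y s) := fun y =>
    hf.continuous.comp
      ((by fun_prop : Continuous fun s : ℝ => Real.exp (c * |s|)).smul y.continuous)
  have hint : ∀ (y z : ℝ → E) (C : ℝ) (t : ℝ),
      (∀ s, ‖y s‖ ≤ C * Real.exp (c * |s|)) →
      ‖∫ s in (0 : ℝ)..t, y s‖ ≤ C * (Real.exp (c * |t|) / c) := by
    intro y z C t hy
    have h0 : 0 ≤ C := by
      have := (norm_nonneg _).trans (hy 0)
      simpa using this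
    calc ‖∫ s in (0 : ℝ)..t, y s‖ ≤ |∫ s in (0 : ℝ)..t, C * Real.exp (c * |s|)| :=
          intervalIntegral.norm_integral_le_abs_of_norm_le (ae_of_all _ fun s => hy s)
            ((by fun_prop : Continuous fun s : ℝ => C * Real.exp (c * |s|)).intervalIntegrable _ _)
      _ = C * |∫ s in (0 : ℝ)..t, Real.exp (c * |s|)| := by
          rw [intervalIntegral.integral_const_mul, abs_mul, abs_of_nonneg h0]
      _ ≤ _ := by gcongr; exact abs_integral_exp_mul_abs_le hc t
  have hexp : ∀ t : ℝ, 1 ≤ Real.exp (c * |t|) := fun t => Real.one_le_exp (by positivity)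
  have hbound : ∀ (y : BoundedContinuousFunction ℝ E) (t : ℝ),
      ‖Real.exp (-(c * |t|)) • (x₀ + ∫ s in (0 : ℝ)..t, f (Real.exp (c * |s|) • y s))‖ ≤
        ‖x₀‖ + (‖f 0‖ + K * ‖y‖) / c := by
    intro y t
    have h1 := hint (fun s => f (Real.exp (c * |s|) • y s)) 0 (‖f 0‖ + K * ‖y‖) t (by
      intro s
      have h := hf.norm_sub_le (Real.exp (c * |s|) • y s) 0
      rw [sub_zero, norm_smul, Real.norm_of_nonneg (Real.exp_pos _).le] at h
      have h2 := norm_le_norm_add_norm_sub' (f (Real.exp (c * |s|) • y s)) (f 0)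
      have h3 : K * (Real.exp (c * |s|) * ‖y s‖) ≤ K * (Real.exp (c * |s|) * ‖y‖) := by
        gcongr; exact y.norm_coe_le_norm s
      have h4 : ‖f 0‖ * 1 ≤ ‖f 0‖ * Real.exp (c * |s|) := by gcongr; exact hexp s
      nlinarith)
    rw [norm_smul, Real.norm_of_nonneg (Real.exp_pos _).le, Real.exp_neg,
      inv_mul_le_iff₀ (Real.exp_pos _)]
    refine (norm_add_le _ _).trans ?_
    have h5 : ‖x₀‖ * 1 ≤ ‖x₀‖ * Real.exp (c * |t|) := by gcongr; exact hexp t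
    calc _ ≤ ‖x₀‖ * Real.exp (c * |t|) + (‖f 0‖ + K * ‖y‖) * (Real.exp (c * |t|) / c) := by
          linarith
      _ = _ := by ring
  -- The Picard map in the unknown `y t = exp (-c |t|) • α t`, which stays bounded.
  let T : BoundedContinuousFunction ℝ E → BoundedContinuousFunction ℝ E := fun y =>
    BoundedContinuousFunction.ofNormedAddCommGroup
      (fun t => Real.exp (-(c * |t|)) • (x₀ + ∫ s in (0 : ℝ)..t, f (Real.exp (c * |s|) • y s)))
      ((by fun_prop : Continuous fun t : ℝ => Real.exp (-(c * |t|))).smul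
        (continuous_const.add (intervalIntegral.continuous_primitive
          (fun a b => (hcont y).intervalIntegrable a b) 0)))
      _ (hbound y)
  have hT : ContractingWith (1 / 2) T := by
    refine ⟨by norm_num [← NNReal.coe_lt_coe], LipschitzWith.of_dist_le_mul fun y z => ?_⟩
    rw [BoundedContinuousFunction.dist_le (by positivity)]
    intro t
    have h1 := hint (fun s => f (Real.exp (c * |s|) • y s) - f (Real.exp (c * |s|) • z s)) 0
      (K * dist y z) t (by
        intro s
        refine (hf.norm_sub_le _ _).trans ?_
        rw [← smul_sub, norm_smul, Real.norm_of_nonneg (Real.exp_pos _).le, ← dist_eq_norm]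
        have : K * (Real.exp (c * |s|) * dist (y s) (z s)) ≤
          K * (Real.exp (c * |s|) * dist y z) := by
            gcongr; exact BoundedContinuousFunction.dist_coe_le_dist s
        linarith)
    have h2 : T y t - T z t = Real.exp (-(c * |t|)) •
        ∫ s in (0 : ℝ)..t, (f (Real.exp (c * |s|) • y s) - f (Real.exp (c * |s|) • z s)) := by
      rw [intervalIntegral.integral_sub ((hcont y).intervalIntegrable _ _)
        ((hcont z).intervalIntegrable _ _)]
      simp only [T, BoundedContinuousFunction.coe_ofNormedAddCommGroup]
      rw [← smul_sub]
      congr 1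
      abel
    rw [dist_eq_norm, h2, norm_smul, Real.norm_of_nonneg (Real.exp_pos _).le, Real.exp_neg,
      inv_mul_le_iff₀ (Real.exp_pos _)]
    refine h1.trans ?_
    have h3 : K / c * (dist y z * Real.exp (c * |t|)) ≤
        1 / 2 * (dist y z * Real.exp (c * |t|)) := by
      gcongr
    calc _ = K / c * (dist y z * Real.exp (c * |t|)) := by ring
      _ ≤ _ := h3
      _ = _ := by push_cast; ring
  have hfix := hT.fixedPoint_isFixedPt
  set y := hT.fixedPoint
  have hα : ∀ t, Real.exp (c * |t|) • y t =
      x₀ + ∫ s in (0 : ℝ)..t, f (Real.exp (c * |s|) • y s) := by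
    intro t
    have h : T y t = y t := by rw [hfix]
    rw [← h]
    simp only [T, BoundedContinuousFunction.coe_ofNormedAddCommGroup]
    rw [smul_smul, ← Real.exp_add]
    simp
  refine ⟨fun t => Real.exp (c * |t|) • y t, ?_, fun t => ?_⟩
  · simpa using hα 0
  · have h := ((hcont y).integral_hasStrictDerivAt 0 t).hasDerivAt.const_add x₀
    exact h.congr_of_eventuallyEq (Eventually.of_forall hα)

/-- Integral form of Grönwall's inequality with vanishing data. -/
theorem eq_zero_of_le_mul_abs_integral {f : ℝ → ℝ} {a r C : ℝ}
    (hf : ContinuousOn f (Metric.ball a r)) (hf0 : ∀ t, 0 ≤ f t)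
    (h : ∀ t ∈ Metric.ball a r, f t ≤ C * |∫ s in a..t, f s|) :
    ∀ t ∈ Metric.ball a r, f t = 0 := by
  have key : ∀ (f : ℝ → ℝ) (b : ℝ), 0 ≤ b → ContinuousOn f (Set.Icc 0 b) → (∀ t, 0 ≤ f t) →
      (∀ t ∈ Set.Icc 0 b, f t ≤ C * |∫ s in (0 : ℝ)..t, f s|) → f b = 0 := by
    intro f b hb hf hf0 h
    have hF : ∀ t ∈ Set.Icc 0 b, |∫ s in (0 : ℝ)..t, f s| = ∫ s in (0 : ℝ)..t, f s := fun t ht =>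
      abs_of_nonneg (intervalIntegral.integral_nonneg ht.1 fun s _ => hf0 s)
    have hderiv : ∀ t ∈ Set.Ico 0 b,
        HasDerivWithinAt (fun t => ∫ s in (0 : ℝ)..t, f s) (f t) (Set.Ici t) t := by
      intro t ht
      have hsub : Set.Icc 0 t ⊆ Set.Icc 0 b := Set.Icc_subset_Icc_right ht.2.le
      have hmem : Set.Icc 0 b ∈ 𝓝[>] t :=
        mem_of_superset (Ioo_mem_nhdsGT ht.2) fun s hs => ⟨ht.1.trans hs.1.le, hs.2.le⟩
      refine intervalIntegral.integral_hasDerivWithinAt_right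
        (ContinuousOn.intervalIntegrable (by rw [Set.uIcc_of_le ht.1]; exact hf.mono hsub))
        (t := Set.Ioi t) ?_ ?_
      · exact ⟨Set.Icc 0 b, hmem, hf.aestronglyMeasurable measurableSet_Icc⟩
      · exact (hf t ⟨ht.1, ht.2.le⟩).mono_of_mem_nhdsWithin hmem
    have hcont : ContinuousOn (fun t => ∫ s in (0 : ℝ)..t, f s) (Set.Icc 0 b) := by
      have := intervalIntegral.continuousOn_primitive_interval (a := 0) (b := b) (μ := volume)
        (f := f) (by rw [Set.uIcc_of_le hb]; exact hf.integrableOn_Icc)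
      rwa [Set.uIcc_of_le hb] at this
    -- Grönwall is applied to the primitive of `f`: its derivative `f` is at most `C` times itself,
    -- and it vanishes at `0`.
    have hg := norm_le_gronwallBound_of_norm_deriv_right_le (δ := 0) (K := C) (ε := 0) hcont hderiv
      (by simp) (fun t ht => by
        have h1 := h t ⟨ht.1, ht.2.le⟩
        rw [Real.norm_of_nonneg (hf0 t), Real.norm_eq_abs]
        linarith) b ⟨hb, le_rfl⟩
    simp only [gronwallBound_ε0_δ0, norm_le_zero_iff] at hg
    have := h b ⟨hb, le_rfl⟩
    rw [hg] at this
    simp only [abs_zero, mul_zero] at this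
    exact le_antisymm this (hf0 b)
  intro t ht
  rw [Metric.mem_ball, Real.dist_eq] at ht
  rcases le_total a t with hat | hat
  · have hmem : ∀ s ∈ Set.Icc 0 (t - a), a + s ∈ Metric.ball a r := fun s hs => by
      rw [Metric.mem_ball, Real.dist_eq, add_sub_cancel_left, abs_of_nonneg hs.1]
      exact hs.2.trans_lt ((le_abs_self _).trans_lt ht)
    have := key (fun s => f (a + s)) (t - a) (by linarith)
      (hf.comp (by fun_prop) hmem) (fun s => hf0 _) (fun s hs => by
        have h1 := h _ (hmem s hs)
        rwa [intervalIntegral.integral_comp_add_left f a, add_zero])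
    simpa using this
  · have hmem : ∀ s ∈ Set.Icc 0 (a - t), a - s ∈ Metric.ball a r := fun s hs => by
      rw [Metric.mem_ball, Real.dist_eq, sub_sub_cancel_left, abs_neg, abs_of_nonneg hs.1]
      rw [abs_sub_comm] at ht
      exact hs.2.trans_lt ((le_abs_self _).trans_lt ht)
    have := key (fun s => f (a - s)) (a - t) (by linarith)
      (hf.comp (by fun_prop) hmem) (fun s => hf0 _) (fun s hs => by
        have h1 := h _ (hmem s hs)
        rwa [intervalIntegral.integral_comp_sub_left f a, sub_zero,
          intervalIntegral.integral_symm, abs_neg])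
    simpa using this

/-! ### Limits under a common modulus of continuity, and weak compactness. -/

/-- On a compact interval, a pointwise limit of functions with a common modulus of continuity is
a uniform limit. -/
theorem eventually_forall_norm_sub_le_of_modulus {E : Type*} [NormedAddCommGroup E]
    {ι : Type*} {l : Filter ι} {F : ι → ℝ → E} {f : ℝ → E} {K : Set ℝ} (hK : IsCompact K)
    {m : ℝ → ℝ} (hm : Tendsto m (𝓝 0) (𝓝 0))
    (hF : ∀ i, ∀ s ∈ K, ∀ t ∈ K, ‖F i s - F i t‖ ≤ m |s - t|)
    (hlim : ∀ s ∈ K, Tendsto (fun i => F i s) l (𝓝 (f s))) {ε : ℝ} (hε : 0 < ε) :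
    ∀ᶠ i in l, ∀ s ∈ K, ‖F i s - f s‖ ≤ ε := by
  rcases l.eq_or_neBot with rfl | _
  · simp
  have hf : ∀ s ∈ K, ∀ t ∈ K, ‖f s - f t‖ ≤ m |s - t| := fun s hs t ht =>
    le_of_tendsto ((hlim s hs).sub (hlim t ht)).norm (Eventually.of_forall fun i => hF i s hs t ht)
  obtain ⟨δ, hδ, hmδ⟩ := Metric.tendsto_nhds_nhds.1 hm (ε / 3) (by positivity)
  obtain ⟨T, hTK, hT, hcover⟩ := hK.finite_cover_balls hδ
  have hev : ∀ᶠ i in l, ∀ t ∈ T, ‖F i t - f t‖ < ε / 3 := by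
    rw [eventually_all_finite hT]
    intro t ht
    have := Metric.tendsto_nhds.1 (hlim t (hTK ht)) (ε / 3) (by positivity)
    simpa only [dist_eq_norm] using this
  filter_upwards [hev] with i hi s hs
  obtain ⟨t, htT, hst⟩ := Set.mem_iUnion₂.1 (hcover hs)
  have hmst : m |s - t| < ε / 3 := by
    have h1 := hmδ (x := |s - t|) (by simpa [Real.dist_eq] using hst)
    rw [Real.dist_eq, sub_zero] at h1
    exact (le_abs_self _).trans_lt h1
  have h1 := hF i s hs t (hTK htT)
  have h2 := hf s hs t (hTK htT)
  have h3 := hi t htT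
  calc ‖F i s - f s‖ = ‖(F i s - F i t) + (F i t - f t) + -(f s - f t)‖ := by congr 1; abel
    _ ≤ ‖F i s - F i t‖ + ‖F i t - f t‖ + ‖f s - f t‖ := by
        refine (norm_add₃_le).trans ?_
        rw [norm_neg]
    _ ≤ ε := by linarith

theorem tendsto_setIntegral_of_eventually_forall_norm_sub_le {E : Type*} [NormedAddCommGroup E]
    [NormedSpace ℝ E] {ι : Type*} {l : Filter ι} {F : ι → ℝ → E} {f : ℝ → E} {K : Set ℝ}
    (hK : volume K ≠ ∞)
    (hF : ∀ i, IntegrableOn (F i) K) (hf : IntegrableOn f K)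
    (h : ∀ ε > 0, ∀ᶠ i in l, ∀ s ∈ K, ‖F i s - f s‖ ≤ ε) :
    Tendsto (fun i => ∫ s in K, F i s) l (𝓝 (∫ s in K, f s)) := by
  rw [Metric.tendsto_nhds]
  intro ε hε
  have hpos : 0 < volume.real K + 1 := by positivity
  filter_upwards [h (ε / (2 * (volume.real K + 1))) (by positivity)] with i hi
  rw [dist_eq_norm, ← integral_sub (hF i) hf]
  calc ‖∫ s in K, F i s - f s‖ ≤ ε / (2 * (volume.real K + 1)) * volume.real K :=
        norm_setIntegral_le_of_norm_le_const hK.lt_top hi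
    _ ≤ ε / (2 * (volume.real K + 1)) * (volume.real K + 1) := by gcongr; linarith
    _ = ε / 2 := by field_simp
    _ < ε := by linarith

/-- Dominated convergence fails along a general ultrafilter; equicontinuity takes its place. -/
theorem tendsto_intervalIntegral_of_modulus {E : Type*} [NormedAddCommGroup E]
    [NormedSpace ℝ E] {ι : Type*} {l : Filter ι} {F : ι → ℝ → E} {f : ℝ → E} {a b : ℝ}
    {m : ℝ → ℝ} (hm : Tendsto m (𝓝 0) (𝓝 0))
    (hFc : ∀ i, Continuous (F i)) (hfc : Continuous f)
    (hF : ∀ i, ∀ s t, ‖F i s - F i t‖ ≤ m |s - t|)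
    (hlim : ∀ s, Tendsto (fun i => F i s) l (𝓝 (f s))) :
    Tendsto (fun i => ∫ s in a..b, F i s) l (𝓝 (∫ s in a..b, f s)) := by
  have h : ∀ c d : ℝ, Tendsto (fun i => ∫ s in Set.Ioc c d, F i s) l
      (𝓝 (∫ s in Set.Ioc c d, f s)) := fun c d => by
    refine tendsto_setIntegral_of_eventually_forall_norm_sub_le (by simp)
      (fun i => ((hFc i).integrableOn_Icc).mono_set Set.Ioc_subset_Icc_self)
      ((hfc.integrableOn_Icc).mono_set Set.Ioc_subset_Icc_self) fun ε hε => ?_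
    filter_upwards [eventually_forall_norm_sub_le_of_modulus (isCompact_Icc (a := c) (b := d)) hm
      (fun i s _ t _ => hF i s t) (fun s _ => hlim s) hε] with i hi s hs
    exact hi s (Set.Ioc_subset_Icc_self hs)
  simp only [intervalIntegral]
  exact (h a b).sub (h b a)

/-- Weak compactness of balls of a Hilbert space, along an ultrafilter. -/
theorem Ultrafilter.exists_forall_tendsto_inner {H : Type*} [NormedAddCommGroup H]
    [InnerProductSpace ℂ H] [CompleteSpace H] {ι : Type*} (l : Ultrafilter ι) {v : ι → H} {R : ℝ}
    (hv : ∀ᶠ i in l, ‖v i‖ ≤ R) :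
    ∃ w : H, ∀ h : H, Tendsto (fun i => inner ℂ (v i) h) l (𝓝 (inner ℂ w h)) := by
  -- Banach–Alaoglu for the functionals represented by `v i`, then Riesz for the limit.
  have hc := WeakDual.isCompact_closedBall (𝕜 := ℂ) (E := H) 0 R
  have hmem : ∀ᶠ i in l, StrongDual.toWeakDual (InnerProductSpace.toDual ℂ H (v i)) ∈
      WeakDual.toStrongDual ⁻¹' Metric.closedBall (0 : StrongDual ℂ H) R := by
    filter_upwards [hv] with i hi
    rw [Set.mem_preimage, mem_closedBall_zero_iff]
    exact ((InnerProductSpace.toDual ℂ H).norm_map (v i)).trans_le hi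
  obtain ⟨x, -, hx⟩ := hc.ultrafilter_le_nhds
    (l.map fun i => StrongDual.toWeakDual (InnerProductSpace.toDual ℂ H (v i)))
    (by rw [le_principal_iff]; exact hmem)
  refine ⟨(InnerProductSpace.toDual ℂ H).symm (WeakDual.toStrongDual x), fun h => ?_⟩
  have h1 : Tendsto (fun i => StrongDual.toWeakDual (InnerProductSpace.toDual ℂ H (v i)))
      l (𝓝 x) := hx
  have h2 := ((WeakDual.eval_continuous h).tendsto x).comp h1
  rw [InnerProductSpace.toDual_symm_apply]
  exact h2

/-- Weak lower semicontinuity of the norm. -/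
theorem norm_le_of_forall_tendsto_inner {H : Type*} [NormedAddCommGroup H]
    [InnerProductSpace ℂ H] {ι : Type*} {l : Filter ι} [l.NeBot] {v : ι → H} {w : H}
    (hv : ∀ h : H, Tendsto (fun i => inner ℂ (v i) h) l (𝓝 (inner ℂ w h)))
    {r : ι → ℝ} {R : ℝ} (hr : Tendsto r l (𝓝 R)) (h : ∀ᶠ i in l, ‖v i‖ ≤ r i) : ‖w‖ ≤ R := by
  have h1 : ‖inner ℂ w w‖ ≤ R * ‖w‖ := by
    refine le_of_tendsto_of_tendsto (hv w).norm (hr.mul_const ‖w‖) ?_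
    filter_upwards [h] with i hi
    exact (norm_inner_le_norm _ _).trans (by gcongr)
  rw [inner_self_eq_norm_sq_to_K] at h1
  simp only [Complex.coe_algebraMap, norm_pow, Complex.norm_real, norm_norm] at h1
  rcases (norm_nonneg w).eq_or_lt with h0 | h0
  · rw [← h0]
    refine ge_of_tendsto hr ?_
    filter_upwards [h] with i hi
    exact (norm_nonneg _).trans hi
  · nlinarith

/-! ### Abstract energy spaces: resolvent, weak continuity, uniqueness for the linear part. -/

/-- A Hilbert space `H` with the norm `‖u‖² = ‖J u‖² + ‖D u‖²`, as for `H¹ ⊆ L²`. -/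
structure EnergySpace (H L : Type*) [NormedAddCommGroup H] [InnerProductSpace ℂ H]
    [CompleteSpace H] [NormedAddCommGroup L] [InnerProductSpace ℂ L] [CompleteSpace L] where
  J : H →L[ℂ] L
  D : H →L[ℂ] L
  inner_eq : ∀ u w : H, inner ℂ u w = inner ℂ (J u) (J w) + inner ℂ (D u) (D w)
  injective : ∀ u, J u = 0 → u = 0

namespace EnergySpace

variable {H L : Type*} [NormedAddCommGroup H] [InnerProductSpace ℂ H] [CompleteSpace H]
  [NormedAddCommGroup L] [InnerProductSpace ℂ L] [CompleteSpace L] (S : EnergySpace H L)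

theorem norm_sq (u : H) : ‖u‖ ^ 2 = ‖S.J u‖ ^ 2 + ‖S.D u‖ ^ 2 := by
  have h := congrArg Complex.re (S.inner_eq u u)
  rw [Complex.add_re] at h
  have h' : ∀ {G : Type _} [NormedAddCommGroup G] [InnerProductSpace ℂ G] (x : G),
      (inner ℂ x x).re = ‖x‖ ^ 2 := fun x => inner_self_eq_norm_sq (𝕜 := ℂ) x
  rw [h' u, inner_self_eq_norm_sq_to_K, inner_self_eq_norm_sq_to_K] at h
  rw [h]
  simp [← Complex.ofReal_pow]

theorem norm_J_le (u : H) : ‖S.J u‖ ≤ ‖u‖ := by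
  have := S.norm_sq u
  exact abs_le_of_sq_le_sq' (by nlinarith [sq_nonneg ‖S.D u‖]) (norm_nonneg u) |>.2

theorem norm_D_le (u : H) : ‖S.D u‖ ≤ ‖u‖ := by
  have := S.norm_sq u
  exact abs_le_of_sq_le_sq' (by nlinarith [sq_nonneg ‖S.J u‖]) (norm_nonneg u) |>.2

theorem norm_le_add (u : H) : ‖u‖ ≤ ‖S.J u‖ + ‖S.D u‖ := by
  have := S.norm_sq u
  have h1 := norm_nonneg (S.J u)
  have h2 := norm_nonneg (S.D u)
  exact abs_le_of_sq_le_sq' (by nlinarith) (by positivity) |>.2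

/-- `R = (J* J + ε)⁻¹`, which exists because `J* J + ε` is bounded below by `ε`. -/
theorem exists_resolvent {ε : ℝ} (hε : 0 < ε) :
    ∃ R : H →L[ℂ] H, ∀ x φ : H,
      inner ℂ φ x = inner ℂ (S.J φ) (S.J (R x)) + ε * inner ℂ φ (R x) := by
  let B : H →L[ℂ] H :=
    (ContinuousLinearMap.adjoint S.J) ∘L S.J + (ε : ℂ) • ContinuousLinearMap.id ℂ H
  have hB : ∀ φ x, inner ℂ φ (B x) = inner ℂ (S.J φ) (S.J x) + ε * inner ℂ φ x := by
    intro φ x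
    simp only [B, add_apply, ContinuousLinearMap.comp_apply,
      smul_apply, ContinuousLinearMap.id_apply, inner_add_right,
      inner_smul_right, ContinuousLinearMap.adjoint_inner_right]
  have hunit : IsUnit B := by
    refine ContinuousLinearMap.isUnit_of_forall_le_norm_inner_map B (c := Real.toNNReal ε)
      (by simpa using hε) fun x => ?_
    rw [norm_inner_symm, hB, inner_self_eq_norm_sq_to_K, inner_self_eq_norm_sq_to_K]
    have : ((‖S.J x‖ : ℂ) ^ 2 + ε * (‖x‖ : ℂ) ^ 2) = ((‖S.J x‖ ^ 2 + ε * ‖x‖ ^ 2 : ℝ) : ℂ) := by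
      push_cast; ring
    simp only [Complex.coe_algebraMap]
    rw [this, Complex.norm_real, Real.norm_of_nonneg (by positivity)]
    rw [Real.coe_toNNReal _ hε.le]
    nlinarith [sq_nonneg ‖S.J x‖]
  obtain ⟨R, hR⟩ := hunit.exists_right_inv
  refine ⟨R, fun x φ => ?_⟩
  rw [← hB, ← mul_apply_eq_comp, hR, one_apply_eq_self]

/-- The orthogonal complement of the range of `J*` is the kernel of `J`, which is zero. -/
theorem dense_range_adjoint (φ : H) {η : ℝ} (hη : 0 < η) :
    ∃ g : L, ‖φ - ContinuousLinearMap.adjoint S.J g‖ < η := by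
  have h : (ContinuousLinearMap.adjoint S.J).range.topologicalClosure = ⊤ := by
    rw [Submodule.topologicalClosure_eq_top_iff, ContinuousLinearMap.orthogonal_range,
      ContinuousLinearMap.adjoint_adjoint, Submodule.eq_bot_iff]
    exact fun u hu => S.injective u hu
  have hmem : φ ∈ closure ((ContinuousLinearMap.adjoint S.J).range : Set H) := by
    rw [← Submodule.topologicalClosure_coe, h]
    trivial
  obtain ⟨_, ⟨g, rfl⟩, hg⟩ := Metric.mem_closure_iff.1 hmem η hη
  exact ⟨g, by rwa [dist_eq_norm] at hg⟩

/-- A locally bounded curve in `H` that is continuous in `L` is weakly continuous. -/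
theorem continuous_inner {v : ℝ → H} (hJ : Continuous fun t => S.J (v t)) {R : ℝ → ℝ}
    (hR : Continuous R) (hv : ∀ t, ‖v t‖ ≤ R t) (φ : H) : Continuous fun t => inner ℂ φ (v t) := by
  rw [continuous_iff_continuousAt]
  intro t₀
  rw [Metric.continuousAt_iff']
  intro ε hε
  have hR0 : 0 ≤ R t₀ := (norm_nonneg _).trans (hv t₀)
  -- Pairing with `J* g` is a pairing in `L`, where `v` is continuous; the error is controlled by
  -- the local bound on `v`.
  obtain ⟨g, hg⟩ := S.dense_range_adjoint φ (η := ε / (2 * (2 * R t₀ + 1))) (by positivity)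
  have h1 : ∀ᶠ t in 𝓝 t₀, R t < R t₀ + 1 :=
    hR.continuousAt.eventually_lt continuousAt_const (by simp)
  have h2 : ∀ᶠ t in 𝓝 t₀, dist (inner ℂ g (S.J (v t))) (inner ℂ g (S.J (v t₀))) < ε / 2 :=
    Metric.continuousAt_iff'.1 ((continuous_const.inner hJ).continuousAt (x := t₀)) _
      (by positivity)
  filter_upwards [h1, h2] with t h1 h2
  rw [dist_eq_norm] at h2 ⊢
  have h3 : inner ℂ φ (v t) - inner ℂ φ (v t₀) =
      inner ℂ (φ - ContinuousLinearMap.adjoint S.J g) (v t - v t₀) +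
        (inner ℂ g (S.J (v t)) - inner ℂ g (S.J (v t₀))) := by
    simp only [inner_sub_left, inner_sub_right, ContinuousLinearMap.adjoint_inner_left]
    ring
  have h4 : ‖v t - v t₀‖ ≤ 2 * R t₀ + 1 := (norm_sub_le _ _).trans (by linarith [hv t, hv t₀])
  rw [h3]
  calc _ ≤ ‖φ - ContinuousLinearMap.adjoint S.J g‖ * ‖v t - v t₀‖ + _ :=
        (norm_add_le _ _).trans (add_le_add_left (norm_inner_le_norm _ _) _)
    _ ≤ ε / (2 * (2 * R t₀ + 1)) * (2 * R t₀ + 1) +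
        ‖inner ℂ g (S.J (v t)) - inner ℂ g (S.J (v t₀))‖ := by gcongr
    _ = ε / 2 + ‖inner ℂ g (S.J (v t)) - inner ℂ g (S.J (v t₀))‖ := by field_simp
    _ < ε := by linarith

end EnergySpace

/-- A weakly continuous bounded integrand: an identity tested on a total set holds for all
vectors. -/
theorem inner_eq_integral_of_total {H : Type*} [NormedAddCommGroup H] [InnerProductSpace ℂ H]
    {T : Set H} (hT : (Submodule.span ℂ T).topologicalClosure = ⊤) {a b C : ℝ} {z : H} {p : ℝ → H}
    (hp : ∀ φ, ContinuousOn (fun s => inner ℂ φ (p s)) (Set.uIcc a b))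
    (hC : ∀ s ∈ Set.uIcc a b, ‖p s‖ ≤ C)
    (h : ∀ φ ∈ T, inner ℂ φ z = ∫ s in a..b, inner ℂ φ (p s)) (φ : H) :
    inner ℂ φ z = ∫ s in a..b, inner ℂ φ (p s) := by
  have hint : ∀ φ, IntervalIntegrable (fun s => inner ℂ φ (p s)) volume a b := fun φ =>
    (hp φ).intervalIntegrable
  have hcont : Continuous fun φ => ∫ s in a..b, inner ℂ φ (p s) := by
    have hlip : LipschitzWith (Real.toNNReal (|C| * |b - a|))
        fun φ => ∫ s in a..b, inner ℂ φ (p s) := by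
      refine LipschitzWith.of_dist_le_mul fun φ ψ => ?_
      rw [dist_eq_norm, ← intervalIntegral.integral_sub (hint φ) (hint ψ),
        Real.coe_toNNReal _ (by positivity)]
      refine (intervalIntegral.norm_integral_le_of_norm_le_const (C := |C| * dist φ ψ)
        fun s hs => ?_).trans_eq (by ring)
      rw [← inner_sub_left, dist_eq_norm, mul_comm]
      exact (norm_inner_le_norm _ _).trans (mul_le_mul_of_nonneg_left
        ((hC s (Set.uIoc_subset_uIcc hs)).trans (le_abs_self C)) (norm_nonneg _))
    exact hlip.continuous
  have hmem : φ ∈ closure (Submodule.span ℂ T : Set H) := by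
    rw [← Submodule.topologicalClosure_coe, hT]
    trivial
  have hclosed : IsClosed {φ : H | inner ℂ φ z = ∫ s in a..b, inner ℂ φ (p s)} :=
    isClosed_eq (by fun_prop) hcont
  refine hclosed.closure_subset_iff.2 (fun ψ hψ => ?_) hmem
  induction hψ using Submodule.span_induction with
  | mem x hx => exact h x hx
  | zero => simp
  | add x y _ _ hx hy =>
    simp only [Set.mem_ofPred_eq, inner_add_left] at *
    rw [hx, hy, intervalIntegral.integral_add (hint x) (hint y)]
  | smul c x _ hx =>
    simp only [Set.mem_ofPred_eq, inner_smul_left] at *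
    rw [hx, intervalIntegral.integral_const_mul]

namespace EnergySpace

variable {H L : Type*} [NormedAddCommGroup H] [InnerProductSpace ℂ H] [CompleteSpace H]
  [NormedAddCommGroup L] [InnerProductSpace ℂ L] [CompleteSpace L] (S : EnergySpace H L)

/-- The difference `d` of two weak solutions is too rough to be tested against itself. With `P = (1
+ δ (1 + D* D))⁻¹ : L → H` and `Q = J P`, self-adjoint with `0 ≤ Q ≤ 1`, the curve `Q J d` is
differentiable in `L`. The linear part does not change its norm, being `-i` times a self-adjoint
operator that commutes with `Q`, so only `n` contributes; and `J d - Q J d` has size at most `√δ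
‖d‖`. -/
theorem norm_sq_mollified_le {d : ℝ → H} {n : ℝ → L} {C t₀ r : ℝ}
    (hx : ContinuousOn (fun t => S.J (d t)) (Metric.ball t₀ r))
    (hn : ContinuousOn n (Metric.ball t₀ r))
    (hC : ∀ t ∈ Metric.ball t₀ r, ‖n t‖ ≤ C * ‖S.J (d t)‖)
    (heq : ∀ φ, ∀ t ∈ Metric.ball t₀ r, Complex.I * inner ℂ (S.J φ) (S.J (d t)) =
      ∫ s in t₀..t, (inner ℂ (S.D φ) (S.D (d s)) - inner ℂ (S.J φ) (n s)))
    {δ : ℝ} (hδ : 0 < δ) {t : ℝ} (ht : t ∈ Metric.ball t₀ r) :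
    ‖S.J (d t)‖ ≤ √(2 * C * |∫ s in t₀..t, ‖S.J (d s)‖ ^ 2|) + √δ * ‖d t‖ := by
  let _ : InnerProductSpace ℝ L := InnerProductSpace.complexToReal
  obtain ⟨R, hR⟩ := S.exists_resolvent hδ
  let P : L →L[ℂ] H := R ∘L ContinuousLinearMap.adjoint S.J
  have hP : ∀ φ f, inner ℂ (S.J φ) f = inner ℂ (S.J φ) (S.J (P f)) + δ * inner ℂ φ (P f) := by
    intro φ f
    rw [← ContinuousLinearMap.adjoint_inner_right, hR]
    rfl
  let Q : L →L[ℂ] L := S.J ∘L P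
  have hQself : ∀ f g, inner ℂ (Q f) g = inner ℂ f (Q g) := by
    intro f g
    have h1 := hP (P f) g
    have h2 := congrArg (starRingEnd ℂ) (hP (P g) f)
    simp only [map_add, map_mul, inner_conj_symm, Complex.conj_ofReal] at h2
    exact h1.trans h2.symm
  have hQpos : ∀ f, inner ℂ (Q f) f = ((‖Q f‖ ^ 2 + δ * ‖P f‖ ^ 2 : ℝ) : ℂ) := by
    intro f
    have h1 := hP (P f) f
    rw [inner_self_eq_norm_sq_to_K, inner_self_eq_norm_sq_to_K] at h1
    refine h1.trans ?_
    push_cast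
    rfl
  have hQle : ∀ f, ‖Q f‖ ≤ ‖f‖ := by
    intro f
    have h1 : ‖inner ℂ (Q f) f‖ ≤ ‖Q f‖ * ‖f‖ := norm_inner_le_norm _ _
    rw [hQpos, Complex.norm_real, Real.norm_of_nonneg (by positivity)] at h1
    rcases (norm_nonneg (Q f)).eq_or_lt with h0 | h0
    · rw [← h0]; exact norm_nonneg f
    · nlinarith [mul_nonneg hδ.le (sq_nonneg ‖P f‖)]
  -- The mollified right-hand side: the defining identity of `P` gives `(1 + D* D) P = δ⁻¹ (1 - Q)`,
  -- hence `D* D P = δ⁻¹ (1 - Q) - Q`.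
  let G : ℝ → L := fun s => (δ : ℂ)⁻¹ • (S.J (d s) - Q (S.J (d s))) - Q (S.J (d s)) - Q (n s)
  have hG : ContinuousOn G (Metric.ball t₀ r) :=
    (((hx.sub (Q.continuous.comp_continuousOn hx)).const_smul _).sub
      (Q.continuous.comp_continuousOn hx)).sub (Q.continuous.comp_continuousOn hn)
  have hsub : ∀ {s}, s ∈ Metric.ball t₀ r → Set.uIcc t₀ s ⊆ Metric.ball t₀ r := fun {s} hs =>
    (convex_ball t₀ r).ordConnected.uIcc_subset
      (Metric.mem_ball_self (Metric.pos_of_mem_ball hs)) hs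
  have hGint : ∀ s ∈ Metric.ball t₀ r, IntervalIntegrable G volume t₀ s := fun s hs =>
    (hG.mono (hsub hs)).intervalIntegrable
  have hy : ∀ s ∈ Metric.ball t₀ r, Q (S.J (d s)) = -Complex.I • ∫ τ in t₀..s, G τ := by
    intro s hs
    have key : ∀ f, inner ℂ f (Complex.I • Q (S.J (d s))) = inner ℂ f (∫ τ in t₀..s, G τ) := by
      intro f
      have h1 := heq (P f) s hs
      have h2 : inner ℂ (S.J (P f)) (S.J (d s)) = inner ℂ f (Q (S.J (d s))) := hQself f _
      rw [inner_smul_right, ← h2, h1]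
      have h3 : inner ℂ f (∫ τ in t₀..s, G τ) = ∫ τ in t₀..s, inner ℂ f (G τ) :=
        ((innerSL ℂ f).intervalIntegral_comp_comm (hGint s hs)).symm
      rw [h3]
      congr 1
      funext τ
      have h4 : inner ℂ (S.D (P f)) (S.D (d τ)) =
          inner ℂ (P f) (d τ) - inner ℂ (S.J (P f)) (S.J (d τ)) := by
        rw [S.inner_eq]; ring
      have h5 : (δ : ℂ) * inner ℂ (P f) (d τ) =
          inner ℂ f (S.J (d τ)) - inner ℂ (S.J (P f)) (S.J (d τ)) := by
        have h := congrArg (starRingEnd ℂ) (hP (d τ) f)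
        simp only [map_add, map_mul, inner_conj_symm, Complex.conj_ofReal] at h
        rw [h]; ring
      have h6 : ∀ x, inner ℂ f (Q x) = inner ℂ (S.J (P f)) x := fun x => (hQself f x).symm
      simp only [G, inner_sub_right, inner_smul_right, h6, h4]
      have hδ' : (δ : ℂ) ≠ 0 := by exact_mod_cast hδ.ne'
      rw [← h5]
      field_simp
    have h := ext_inner_left ℂ key
    rw [← h, smul_smul]
    simp
  have hderiv : ∀ s ∈ Metric.ball t₀ r,
      HasDerivAt (fun s => Q (S.J (d s))) (-Complex.I • G s) s := by
    intro s hs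
    have h1 : HasDerivAt (fun s => -Complex.I • ∫ τ in t₀..s, G τ) (-Complex.I • G s) s :=
      (intervalIntegral.integral_hasDerivAt_right (hGint s hs)
        (hG.stronglyMeasurableAtFilter Metric.isOpen_ball s hs)
        (hG.continuousAt (Metric.isOpen_ball.mem_nhds hs))).const_smul _
    refine h1.congr_of_eventuallyEq ?_
    filter_upwards [Metric.isOpen_ball.mem_nhds hs] with τ hτ using hy τ hτ
  have hre : ∀ s ∈ Metric.ball t₀ r,
      |2 * inner ℝ (Q (S.J (d s))) (-Complex.I • G s)| ≤ 2 * C * ‖S.J (d s)‖ ^ 2 := by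
    intro s hs
    -- By `hQpos` the linear terms of `G` have a real inner product with `Q J d`; the factor `-i`
    -- removes them from the real part.
    have h1 : inner ℝ (Q (S.J (d s))) (-Complex.I • G s) =
        (Complex.I * inner ℂ (Q (S.J (d s))) (Q (n s))).re := by
      rw [real_inner_eq_re_inner ℂ]
      simp only [G, inner_smul_right, inner_sub_right, hQpos, inner_self_eq_norm_sq_to_K]
      simp only [Complex.coe_algebraMap, ← Complex.ofReal_pow, ← Complex.ofReal_inv,
        RCLike.re_to_complex]
      simp only [Complex.neg_re, Complex.neg_im, Complex.mul_re, Complex.sub_re, Complex.sub_im,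
        Complex.I_re, Complex.I_im, Complex.ofReal_re, Complex.ofReal_im, Complex.mul_im]
      ring
    have h2 : ‖Complex.I * inner ℂ (Q (S.J (d s))) (Q (n s))‖ ≤
        ‖S.J (d s)‖ * (C * ‖S.J (d s)‖) := by
      rw [norm_mul, Complex.norm_I, one_mul]
      exact (norm_inner_le_norm _ _).trans
        (mul_le_mul (hQle _) ((hQle _).trans (hC s hs)) (norm_nonneg _) (norm_nonneg _))
    rw [abs_mul, abs_two, h1]
    have h3 := (Complex.abs_re_le_norm _).trans h2
    nlinarith
  have hQt : ‖Q (S.J (d t))‖ ^ 2 ≤ 2 * C * |∫ s in t₀..t, ‖S.J (d s)‖ ^ 2| := by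
    have ht₀ : Q (S.J (d t₀)) = 0 := by
      rw [hy t₀ (Metric.mem_ball_self (Metric.pos_of_mem_ball ht))]
      simp
    have hcont : ContinuousOn (fun s => 2 * inner ℝ (Q (S.J (d s))) (-Complex.I • G s))
        (Metric.ball t₀ r) :=
      continuousOn_const.mul ((Q.continuous.comp_continuousOn hx).inner (hG.const_smul _))
    have hftc := intervalIntegral.integral_eq_sub_of_hasDerivAt
      (fun s hs => (hderiv s (hsub ht hs)).norm_sq) (hcont.mono (hsub ht)).intervalIntegrable
    rw [ht₀, norm_zero, zero_pow two_ne_zero, sub_zero] at hftc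
    rw [← hftc]
    have hmaj : IntervalIntegrable (fun s => 2 * C * ‖S.J (d s)‖ ^ 2) volume t₀ t :=
      (continuousOn_const.mul ((hx.mono (hsub ht)).norm.pow 2)).intervalIntegrable
    have habs := intervalIntegral.norm_integral_le_abs_of_norm_le
      (f := fun s => 2 * inner ℝ (Q (S.J (d s))) (-Complex.I • G s))
      ((ae_restrict_mem measurableSet_uIoc).mono fun s hs =>
        hre s (hsub ht (Set.uIoc_subset_uIcc hs))) hmaj
    refine (le_abs_self _).trans (habs.trans ?_)
    rw [intervalIntegral.integral_const_mul, abs_mul]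
    rcases le_or_gt 0 C with h0 | h0
    · rw [abs_of_nonneg (by linarith : 0 ≤ 2 * C)]
    -- For `C < 0` the bound on `n` forces `J d = 0`.
    · have hzero : ∀ s ∈ Set.uIcc t₀ t, ‖S.J (d s)‖ ^ 2 = 0 := by
        intro s hs
        have h1 := (norm_nonneg _).trans (hC s (hsub ht hs))
        have h2 := norm_nonneg (S.J (d s))
        have h3 : ‖S.J (d s)‖ = 0 := by nlinarith
        rw [h3, zero_pow two_ne_zero]
      rw [intervalIntegral.integral_congr hzero]
      simp
  have happ : ‖S.J (d t) - Q (S.J (d t))‖ ≤ √δ * ‖d t‖ := by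
    set u := P (S.J (d t)) with hu
    -- Testing the equation of `u = P J d` with `d - u` gives `‖J (d - u)‖² + δ ‖d - u‖² = δ ⟪d - u,
    -- d⟫`.
    have h1 := hP (d t - u) (S.J (d t))
    rw [← hu] at h1
    have h2 : inner ℂ (S.J (d t - u)) (S.J (d t - u)) + δ * inner ℂ (d t - u) (d t - u) =
        δ * inner ℂ (d t - u) (d t) := by
      rw [map_sub, inner_sub_right, ← map_sub, h1, inner_sub_right (d t - u)]
      ring
    rw [inner_self_eq_norm_sq_to_K, inner_self_eq_norm_sq_to_K] at h2
    have h3 : ‖S.J (d t - u)‖ ^ 2 + δ * ‖d t - u‖ ^ 2 ≤ δ * (‖d t - u‖ * ‖d t‖) := by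
      have h4 : ((‖S.J (d t - u)‖ ^ 2 + δ * ‖d t - u‖ ^ 2 : ℝ) : ℂ) =
          δ * inner ℂ (d t - u) (d t) := by
        rw [← h2]; push_cast; rfl
      have h5 := congrArg norm h4
      rw [Complex.norm_real, Real.norm_of_nonneg (by positivity), norm_mul, Complex.norm_real,
        Real.norm_of_nonneg hδ.le] at h5
      rw [h5]
      exact mul_le_mul_of_nonneg_left (norm_inner_le_norm _ _) hδ.le
    have h6 : ‖d t - u‖ ≤ ‖d t‖ := by
      rcases (norm_nonneg (d t - u)).eq_or_lt with h0 | h0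
      · rw [← h0]; exact norm_nonneg _
      · have h7 : δ * ‖d t - u‖ * ‖d t - u‖ ≤ δ * ‖d t - u‖ * ‖d t‖ := by
          nlinarith [sq_nonneg ‖S.J (d t - u)‖]
        exact le_of_mul_le_mul_left h7 (by positivity)
    have h8 : S.J (d t) - Q (S.J (d t)) = S.J (d t - u) := by rw [map_sub]; rfl
    rw [h8]
    refine abs_le_of_sq_le_sq' ?_ (by positivity) |>.2
    rw [mul_pow, Real.sq_sqrt hδ.le]
    have h9 : ‖d t - u‖ * ‖d t‖ ≤ ‖d t‖ * ‖d t‖ := by gcongr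
    nlinarith [mul_le_mul_of_nonneg_left h9 hδ.le, mul_nonneg hδ.le (sq_nonneg ‖d t - u‖)]
  calc ‖S.J (d t)‖ = ‖Q (S.J (d t)) + (S.J (d t) - Q (S.J (d t)))‖ := by congr 1; abel
    _ ≤ ‖Q (S.J (d t))‖ + ‖S.J (d t) - Q (S.J (d t))‖ := norm_add_le _ _
    _ ≤ _ := add_le_add (Real.le_sqrt_of_sq_le hQt) happ

/-- Uniqueness for the weak form of `i d' = D* D d - J* n` with `‖n‖ ≤ C ‖J d‖`. -/
theorem eq_zero_of_weak_equation {d : ℝ → H} {n : ℝ → L} {C t₀ r : ℝ} (hC0 : 0 ≤ C)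
    (hx : ContinuousOn (fun t => S.J (d t)) (Metric.ball t₀ r))
    (hn : ContinuousOn n (Metric.ball t₀ r))
    (hC : ∀ t ∈ Metric.ball t₀ r, ‖n t‖ ≤ C * ‖S.J (d t)‖)
    (heq : ∀ φ, ∀ t ∈ Metric.ball t₀ r, Complex.I * inner ℂ (S.J φ) (S.J (d t)) =
      ∫ s in t₀..t, (inner ℂ (S.D φ) (S.D (d s)) - inner ℂ (S.J φ) (n s))) :
    ∀ t ∈ Metric.ball t₀ r, d t = 0 := by
  -- As `δ → 0` the mollified estimate becomes `‖J d‖² ≤ 2C |∫ ‖J d‖²|`.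
  have h := eq_zero_of_le_mul_abs_integral (C := 2 * C) (f := fun t => ‖S.J (d t)‖ ^ 2)
    (hx.norm.pow 2) (fun t => by positivity) (fun t ht => by
      have hlim : Tendsto (fun δ : ℝ => √(2 * C * |∫ s in t₀..t, ‖S.J (d s)‖ ^ 2|) + √δ * ‖d t‖)
          (𝓝[>] 0) (𝓝 (√(2 * C * |∫ s in t₀..t, ‖S.J (d s)‖ ^ 2|) + √0 * ‖d t‖)) :=
        ((by fun_prop : Continuous fun δ : ℝ =>
          √(2 * C * |∫ s in t₀..t, ‖S.J (d s)‖ ^ 2|) + √δ * ‖d t‖).tendsto 0).mono_left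
          nhdsWithin_le_nhds
      have h1 := ge_of_tendsto hlim (eventually_mem_nhdsWithin.mono fun δ hδ =>
        S.norm_sq_mollified_le hx hn hC heq hδ ht)
      rw [Real.sqrt_zero, zero_mul, add_zero] at h1
      have h2 := pow_le_pow_left₀ (norm_nonneg _) h1 2
      rwa [Real.sq_sqrt (by positivity)] at h2)
  intro t ht
  exact S.injective _ (norm_eq_zero.1 (pow_eq_zero_iff two_ne_zero |>.1 (h t ht)))

end EnergySpace

/-! ### Abstract semilinear Schrödinger equations: global existence, uniqueness, energy
conservation. -/

/-- Data of a semilinear Schrödinger equation `i v' = D* (a + D v) - J* N (J v)` over an energy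
space, where `-N` is the gradient of the nonnegative potential `V`, with a total set of test
vectors against which the nonlinearity is weakly continuous. -/
structure SemilinearData {H L : Type*} [NormedAddCommGroup H] [InnerProductSpace ℂ H]
    [CompleteSpace H] [NormedAddCommGroup L] [InnerProductSpace ℂ L] [CompleteSpace L]
    (S : EnergySpace H L) where
  a : L
  N : L → L
  V : L → ℝ
  K : NNReal
  B : ℝ
  C : ℝ
  tests : Set H
  lipschitz_N : LipschitzWith K N
  V_nonneg : ∀ u, 0 ≤ V u
  C_nonneg : 0 ≤ C
  norm_N_sq_le : ∀ u, ‖N u‖ ^ 2 ≤ C * V u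
  V_quadratic : ∀ u h, |V (u + h) - V u + (inner ℂ (N u) h).re| ≤ B * ‖h‖ ^ 2
  dense_tests : (Submodule.span ℂ tests).topologicalClosure = ⊤
  test_deriv : ∀ φ ∈ tests, ∃ ψ : L, ∀ w, inner ℂ (S.D φ) (S.D w) = inner ℂ ψ (S.J w)
  weak_N : ∀ φ ∈ tests, ∀ (l : Ultrafilter ℕ) (v : ℕ → H) (w : H) (R : ℝ), (∀ n, ‖v n‖ ≤ R) →
    (∀ h, Tendsto (fun n => inner ℂ (v n) h) l (𝓝 (inner ℂ w h))) →
    Tendsto (fun n => inner ℂ (S.J φ) (N (S.J (v n)))) l (𝓝 (inner ℂ (S.J φ) (N (S.J w))))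
  weak_V : ∀ (l : Ultrafilter ℕ) (v : ℕ → H) (w : H) (R p : ℝ), (∀ n, ‖v n‖ ≤ R) →
    (∀ h, Tendsto (fun n => inner ℂ (v n) h) l (𝓝 (inner ℂ w h))) →
    Tendsto (fun n => V (S.J (v n))) l (𝓝 p) → V (S.J w) ≤ p

namespace SemilinearData

variable {H L : Type*} [NormedAddCommGroup H] [InnerProductSpace ℂ H] [CompleteSpace H]
  [NormedAddCommGroup L] [InnerProductSpace ℂ L] [CompleteSpace L] {S : EnergySpace H L}
  (W : SemilinearData S)

/-- The conserved energy. -/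
noncomputable def energy (v : H) : ℝ := 1 / 2 * ‖W.a + S.D v‖ ^ 2 + W.V (S.J v)

/-- The gradient of the energy. -/
noncomputable def gradient (v : H) : H :=
  ContinuousLinearMap.adjoint S.D (W.a + S.D v) - ContinuousLinearMap.adjoint S.J (W.N (S.J v))

theorem inner_gradient (φ v : H) : inner ℂ φ (W.gradient v) =
    inner ℂ (S.D φ) (W.a + S.D v) - inner ℂ (S.J φ) (W.N (S.J v)) := by
  rw [gradient, inner_sub_right, ContinuousLinearMap.adjoint_inner_right,
    ContinuousLinearMap.adjoint_inner_right]

theorem exists_lipschitz_gradient : ∃ K : NNReal, LipschitzWith K W.gradient :=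
  ⟨_, (((ContinuousLinearMap.adjoint S.D).lipschitz.comp
    ((LipschitzWith.const W.a).add S.D.lipschitz)).sub
    ((ContinuousLinearMap.adjoint S.J).lipschitz.comp (W.lipschitz_N.comp S.J.lipschitz)))⟩

theorem V_le_energy (v : H) : W.V (S.J v) ≤ W.energy v := by
  rw [energy]; nlinarith [sq_nonneg ‖W.a + S.D v‖]

theorem norm_deriv_le {v : H} {M : ℝ} (h : W.energy v ≤ M) : ‖W.a + S.D v‖ ≤ √(2 * M) := by
  refine Real.le_sqrt_of_sq_le ?_
  have := W.V_nonneg (S.J v)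
  rw [energy] at h
  linarith

theorem norm_N_le {v : H} {M : ℝ} (h : W.energy v ≤ M) : ‖W.N (S.J v)‖ ≤ √(W.C * M) := by
  refine Real.le_sqrt_of_sq_le ((W.norm_N_sq_le _).trans ?_)
  exact mul_le_mul_of_nonneg_left ((W.V_le_energy v).trans h) W.C_nonneg

theorem hasDerivAt_V {u : ℝ → L} {u' : L} {t : ℝ} (hu : HasDerivAt u u' t) :
    HasDerivAt (fun t => W.V (u t)) (-(inner ℂ (W.N (u t)) u').re) t := by
  have h : HasFDerivAt W.V
      (-(Complex.reCLM ∘L (innerSL ℂ (W.N (u t))).restrictScalars ℝ) : L →L[ℝ] ℝ) (u t) := by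
    rw [hasFDerivAt_iff_isLittleO_nhds_zero]
    refine Asymptotics.IsBigO.trans_isLittleO (g := fun h : L => ‖h‖ ^ 2)
      (Asymptotics.IsBigO.of_bound W.B (Eventually.of_forall fun h => ?_))
      (Asymptotics.isLittleO_norm_pow_id one_lt_two)
    have := W.V_quadratic (u t) h
    rw [Real.norm_of_nonneg (by positivity : (0 : ℝ) ≤ ‖h‖ ^ 2), Real.norm_eq_abs]
    convert this using 2
    simp
  exact h.comp_hasDerivAt t hu

theorem continuous_V : Continuous W.V := by
  rw [continuous_iff_continuousAt]
  intro u
  have h : Tendsto (fun w => W.V u + (‖inner ℂ (W.N u) (w - u)‖ + W.B * ‖w - u‖ ^ 2)) (𝓝 u)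
      (𝓝 (W.V u + (‖inner ℂ (W.N u) (u - u)‖ + W.B * ‖u - u‖ ^ 2))) :=
    Continuous.tendsto (by fun_prop) u
  have h' : Tendsto (fun w => W.V u - (‖inner ℂ (W.N u) (w - u)‖ + W.B * ‖w - u‖ ^ 2)) (𝓝 u)
      (𝓝 (W.V u - (‖inner ℂ (W.N u) (u - u)‖ + W.B * ‖u - u‖ ^ 2))) :=
    Continuous.tendsto (by fun_prop) u
  simp only [sub_self, inner_zero_right, norm_zero, ne_eq, OfNat.ofNat_ne_zero, not_false_eq_true,
    zero_pow, mul_zero, add_zero, sub_zero] at h h'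
  refine tendsto_of_tendsto_of_tendsto_of_le_of_le h' h (fun w => ?_) (fun w => ?_)
  all_goals
    have h1 := abs_le.1 (W.V_quadratic u (w - u))
    have h2 := abs_le.1 (Complex.abs_re_le_norm (inner ℂ (W.N u) (w - u)))
    rw [add_sub_cancel] at h1
    simp only
    linarith [h1.1, h1.2, h2.1, h2.2]

/-- With `J* J + ε` in place of `J* J` the equation reads `v' = -i R (gradient v)`, an ordinary
differential equation with globally Lipschitz field. The regularization keeps the Hamiltonian
structure, so the energy is conserved exactly. -/
theorem exists_regularized_solution {ε : ℝ} (hε : 0 < ε) (v₀ : H) :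
    ∃ v : ℝ → H, v 0 = v₀ ∧ Continuous v ∧ (∀ t, W.energy (v t) = W.energy v₀) ∧
      ∀ φ s t, Complex.I * (inner ℂ (S.J φ) (S.J (v t - v s)) + ε * inner ℂ φ (v t - v s)) =
        ∫ τ in s..t, inner ℂ φ (W.gradient (v τ)) := by
  let _ : InnerProductSpace ℝ L := InnerProductSpace.complexToReal
  obtain ⟨R, hR⟩ := S.exists_resolvent hε
  obtain ⟨K, hK⟩ := W.exists_lipschitz_gradient
  have hlip : LipschitzWith (‖-Complex.I • R‖₊ * K) fun v => (-Complex.I • R) (W.gradient v) :=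
    (-Complex.I • R).lipschitz.comp hK
  obtain ⟨v, hv0, hv⟩ := hlip.exists_global_integralCurve v₀
  have hcont : Continuous v := continuous_iff_continuousAt.2 fun t => (hv t).continuousAt
  refine ⟨v, hv0, hcont, ?_, ?_⟩
  · have hderiv : ∀ t, HasDerivAt (fun t => W.energy (v t)) 0 t := by
      intro t
      have h1 : HasDerivAt (fun t => S.J (v t)) (S.J ((-Complex.I • R) (W.gradient (v t)))) t :=
        (S.J.restrictScalars ℝ).hasFDerivAt.comp_hasDerivAt t (hv t)
      have h2 : HasDerivAt (fun t => W.a + S.D (v t))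
          (S.D ((-Complex.I • R) (W.gradient (v t)))) t :=
        ((S.D.restrictScalars ℝ).hasFDerivAt.comp_hasDerivAt t (hv t)).const_add _
      have h3 := (h2.norm_sq.const_mul (1 / 2)).add (W.hasDerivAt_V h1)
      convert! h3 using 1
      set G := W.gradient (v t) with hG
      have h4 : inner ℂ G ((-Complex.I • R) G) =
          inner ℂ (W.a + S.D (v t)) (S.D ((-Complex.I • R) G)) -
            inner ℂ (W.N (S.J (v t))) (S.J ((-Complex.I • R) G)) := by
        rw [hG, gradient, inner_sub_left, ContinuousLinearMap.adjoint_inner_left,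
          ContinuousLinearMap.adjoint_inner_left]
      -- The identity defining `R`, tested with `R G`, shows that `⟪R G, G⟫` is real.
      have h5 : (inner ℂ G ((-Complex.I • R) G)).re = 0 := by
        have h6 := congrArg (starRingEnd ℂ) (hR G (R G))
        simp only [inner_conj_symm, inner_self_eq_norm_sq_to_K] at h6
        rw [smul_apply, inner_smul_right, h6]
        simp [← Complex.ofReal_pow]
      rw [real_inner_eq_re_inner ℂ]
      rw [h4, Complex.sub_re] at h5
      simp only [RCLike.re_to_complex]
      linarith
    intro t
    rw [← hv0]
    exact is_const_of_deriv_eq_zero (fun t => (hderiv t).differentiableAt)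
      (fun t => (hderiv t).deriv) t 0
  · intro φ s t
    let ℓ : H →L[ℂ] ℂ := innerSL ℂ (ContinuousLinearMap.adjoint S.J (S.J φ) + (ε : ℂ) • φ)
    have hℓ : ∀ x, ℓ x = inner ℂ (S.J φ) (S.J x) + ε * inner ℂ φ x := by
      intro x
      simp only [ℓ, innerSL_apply_apply, inner_add_left, ContinuousLinearMap.adjoint_inner_left,
        inner_smul_left, Complex.conj_ofReal]
    have h1 : ∀ τ, HasDerivAt (fun τ => ℓ (v τ)) (-Complex.I * inner ℂ φ (W.gradient (v τ))) τ := by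
      intro τ
      have h2 := (ℓ.restrictScalars ℝ).hasFDerivAt.comp_hasDerivAt τ (hv τ)
      refine h2.congr_deriv ?_
      rw [hR, ← hℓ, ContinuousLinearMap.coe_restrictScalars', smul_apply, map_smul, smul_eq_mul]
    have h3 : Continuous fun τ => inner ℂ φ (W.gradient (v τ)) :=
      continuous_const.inner (hK.continuous.comp hcont)
    have h4 := intervalIntegral.integral_eq_sub_of_hasDerivAt (fun τ _ => h1 τ)
      ((continuous_const.mul h3).intervalIntegrable s t)
    rw [← hℓ, map_sub, ← h4, intervalIntegral.integral_const_mul, ← mul_assoc]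
    simp

/-- The modulus of continuity in `L` of trajectories of energy at most `M`. -/
noncomputable def modulus (M τ : ℝ) : ℝ := √(4 * M * τ) + √(W.C * M) * τ

theorem continuous_modulus (M : ℝ) : Continuous (W.modulus M) := by
  unfold modulus; fun_prop

/-- The increment `w` is tested against itself. The term `ε ‖w‖²` has a good sign, so the estimate
is uniform in `ε`; the constant `4M` is the product of the bounds `2 √(2M)` for `D w` and `√(2M)`
for `a + D v`. -/
theorem norm_sub_le_modulus {ε M : ℝ} (hε : 0 ≤ ε) {v : ℝ → H}
    (hM : ∀ t, W.energy (v t) ≤ M)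
    (heq : ∀ φ s t,
      Complex.I * (inner ℂ (S.J φ) (S.J (v t - v s)) + ε * inner ℂ φ (v t - v s)) =
        ∫ τ in s..t, inner ℂ φ (W.gradient (v τ))) (s t : ℝ) :
    ‖S.J (v s) - S.J (v t)‖ ≤ W.modulus M |s - t| := by
  have hM0 : 0 ≤ M := by
    refine le_trans ?_ (hM 0)
    have := W.V_nonneg (S.J (v 0))
    rw [energy]; positivity
  set w := v t - v s with hw
  have h1 := heq w s t
  rw [← hw, inner_self_eq_norm_sq_to_K, inner_self_eq_norm_sq_to_K] at h1
  have hDw : ‖S.D w‖ ≤ 2 * √(2 * M) := by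
    have : S.D w = (W.a + S.D (v t)) - (W.a + S.D (v s)) := by rw [hw, map_sub]; abel
    rw [this]
    exact (norm_sub_le _ _).trans (by linarith [W.norm_deriv_le (hM t), W.norm_deriv_le (hM s)])
  have h2 : ‖S.J w‖ ^ 2 ≤ (4 * M + √(W.C * M) * ‖S.J w‖) * |t - s| := by
    have h3 : ‖∫ τ in s..t, inner ℂ w (W.gradient (v τ))‖ ≤
        (4 * M + √(W.C * M) * ‖S.J w‖) * |t - s| := by
      refine intervalIntegral.norm_integral_le_of_norm_le_const fun τ _ => ?_
      rw [W.inner_gradient]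
      refine (norm_sub_le _ _).trans (add_le_add ?_ ?_)
      · refine (norm_inner_le_norm _ _).trans ?_
        calc _ ≤ 2 * √(2 * M) * √(2 * M) := by
              gcongr; exact W.norm_deriv_le (hM τ)
          _ = 4 * M := by rw [mul_assoc, Real.mul_self_sqrt (by positivity)]; ring
      · refine (norm_inner_le_norm _ _).trans ?_
        rw [mul_comm]
        gcongr
        exact W.norm_N_le (hM τ)
    rw [← h1, norm_mul, Complex.norm_I, one_mul] at h3
    have h4 : ((RCLike.ofReal ‖S.J w‖ : ℂ) ^ 2 + ε * (RCLike.ofReal ‖w‖ : ℂ) ^ 2) =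
        ((‖S.J w‖ ^ 2 + ε * ‖w‖ ^ 2 : ℝ) : ℂ) := by push_cast; rfl
    rw [h4, Complex.norm_real, Real.norm_of_nonneg (by positivity)] at h3
    nlinarith [mul_nonneg hε (sq_nonneg ‖w‖)]
  have h5 : S.J (v s) - S.J (v t) = -S.J w := by rw [hw, map_sub]; abel
  rw [h5, norm_neg, abs_sub_comm, modulus]
  -- From `x² ≤ A² + B x` with nonnegative terms it follows that `x ≤ A + B`.
  by_contra! hlt
  set A := √(4 * M * |t - s|)
  set Bt := √(W.C * M) * |t - s|
  have hA : A ^ 2 = 4 * M * |t - s| := Real.sq_sqrt (by positivity)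
  have hA0 : 0 ≤ A := Real.sqrt_nonneg _
  have hB0 : 0 ≤ Bt := by positivity
  have h6 : ‖S.J w‖ ^ 2 ≤ A ^ 2 + Bt * ‖S.J w‖ := by rw [hA]; simp only [Bt]; linarith
  nlinarith

/-- Weak solutions: the equation is tested against `H` and integrated in time. -/
structure IsWeakSolution (v : ℝ → H) : Prop where
  continuous_J : Continuous fun t => S.J (v t)
  continuous_inner : ∀ φ, Continuous fun t => inner ℂ φ (v t)
  equation : ∀ φ t, Complex.I * inner ℂ (S.J φ) (S.J (v t) - S.J (v 0)) =
    ∫ τ in (0 : ℝ)..t, inner ℂ φ (W.gradient (v τ))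

variable {W}

theorem IsWeakSolution.continuous_inner_gradient {v : ℝ → H} (hv : W.IsWeakSolution v) (φ : H) :
    Continuous fun t => inner ℂ φ (W.gradient (v t)) := by
  have h : (fun t => inner ℂ φ (W.gradient (v t))) = fun t =>
      inner ℂ (S.D φ) W.a + inner ℂ (ContinuousLinearMap.adjoint S.D (S.D φ)) (v t) -
        inner ℂ (S.J φ) (W.N (S.J (v t))) := by
    funext t
    rw [W.inner_gradient, inner_add_right, ContinuousLinearMap.adjoint_inner_left]
  rw [h]
  exact (continuous_const.add (hv.continuous_inner _)).sub
    (continuous_const.inner (W.lipschitz_N.continuous.comp hv.continuous_J))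

theorem IsWeakSolution.equation_between {v : ℝ → H} (hv : W.IsWeakSolution v) (φ : H) (s t : ℝ) :
    Complex.I * inner ℂ (S.J φ) (S.J (v t) - S.J (v s)) =
      ∫ τ in s..t, inner ℂ φ (W.gradient (v τ)) := by
  have hi := fun a b => (hv.continuous_inner_gradient φ).intervalIntegrable (μ := volume) a b
  rw [← intervalIntegral.integral_interval_sub_left (hi 0 t) (hi 0 s), ← hv.equation φ t,
    ← hv.equation φ s, ← mul_sub, ← inner_sub_right]
  congr 2
  abel

theorem IsWeakSolution.comp_add {v : ℝ → H} (hv : W.IsWeakSolution v) (s : ℝ) :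
    W.IsWeakSolution fun t => v (s + t) where
  continuous_J := hv.continuous_J.comp (continuous_const.add continuous_id)
  continuous_inner φ := (hv.continuous_inner φ).comp (continuous_const.add continuous_id)
  equation φ t := by
    have h := hv.equation_between φ s (s + t)
    rw [intervalIntegral.integral_comp_add_left (fun τ => inner ℂ φ (W.gradient (v τ))), add_zero]
    exact h

/-- The estimate is two-sided in time and needs no energy bound, so solutions can also be followed
backwards. -/
theorem IsWeakSolution.eq {v w : ℝ → H} (hv : W.IsWeakSolution v) (hw : W.IsWeakSolution w)
    (h0 : v 0 = w 0) : v = w := by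
  funext t
  have h := S.eq_zero_of_weak_equation (d := fun t => v t - w t)
    (n := fun t => W.N (S.J (v t)) - W.N (S.J (w t))) (C := W.K) (t₀ := 0) (r := |t| + 1)
    W.K.coe_nonneg
    (by simp only [map_sub]; exact (hv.continuous_J.sub hw.continuous_J).continuousOn)
    ((W.lipschitz_N.continuous.comp hv.continuous_J).sub
      (W.lipschitz_N.continuous.comp hw.continuous_J)).continuousOn
    (fun t _ => by rw [map_sub]; exact W.lipschitz_N.norm_sub_le _ _)
    (fun φ t _ => by
      have h1 := hv.equation φ t
      have h2 := hw.equation φ t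
      have h3 : inner ℂ (S.J φ) (S.J (v t - w t)) =
          inner ℂ (S.J φ) (S.J (v t) - S.J (v 0)) - inner ℂ (S.J φ) (S.J (w t) - S.J (w 0)) := by
        rw [h0, ← inner_sub_right, map_sub]; congr 1; abel
      rw [h3, mul_sub, h1, h2, ← intervalIntegral.integral_sub
        ((hv.continuous_inner_gradient φ).intervalIntegrable _ _)
        ((hw.continuous_inner_gradient φ).intervalIntegrable _ _)]
      congr 1
      funext τ
      simp only [W.inner_gradient, map_sub, inner_sub_right, inner_add_right]
      ring) t (by simp [Metric.mem_ball])
  exact sub_eq_zero.1 h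

variable (W)

/-- Weak limit of the regularized solutions with `ε = 1 / (n + 1)`. Only an energy inequality
survives the limit. Convergence of the nonlinearity is available on test vectors alone; the equation
for all `φ` follows by density. -/
theorem exists_weakSolution (v₀ : H) :
    ∃ v : ℝ → H, v 0 = v₀ ∧ W.IsWeakSolution v ∧ ∀ t, W.energy (v t) ≤ W.energy v₀ := by
  set M := W.energy v₀ with hMdef
  have hε : ∀ n : ℕ, (0 : ℝ) < 1 / ((n : ℝ) + 1) := fun n => by positivity
  choose u hu0 hucont huE hueq using fun n : ℕ => W.exists_regularized_solution (hε n) v₀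
  have humod : ∀ n s t, ‖S.J (u n s) - S.J (u n t)‖ ≤ W.modulus M |s - t| := fun n =>
    W.norm_sub_le_modulus (hε n).le (fun t => (huE n t).le) (hueq n)
  have hmod0 : Tendsto (W.modulus M) (𝓝 0) (𝓝 0) := by
    have := (W.continuous_modulus M).tendsto 0
    simpa [modulus] using this
  let R : ℝ → ℝ := fun t => ‖S.J v₀‖ + W.modulus M |t| + (√(2 * M) + ‖W.a‖)
  have hR : ∀ n t, ‖u n t‖ ≤ R t := by
    intro n t
    refine (S.norm_le_add _).trans (add_le_add ?_ ?_)
    · have h1 := humod n t 0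
      rw [hu0, sub_zero] at h1
      linarith [norm_le_norm_add_norm_sub' (S.J (u n t)) (S.J v₀)]
    · have h1 := W.norm_deriv_le (huE n t).le
      calc ‖S.D (u n t)‖ = ‖(W.a + S.D (u n t)) - W.a‖ := by congr 1; abel
        _ ≤ _ := (norm_sub_le _ _).trans (by linarith)
  -- An ultrafilter yields weak limits at all times at once, with no extraction of subsequences.
  let l : Ultrafilter ℕ := hyperfilter ℕ
  have hl : (l : Filter ℕ) ≤ atTop := Nat.hyperfilter_le_atTop
  choose v hv using fun t => l.exists_forall_tendsto_inner
    (v := fun n => u n t) (R := R t) (Eventually.of_forall fun n => hR n t)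
  have hv' : ∀ t h, Tendsto (fun n => inner ℂ h (u n t)) l (𝓝 (inner ℂ h (v t))) := by
    intro t h
    have := (Complex.continuous_conj.tendsto _).comp (hv t h)
    simpa only [Function.comp_def, inner_conj_symm] using this
  have hvJ : ∀ t (g : L),
      Tendsto (fun n => inner ℂ (S.J (u n t)) g) l (𝓝 (inner ℂ (S.J (v t)) g)) := by
    intro t g
    simpa only [ContinuousLinearMap.adjoint_inner_right] using
      hv t (ContinuousLinearMap.adjoint S.J g)
  have hvD : ∀ t (g : L),
      Tendsto (fun n => inner ℂ (S.D (u n t)) g) l (𝓝 (inner ℂ (S.D (v t)) g)) := by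
    intro t g
    simpa only [ContinuousLinearMap.adjoint_inner_right] using
      hv t (ContinuousLinearMap.adjoint S.D g)
  have hv0 : v 0 = v₀ := by
    refine ext_inner_right ℂ fun h => tendsto_nhds_unique (hv 0 h) ?_
    simp only [hu0]
    exact tendsto_const_nhds
  have hvmod : ∀ s t, ‖S.J (v s) - S.J (v t)‖ ≤ W.modulus M |s - t| := fun s t =>
    norm_le_of_forall_tendsto_inner (l := (l : Filter ℕ))
      (v := fun n => S.J (u n s) - S.J (u n t))
      (fun h => by simpa only [inner_sub_left] using (hvJ s h).sub (hvJ t h))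
      tendsto_const_nhds (Eventually.of_forall fun n => humod n s t)
  have hvcont : Continuous fun t => S.J (v t) := by
    rw [continuous_iff_continuousAt]
    intro t
    rw [ContinuousAt, tendsto_iff_norm_sub_tendsto_zero]
    have h1 : Tendsto (fun s => W.modulus M |s - t|) (𝓝 t) (𝓝 0) := by
      refine hmod0.comp ?_
      simpa using (by fun_prop : Continuous fun s : ℝ => |s - t|).tendsto t
    exact squeeze_zero (fun s => norm_nonneg _) (fun s => hvmod s t) h1
  have hRcont : Continuous R := by
    have := (W.continuous_modulus M).comp (continuous_abs (G := ℝ))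
    exact (continuous_const.add this).add continuous_const
  have hvR : ∀ t, ‖v t‖ ≤ R t := fun t =>
    norm_le_of_forall_tendsto_inner (hv t) tendsto_const_nhds (Eventually.of_forall fun n => hR n t)
  have hvweak := S.continuous_inner hvcont hRcont hvR
  have hvE : ∀ t, W.energy (v t) ≤ M := by
    intro t
    -- Along `l` the potential terms converge to some `p`, so the squared norms of `a + D u`
    -- converge to `2 (M - p)`; semicontinuity of each part gives a total of at most `M`.
    have hmem : ∀ᶠ n in (l : Filter ℕ), W.V (S.J (u n t)) ∈ Set.Icc 0 M :=
      Eventually.of_forall fun n => ⟨W.V_nonneg _, (W.V_le_energy _).trans (huE n t).le⟩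
    obtain ⟨p, hp, hpl⟩ := isCompact_Icc.ultrafilter_le_nhds
      (l.map fun n => W.V (S.J (u n t))) (by rw [le_principal_iff]; exact hmem)
    have hpl' : Tendsto (fun n => W.V (S.J (u n t))) l (𝓝 p) := hpl
    have h1 := W.weak_V l (fun n => u n t) (v t) (R t) p (fun n => hR n t) (hv t) hpl'
    have h2 : ‖W.a + S.D (v t)‖ ≤ √(2 * (M - p)) := by
      refine norm_le_of_forall_tendsto_inner (l := (l : Filter ℕ))
        (v := fun n => W.a + S.D (u n t)) (r := fun n => √(2 * (M - W.V (S.J (u n t)))))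
        (fun h => ?_)
        ((Real.continuous_sqrt.tendsto _).comp ((hpl'.const_sub M).const_mul 2))
        (Eventually.of_forall fun n => Real.le_sqrt_of_sq_le ?_)
      · simpa only [inner_add_left] using (hvD t h).const_add (inner ℂ W.a h)
      · have := huE n t
        rw [energy] at this
        linarith
    have h3 : ‖W.a + S.D (v t)‖ ^ 2 ≤ 2 * (M - p) := by
      have h4 := pow_le_pow_left₀ (norm_nonneg _) h2 2
      rwa [Real.sq_sqrt (by linarith [hp.2])] at h4
    rw [energy]
    linarith
  refine ⟨v, hv0, ⟨hvcont, hvweak, ?_⟩, hvE⟩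
  intro φ t
  have hgrad : ∀ φ, Continuous fun τ => inner ℂ φ (W.gradient (v τ)) := by
    intro φ
    have h : (fun t => inner ℂ φ (W.gradient (v t))) = fun t =>
        inner ℂ (S.D φ) W.a + inner ℂ (ContinuousLinearMap.adjoint S.D (S.D φ)) (v t) -
          inner ℂ (S.J φ) (W.N (S.J (v t))) := by
      funext t
      rw [W.inner_gradient, inner_add_right, ContinuousLinearMap.adjoint_inner_left]
    rw [h]
    exact (continuous_const.add (hvweak _)).sub
      (continuous_const.inner (W.lipschitz_N.continuous.comp hvcont))
  have hlhs : ∀ φ, Complex.I * inner ℂ (S.J φ) (S.J (v t) - S.J (v 0)) =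
      inner ℂ φ (Complex.I • ContinuousLinearMap.adjoint S.J (S.J (v t) - S.J (v 0))) := by
    intro φ
    rw [inner_smul_right, ContinuousLinearMap.adjoint_inner_right]
  obtain ⟨KG, hKG⟩ := W.exists_lipschitz_gradient
  obtain ⟨C, hC⟩ : ∃ C, ∀ s ∈ Set.uIcc 0 t, R s ≤ C := by
    obtain ⟨C, hC⟩ := (isCompact_uIcc.image (f := R) (s := Set.uIcc 0 t) hRcont).bddAbove
    exact ⟨C, fun s hs => hC ⟨s, hs, rfl⟩⟩
  rw [hlhs]
  refine inner_eq_integral_of_total W.dense_tests (C := ‖W.gradient 0‖ + KG * C)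
    (fun φ => (hgrad φ).continuousOn) (fun s hs => ?_) (fun φ hφ => ?_) φ
  · have h1 := hKG.norm_sub_le (v s) 0
    rw [sub_zero] at h1
    have h2 : (KG : ℝ) * ‖v s‖ ≤ KG * C := by gcongr; exact (hvR s).trans (hC s hs)
    linarith [norm_le_norm_add_norm_sub' (W.gradient (v s)) (W.gradient 0)]
  · rw [← hlhs]
    obtain ⟨ψ, hψ⟩ := W.test_deriv φ hφ
    have hgradtest : ∀ w, inner ℂ φ (W.gradient w) =
        inner ℂ (S.D φ) W.a + inner ℂ ψ (S.J w) - inner ℂ (S.J φ) (W.N (S.J w)) := by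
      intro w
      rw [W.inner_gradient, inner_add_right, hψ]
    have hrhs : Tendsto (fun n => ∫ τ in (0 : ℝ)..t, inner ℂ φ (W.gradient (u n τ))) l
        (𝓝 (∫ τ in (0 : ℝ)..t, inner ℂ φ (W.gradient (v τ)))) := by
      -- On a test vector the derivative moves to `ψ`, so the integrand depends on `J u` only and
      -- inherits its modulus, uniformly in `n`.
      refine tendsto_intervalIntegral_of_modulus
        (m := fun τ => (‖ψ‖ + ‖S.J φ‖ * W.K) * W.modulus M τ)
        (by simpa using hmod0.const_mul (‖ψ‖ + ‖S.J φ‖ * W.K))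
        (fun n => continuous_const.inner (hKG.continuous.comp (hucont n))) (hgrad φ)
        (fun n s t => ?_) (fun s => ?_)
      · have h1 : inner ℂ φ (W.gradient (u n s)) - inner ℂ φ (W.gradient (u n t)) =
            inner ℂ ψ (S.J (u n s) - S.J (u n t)) -
              inner ℂ (S.J φ) (W.N (S.J (u n s)) - W.N (S.J (u n t))) := by
          rw [hgradtest, hgradtest, inner_sub_right, inner_sub_right]; ring
        rw [h1, add_mul]
        refine (norm_sub_le _ _).trans (add_le_add ?_ ?_)
        · refine (norm_inner_le_norm _ _).trans ?_
          gcongr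
          exact humod n s t
        · refine (norm_inner_le_norm _ _).trans ?_
          rw [mul_assoc]
          gcongr
          refine (W.lipschitz_N.norm_sub_le _ _).trans ?_
          gcongr
          exact humod n s t
      · simp only [hgradtest]
        refine (Tendsto.const_add _ ?_).sub
          (W.weak_N φ hφ l (fun n => u n s) (v s) (R s) (fun n => hR n s) (hv s))
        simpa only [ContinuousLinearMap.adjoint_inner_left] using
          hv' s (ContinuousLinearMap.adjoint S.J ψ)
    refine tendsto_nhds_unique ?_ hrhs
    simp only [← hueq]
    have h1 : Tendsto (fun n => inner ℂ (S.J φ) (S.J (u n t - u n 0))) l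
        (𝓝 (inner ℂ (S.J φ) (S.J (v t) - S.J (v 0)))) := by
      simp only [map_sub, inner_sub_right]
      have := fun s => hv' s (ContinuousLinearMap.adjoint S.J (S.J φ))
      simp only [ContinuousLinearMap.adjoint_inner_left] at this
      exact (this t).sub (this 0)
    have h2 : Tendsto (fun n : ℕ => ((1 / ((n : ℝ) + 1) : ℝ) : ℂ) * inner ℂ φ (u n t - u n 0)) l
        (𝓝 (((0 : ℝ) : ℂ) * inner ℂ φ (v t - v 0))) := by
      refine Tendsto.mul ?_ ?_
      · exact (Complex.continuous_ofReal.tendsto 0).comp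
          (tendsto_one_div_add_atTop_nhds_zero_nat.mono_left hl)
      · simp only [inner_sub_right]
        exact (hv' t φ).sub (hv' 0 φ)
    have h3 := (h1.add h2).const_mul Complex.I
    simpa using h3

/-- Global existence, with conservation of the energy and strong continuity. -/
theorem exists_continuous_weakSolution (v₀ : H) :
    ∃ v : ℝ → H, v 0 = v₀ ∧ Continuous v ∧ W.IsWeakSolution v ∧
      ∀ t, W.energy (v t) = W.energy v₀ := by
  obtain ⟨v, hv0, hv, hle⟩ := W.exists_weakSolution v₀
  have hE : ∀ t, W.energy (v t) = W.energy v₀ := by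
    intro t
    refine le_antisymm (hle t) ?_
    -- By uniqueness the solution issued from `v t` returns to `v₀` at time `-t`, which gives the
    -- reverse inequality.
    obtain ⟨w, hw0, hw, hwle⟩ := W.exists_weakSolution (v t)
    have h := congrFun (hw.eq (hv.comp_add t) (by rw [hw0, add_zero])) (-t)
    have h1 := hwle (-t)
    rw [h] at h1
    simpa [hv0] using h1
  refine ⟨v, hv0, ?_, hv, hE⟩
  rw [continuous_iff_continuousAt]
  intro t₀
  -- Conservation expresses `‖a + D v‖²` through the potential, which is continuous along `J v`; the
  -- cross term is continuous by weak continuity.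
  have hnorm : ∀ t, ‖v t - v t₀‖ ^ 2 = ‖S.J (v t) - S.J (v t₀)‖ ^ 2 +
      (2 * (W.energy v₀ - W.V (S.J (v t))) + 2 * (W.energy v₀ - W.V (S.J (v t₀))) -
        2 * (inner ℂ (W.a + S.D (v t₀)) W.a + inner ℂ
          (ContinuousLinearMap.adjoint S.D (W.a + S.D (v t₀))) (v t)).re) := by
    intro t
    have hA : ∀ t, ‖W.a + S.D (v t)‖ ^ 2 = 2 * (W.energy v₀ - W.V (S.J (v t))) := fun t => by
      rw [← hE t, energy]; ring
    rw [S.norm_sq, map_sub, map_sub, ← hA, ← hA, ContinuousLinearMap.adjoint_inner_left,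
      ← inner_add_right]
    have h1 : S.D (v t) - S.D (v t₀) = (W.a + S.D (v t)) - (W.a + S.D (v t₀)) := by abel
    rw [h1, @norm_sub_sq ℂ _ _ _ _ (W.a + S.D (v t)), ← inner_re_symm]
    simp only [RCLike.re_to_complex]
    ring
  have hcont : Continuous fun t => ‖v t - v t₀‖ ^ 2 := by
    simp only [hnorm]
    have h1 := hv.continuous_J
    have h2 := W.continuous_V.comp hv.continuous_J
    have h3 := hv.continuous_inner (ContinuousLinearMap.adjoint S.D (W.a + S.D (v t₀)))
    exact ((h1.sub continuous_const).norm.pow 2).add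
      (((continuous_const.mul (continuous_const.sub h2)).add continuous_const).sub
        (continuous_const.mul (Complex.continuous_re.comp (continuous_const.add h3))))
  rw [ContinuousAt, tendsto_iff_norm_sub_tendsto_zero]
  have := (Real.continuous_sqrt.comp hcont).tendsto t₀
  simpa [Function.comp_def, Real.sqrt_sq] using this

end SemilinearData

/-! ### Test functions and weak derivatives on the line. -/

theorem IsTestFunction.deriv {φ : ℝ → ℝ} (hφ : IsTestFunction φ) : IsTestFunction (deriv φ) :=
  ⟨(contDiff_infty_iff_deriv.1 hφ.1).2, hφ.2.deriv⟩

theorem IsTestFunction.continuous {φ : ℝ → ℝ} (hφ : IsTestFunction φ) : Continuous φ :=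
  hφ.1.continuous

theorem IsTestFunction.hasDerivAt {φ : ℝ → ℝ} (hφ : IsTestFunction φ) (x : ℝ) :
    HasDerivAt φ (_root_.deriv φ x) x :=
  ((contDiff_infty_iff_deriv.1 hφ.1).1 x).hasDerivAt

theorem IsTestFunction.continuous_ofReal {φ : ℝ → ℝ} (hφ : IsTestFunction φ) :
    Continuous fun x => (φ x : ℂ) :=
  Complex.continuous_ofReal.comp hφ.continuous

theorem IsTestFunction.hasCompactSupport_ofReal {φ : ℝ → ℝ} (hφ : IsTestFunction φ) :
    HasCompactSupport fun x => (φ x : ℂ) :=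
  hφ.2.comp_left (g := fun r : ℝ => (r : ℂ)) Complex.ofReal_zero

theorem IsTestFunction.integrable_mul {φ : ℝ → ℝ} (hφ : IsTestFunction φ) {f : ℝ → ℂ}
    (hf : LocallyIntegrable f) : Integrable fun x => f x * (φ x : ℂ) := by
  simpa only [smul_eq_mul, mul_comm] using
    hf.integrable_smul_left_of_hasCompactSupport hφ.continuous_ofReal hφ.hasCompactSupport_ofReal

theorem IsTestFunction.exists_support_subset {φ : ℝ → ℝ} (hφ : IsTestFunction φ) :
    ∃ R : ℝ, 0 < R ∧ ∀ x, R ≤ |x| → φ x = 0 := by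
  obtain ⟨R, hR, h⟩ := hφ.2.isCompact.isBounded.subset_closedBall_lt 0 0
  refine ⟨R + 1, by linarith, fun x hx => ?_⟩
  by_contra hne
  have := h (subset_tsupport φ hne)
  rw [mem_closedBall_zero_iff, Real.norm_eq_abs] at this
  linarith

/-- The primitive starting to the left of the support vanishes again to its right because the total
integral is zero. -/
theorem IsTestFunction.exists_deriv_eq {θ : ℝ → ℝ} (hθ : IsTestFunction θ)
    (h0 : ∫ x, θ x = 0) : ∃ φ, IsTestFunction φ ∧ _root_.deriv φ = θ := by
  obtain ⟨R, hR, hsupp⟩ := hθ.exists_support_subset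
  have hderiv : ∀ x, HasDerivAt (fun x => ∫ t in (-R)..x, θ t) (θ x) x := fun x =>
    (hθ.continuous.integral_hasStrictDerivAt _ x).hasDerivAt
  have hd : _root_.deriv (fun x => ∫ t in (-R)..x, θ t) = θ := funext fun x => (hderiv x).deriv
  refine ⟨fun x => ∫ t in (-R)..x, θ t, ⟨?_, ?_⟩, hd⟩
  · rw [contDiff_infty_iff_deriv, hd]
    exact ⟨fun x => (hderiv x).differentiableAt, hθ.1⟩
  · refine HasCompactSupport.intro (isCompact_Icc (a := -R) (b := R)) fun x hx => ?_
    rcases lt_or_ge x (-R) with h | h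
    · rw [intervalIntegral.integral_congr (g := fun _ => 0) (fun t ht => ?_)]
      · simp
      · rw [Set.uIcc_of_ge h.le] at ht
        exact hsupp t (by rw [le_abs]; right; linarith [ht.2])
    · have hx' : R < x := by
        by_contra hle
        exact hx ⟨h, not_lt.1 hle⟩
      change ∫ t in (-R)..x, θ t = 0
      rw [intervalIntegral.integral_eq_integral_of_support_subset, h0]
      intro t ht
      by_contra hmem
      refine ht (hsupp t ?_)
      rw [Set.mem_Ioc, not_and_or, not_lt, not_le] at hmem
      rw [le_abs]
      rcases hmem with h | h
      · right; linarith
      · left; linarith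

theorem exists_isTestFunction_integral_eq_one : ∃ χ, IsTestFunction χ ∧ ∫ x, χ x = 1 := by
  let b : ContDiffBump (0 : ℝ) := ⟨1, 2, one_pos, one_lt_two⟩
  exact ⟨b.normed volume, ⟨b.contDiff_normed, b.hasCompactSupport_normed⟩, b.integral_normed⟩

/-- The lemma of du Bois-Reymond. -/
theorem ae_eq_const_of_integral_mul_deriv_eq_zero {f : ℝ → ℂ} (hf : LocallyIntegrable f)
    (h : ∀ φ : ℝ → ℝ, IsTestFunction φ → ∫ x, f x * ((deriv φ x : ℝ) : ℂ) = 0) :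
    ∃ c : ℂ, f =ᵐ[volume] fun _ => c := by
  obtain ⟨χ, hχ, hχ1⟩ := exists_isTestFunction_integral_eq_one
  refine ⟨∫ x, f x * (χ x : ℂ), ae_eq_of_integral_contDiff_smul_eq hf
    (continuous_const.locallyIntegrable) fun ψ hψ hψc => ?_⟩
  have hψt : IsTestFunction ψ := ⟨hψ, hψc⟩
  -- Removing the mean of `ψ` with the bump `χ` leaves the derivative of a test function.
  have hθ : IsTestFunction fun x => ψ x - (∫ y, ψ y) * χ x :=
    ⟨hψ.sub (contDiff_const.mul hχ.1), hψc.sub hχ.2.mul_left⟩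
  have hψi : Integrable ψ := hψt.continuous.integrable_of_hasCompactSupport hψc
  have hχi : Integrable χ := hχ.continuous.integrable_of_hasCompactSupport hχ.2
  obtain ⟨φ, hφ, hφd⟩ := hθ.exists_deriv_eq (by
    rw [integral_sub hψi (hχi.const_mul _), integral_const_mul, hχ1]
    ring)
  have h1 := h φ hφ
  rw [hφd] at h1
  have h2 : ∀ x, f x * ((ψ x - (∫ y, ψ y) * χ x : ℝ) : ℂ) =
      f x * (ψ x : ℂ) - ((∫ y, ψ y : ℝ) : ℂ) * (f x * (χ x : ℂ)) := fun x => by push_cast; ring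
  simp only [h2] at h1
  rw [integral_sub (hψt.integrable_mul hf) ((hχ.integrable_mul hf).const_mul _),
    integral_const_mul, sub_eq_zero] at h1
  calc ∫ x, ψ x • f x = ∫ x, f x * (ψ x : ℂ) := by
        congr 1; funext x; rw [Complex.real_smul, mul_comm]
    _ = ((∫ y, ψ y : ℝ) : ℂ) * ∫ x, f x * (χ x : ℂ) := h1
    _ = ∫ x, ψ x • ∫ x, f x * (χ x : ℂ) := by
        rw [integral_smul_const, Complex.real_smul]

theorem intervalIntegrable_of_locallyIntegrable {E : Type*} [NormedAddCommGroup E] {f : ℝ → E}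
    (hf : LocallyIntegrable f) (a b : ℝ) : IntervalIntegrable f volume a b :=
  (hf.integrableOn_isCompact isCompact_uIcc).intervalIntegrable

/-- Integration by parts for the absolutely continuous primitive, on an interval so large that the
boundary terms vanish. -/
theorem integral_primitive_mul_deriv {g : ℝ → ℝ} (hg : LocallyIntegrable g) {φ : ℝ → ℝ}
    (hφ : IsTestFunction φ) :
    ∫ x, (∫ y in (0 : ℝ)..x, g y) * deriv φ x = -∫ x, g x * φ x := by
  obtain ⟨R, hR, hsupp⟩ := hφ.exists_support_subset
  obtain ⟨R', hR', hsupp'⟩ := hφ.deriv.exists_support_subset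
  set B := max R R'
  have hB : 0 < B := lt_max_of_lt_left hR
  have hgi := intervalIntegrable_of_locallyIntegrable hg (-B) B
  have hG := hgi.absolutelyContinuousOnInterval_intervalIntegral (c := 0) (by
    rw [Set.uIcc_of_le (by linarith)]; exact ⟨by linarith, hB.le⟩)
  have hφac : AbsolutelyContinuousOnInterval φ (-B) B :=
    (hφ.1.contDiffOn.of_le (by norm_cast)).absolutelyContinuousOnInterval
  have h := hG.integral_mul_deriv_eq_deriv_mul hφac
  rw [hsupp B ((le_max_left _ _).trans (le_abs_self _)),
    hsupp (-B) (by rw [abs_neg]; exact (le_max_left _ _).trans (le_abs_self _))] at h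
  have hsub : ∀ {f : ℝ → ℝ} {S : ℝ}, S ≤ B → (∀ x, S ≤ |x| → f x = 0) →
      Function.support f ⊆ Set.Ioc (-B) B := by
    intro f S hS hf x hx
    by_contra hmem
    refine hx (hf x (hS.trans ?_))
    rw [Set.mem_Ioc, not_and_or, not_lt, not_le] at hmem
    rw [le_abs]
    rcases hmem with h | h
    · right; linarith
    · left; linarith
  rw [intervalIntegral.integral_eq_integral_of_support_subset
    (hsub (le_max_right R R') fun x hx => by rw [hsupp' x hx, mul_zero])] at h
  have h2 : ∫ x in (-B)..B, deriv (fun x => ∫ y in (0 : ℝ)..x, g y) x * φ x =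
      ∫ x in (-B)..B, g x * φ x := by
    refine intervalIntegral.integral_congr_ae ?_
    filter_upwards [_root_.LocallyIntegrable.ae_hasDerivAt_integral hg] with x hx _
    rw [(hx 0).deriv]
  rw [h2, intervalIntegral.integral_eq_integral_of_support_subset
    (hsub (le_max_left R R') fun x hx => by rw [hsupp x hx, mul_zero])] at h
  rw [h]
  ring

theorem hasWeakDeriv_primitive {g : ℝ → ℂ} (hg : LocallyIntegrable g) :
    HasWeakDeriv (fun x => ∫ y in (0 : ℝ)..x, g y) g := by
  have hgi := intervalIntegrable_of_locallyIntegrable hg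
  have hc : Continuous fun x => ∫ y in (0 : ℝ)..x, g y :=
    intervalIntegral.continuous_primitive hgi 0
  refine ⟨hc.locallyIntegrable, hg, fun φ hφ => ?_⟩
  have hre : LocallyIntegrable fun x => (g x).re := fun x => by
    obtain ⟨s, hs, h⟩ := hg x
    exact ⟨s, hs, h.re⟩
  have him : LocallyIntegrable fun x => (g x).im := fun x => by
    obtain ⟨s, hs, h⟩ := hg x
    exact ⟨s, hs, h.im⟩
  have h1 := integral_primitive_mul_deriv hre hφ
  have h2 := integral_primitive_mul_deriv him hφ
  have hint1 := hφ.deriv.integrable_mul hc.locallyIntegrable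
  have hint2 := hφ.integrable_mul hg
  have hprim : ∀ x, ∫ y in (0 : ℝ)..x, (g y).re = (∫ y in (0 : ℝ)..x, g y).re := fun x =>
    Complex.reCLM.intervalIntegral_comp_comm (hgi 0 x)
  have hprim' : ∀ x, ∫ y in (0 : ℝ)..x, (g y).im = (∫ y in (0 : ℝ)..x, g y).im := fun x =>
    Complex.imCLM.intervalIntegral_comp_comm (hgi 0 x)
  apply Complex.ext
  · have e1 := (Complex.reCLM.integral_comp_comm hint1).symm
    have e2 := (Complex.reCLM.integral_comp_comm hint2).symm
    simp only [Complex.reCLM_apply, Complex.re_mul_ofReal] at e1 e2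
    rw [Complex.neg_re, e1, e2, ← h1]
    simp only [hprim]
  · have e1 := (Complex.imCLM.integral_comp_comm hint1).symm
    have e2 := (Complex.imCLM.integral_comp_comm hint2).symm
    simp only [Complex.imCLM_apply, Complex.im_mul_ofReal] at e1 e2
    rw [Complex.neg_im, e1, e2, ← h2]
    simp only [hprim']

namespace HasWeakDeriv

variable {f g f₁ g₁ : ℝ → ℂ}

theorem add (h : HasWeakDeriv f g) (h₁ : HasWeakDeriv f₁ g₁) :
    HasWeakDeriv (fun x => f x + f₁ x) (fun x => g x + g₁ x) := by
  refine ⟨h.1.add h₁.1, h.2.1.add h₁.2.1, fun φ hφ => ?_⟩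
  simp only [add_mul]
  rw [integral_add (hφ.deriv.integrable_mul h.1) (hφ.deriv.integrable_mul h₁.1),
    integral_add (hφ.integrable_mul h.2.1) (hφ.integrable_mul h₁.2.1), h.2.2 φ hφ, h₁.2.2 φ hφ]
  ring

theorem const_mul (h : HasWeakDeriv f g) (c : ℂ) :
    HasWeakDeriv (fun x => c * f x) (fun x => c * g x) := by
  refine ⟨h.1.smul c, h.2.1.smul c, fun φ hφ => ?_⟩
  simp only [mul_assoc]
  rw [integral_const_mul, integral_const_mul, h.2.2 φ hφ]
  ring

theorem sub (h : HasWeakDeriv f g) (h₁ : HasWeakDeriv f₁ g₁) :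
    HasWeakDeriv (fun x => f x - f₁ x) (fun x => g x - g₁ x) := by
  have := h.add (h₁.const_mul (-1))
  simpa [sub_eq_add_neg] using this

theorem congr (h : HasWeakDeriv f g) (hf : f =ᵐ[volume] f₁) (hg : g =ᵐ[volume] g₁) :
    HasWeakDeriv f₁ g₁ := by
  refine ⟨h.1.congr hf, h.2.1.congr hg, fun φ hφ => ?_⟩
  have h1 := h.2.2 φ hφ
  rwa [integral_congr_ae (g := fun x => f₁ x * ((deriv φ x : ℝ) : ℂ))
      (hf.mono fun x hx => by simp only [hx]),
    integral_congr_ae (f := fun x => g x * (φ x : ℂ)) (g := fun x => g₁ x * (φ x : ℂ))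
      (hg.mono fun x hx => by simp only [hx])] at h1

theorem ae_eq_zero (h : HasWeakDeriv f g) (hf : f =ᵐ[volume] 0) : g =ᵐ[volume] 0 := by
  refine ae_eq_zero_of_integral_contDiff_smul_eq_zero h.2.1 fun φ hφ hφc => ?_
  have h1 := h.2.2 φ ⟨hφ, hφc⟩
  rw [integral_eq_zero_of_ae (hf.mono fun x hx => by simp [hx])] at h1
  simp only [Complex.real_smul, mul_comm (Complex.ofReal _)]
  exact neg_eq_zero.1 h1.symm

theorem exists_ae_eq_primitive (h : HasWeakDeriv f g) :
    ∃ c : ℂ, f =ᵐ[volume] fun x => c + ∫ y in (0 : ℝ)..x, g y := by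
  have h1 := h.sub (hasWeakDeriv_primitive h.2.1)
  obtain ⟨c, hc⟩ := ae_eq_const_of_integral_mul_deriv_eq_zero h1.1 fun φ hφ => by
    rw [h1.2.2 φ hφ]; simp
  exact ⟨c, hc.mono fun x hx => sub_eq_iff_eq_add.1 hx⟩

/-- The fundamental theorem of calculus for weak derivatives. -/
theorem sub_eq_integral (h : HasWeakDeriv f g) (hf : Continuous f) (x y : ℝ) :
    f y - f x = ∫ t in x..y, g t := by
  have hgi := intervalIntegrable_of_locallyIntegrable h.2.1
  obtain ⟨c, hc⟩ := h.exists_ae_eq_primitive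
  have heq : f = fun x => c + ∫ y in (0 : ℝ)..x, g y :=
    (Continuous.ae_eq_iff_eq volume hf
      (continuous_const.add (intervalIntegral.continuous_primitive hgi 0))).1 hc
  rw [heq, ← intervalIntegral.integral_interval_sub_left (hgi 0 y) (hgi 0 x)]
  ring

/-- Solutions are multiples of `exp (c x)`, whose modulus is at least a constant on a half-line and
hence not in `L²`. This serves the density of test functions in `H¹`. -/
theorem ae_eq_zero_of_eq_const_mul {c : ℝ} (hc : c ≠ 0)
    (h : HasWeakDeriv f (fun x => (c : ℂ) * f x)) (hf : MemLp f 2) : f =ᵐ[volume] 0 := by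
  obtain ⟨k, hk⟩ := h.exists_ae_eq_primitive
  set F : ℝ → ℂ := fun x => k + ∫ y in (0 : ℝ)..x, (c : ℂ) * f y with hF
  have hFc : Continuous F := continuous_const.add
    (intervalIntegral.continuous_primitive (intervalIntegrable_of_locallyIntegrable h.2.1) 0)
  have hF' : ∀ x, F x = k + ∫ y in (0 : ℝ)..x, (c : ℂ) * F y := fun x => by
    simp only [hF]
    congr 1
    exact intervalIntegral.integral_congr_ae (hk.mono fun y hy _ => by rw [hy])
  have hderiv : ∀ x, HasDerivAt F ((c : ℂ) * F x) x := fun x =>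
    (((continuous_const.mul hFc).integral_hasStrictDerivAt 0 x).hasDerivAt.const_add k)
      |>.congr_of_eventuallyEq (Eventually.of_forall hF')
  have hE : ∀ x, HasDerivAt (fun x : ℝ => Complex.exp (-(c * x : ℝ)) * F x) 0 x := fun x => by
    have h1 : HasDerivAt (fun x : ℝ => (-(c * x : ℝ) : ℂ)) (-(c : ℂ)) x := by
      have := (((hasDerivAt_id x).const_mul c).ofReal_comp).fun_neg
      simpa using this
    have := h1.cexp.mul (hderiv x)
    convert! this using 1
    ring
  have hconst : ∀ x : ℝ, F x = Complex.exp (c * x : ℝ) * F 0 := fun x => by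
    have := is_const_of_deriv_eq_zero (fun x => (hE x).differentiableAt)
      (fun x => (hE x).deriv) x 0
    simp only [mul_zero, Complex.ofReal_zero, neg_zero, Complex.exp_zero, one_mul] at this
    rw [← this, ← mul_assoc, ← Complex.exp_add]
    simp
  have hFL : MemLp F 2 := (memLp_congr_ae hk).1 hf
  have hF0 : F 0 = 0 := by
    by_contra hne
    have hfin := hFL.meas_ge_lt_top' (by norm_num) (by norm_num)
      (ε := ENNReal.ofReal ‖F 0‖) (by simpa using hne)
    have hsub : {x : ℝ | 0 ≤ c * x} ⊆ {x | ENNReal.ofReal ‖F 0‖ ≤ ‖F x‖ₑ} := by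
      intro x hx
      have hx' : 0 ≤ c * x := hx
      change _ ≤ ‖F x‖ₑ
      rw [← ofReal_norm, hconst x, norm_mul, Complex.norm_exp_ofReal]
      gcongr
      exact le_mul_of_one_le_left (norm_nonneg _) (Real.one_le_exp hx')
    have htop : volume {x : ℝ | 0 ≤ c * x} = ∞ := by
      rcases lt_or_gt_of_ne hc with h | h
      · have : {x : ℝ | 0 ≤ c * x} = Set.Iic 0 := by
          ext x
          change 0 ≤ c * x ↔ x ≤ 0
          constructor <;> intro hx <;> nlinarith
        rw [this, Real.volume_Iic]
      · have : {x : ℝ | 0 ≤ c * x} = Set.Ici 0 := by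
          ext x
          change 0 ≤ c * x ↔ 0 ≤ x
          constructor <;> intro hx <;> nlinarith
        rw [this, Real.volume_Ici]
    have := measure_mono (μ := volume) hsub
    rw [htop] at this
    exact absurd hfin (not_lt.2 this)
  filter_upwards [hk] with x hx
  rw [hx]
  have := hconst x
  rw [hF0, mul_zero] at this
  exact this

end HasWeakDeriv

/-! ### The Hilbert space `H¹`, its continuous representatives and its test functions. -/

/-- `L²(ℝ; ℂ)`. -/
abbrev LTwo : Type := Lp ℂ 2 (volume : Measure ℝ)

theorem LTwo.norm_sq_eq (f : LTwo) : ‖f‖ ^ 2 = ∫ x, ‖f x‖ ^ 2 := by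
  rw [← inner_self_eq_norm_sq (𝕜 := ℂ) f, L2.inner_def, ← integral_re (L2.integrable_inner f f)]
  congr 1
  funext x
  exact inner_self_eq_norm_sq (𝕜 := ℂ) (f x)

theorem LTwo.locallyIntegrable (f : LTwo) : LocallyIntegrable f :=
  (Lp.memLp f).locallyIntegrable one_le_two

/-- Cauchy–Schwarz against an indicator function; applied to derivatives, it is the Hölder-`1/2`
estimate. -/
theorem LTwo.norm_integral_le (f : LTwo) (x y : ℝ) :
    ‖∫ t in x..y, f t‖ ≤ √|y - x| * ‖f‖ := by
  have key : ∀ a b : ℝ, a ≤ b → ‖∫ t in a..b, f t‖ ≤ √|b - a| * ‖f‖ := by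
    intro a b hab
    have hfin : volume (Set.Ioc a b) ≠ ∞ := by simp
    have h1 := L2.inner_indicatorConstLp_eq_inner_setIntegral ℂ
      (measurableSet_Ioc (a := a) (b := b)) hfin (1 : ℂ) f
    have h2 : inner ℂ (1 : ℂ) (∫ t in Set.Ioc a b, f t) = ∫ t in Set.Ioc a b, f t := by simp
    rw [intervalIntegral.integral_of_le hab, ← h2, ← h1]
    refine (norm_inner_le_norm _ _).trans ?_
    rw [norm_indicatorConstLp (by norm_num) (by norm_num)]
    simp [Real.sqrt_eq_rpow, abs_of_nonneg (sub_nonneg.2 hab), hab]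
  rcases le_total x y with h | h
  · exact key x y h
  · rw [intervalIntegral.integral_symm, norm_neg, abs_sub_comm]
    exact key y x h

theorem IsTestFunction.memLp {φ : ℝ → ℝ} (hφ : IsTestFunction φ) :
    MemLp (fun x => (φ x : ℂ)) 2 :=
  hφ.continuous_ofReal.memLp_of_hasCompactSupport hφ.hasCompactSupport_ofReal

/-- A test function as an element of `L²`. -/
noncomputable def IsTestFunction.toLTwo {φ : ℝ → ℝ} (hφ : IsTestFunction φ) : LTwo :=
  hφ.memLp.toLp

theorem IsTestFunction.coe_toLTwo {φ : ℝ → ℝ} (hφ : IsTestFunction φ) :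
    hφ.toLTwo =ᵐ[volume] fun x => (φ x : ℂ) :=
  hφ.memLp.coeFn_toLp

theorem IsTestFunction.inner_toLTwo {φ : ℝ → ℝ} (hφ : IsTestFunction φ) (f : LTwo) :
    inner ℂ hφ.toLTwo f = ∫ x, f x * (φ x : ℂ) := by
  rw [L2.inner_def]
  refine integral_congr_ae (hφ.coe_toLTwo.mono fun x hx => ?_)
  simp only [hx]
  rw [RCLike.inner_apply, Complex.conj_ofReal]

theorem IsTestFunction.hasWeakDeriv {φ : ℝ → ℝ} (hφ : IsTestFunction φ) :
    HasWeakDeriv (fun x => (φ x : ℂ)) (fun x => ((_root_.deriv φ x : ℝ) : ℂ)) := by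
  refine ⟨hφ.continuous_ofReal.locallyIntegrable, hφ.deriv.continuous_ofReal.locallyIntegrable,
    fun ψ hψ => ?_⟩
  have h := integral_mul_deriv_eq_deriv_mul_of_integrable (u := φ) (v := ψ)
    (fun x _ => hφ.hasDerivAt x) (fun x _ => hψ.hasDerivAt x)
    ((hφ.continuous.mul hψ.deriv.continuous).integrable_of_hasCompactSupport hφ.2.mul_right)
    ((hφ.deriv.continuous.mul hψ.continuous).integrable_of_hasCompactSupport hψ.2.mul_left)
    ((hφ.continuous.mul hψ.continuous).integrable_of_hasCompactSupport hφ.2.mul_right)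
  have h' := congrArg (fun r : ℝ => (r : ℂ)) h
  simpa only [← Complex.ofReal_mul, integral_complex_ofReal, ← Complex.ofReal_neg] using h'

/-- The vectors `(φ', φ)` whose orthogonal complement is the graph of the weak derivative. -/
def weakDerivTests : Set (WithLp 2 (LTwo × LTwo)) :=
  {p | ∃ (φ : ℝ → ℝ) (hφ : IsTestFunction φ), p = WithLp.toLp 2 (hφ.deriv.toLTwo, hφ.toLTwo)}

/-- The Hilbert space `H¹(ℝ; ℂ)`, as the space of pairs of an `L²` function and its weak
derivative. -/
abbrev HOne : Type := ((Submodule.span ℂ weakDerivTests)ᗮ : Submodule ℂ (WithLp 2 (LTwo × LTwo)))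

/-- Orthogonality to `(φ', φ)` is the definition of the weak derivative, so `H¹` is an orthogonal
complement and thus complete. -/
theorem mem_HOne_iff (p : WithLp 2 (LTwo × LTwo)) :
    p ∈ (Submodule.span ℂ weakDerivTests)ᗮ ↔ HasWeakDeriv p.fst p.snd := by
  have h0 : ∀ (φ : ℝ → ℝ) (hφ : IsTestFunction φ),
      inner ℂ (WithLp.toLp 2 (hφ.deriv.toLTwo, hφ.toLTwo)) p =
        (∫ x, p.fst x * ((deriv φ x : ℝ) : ℂ)) + ∫ x, p.snd x * (φ x : ℂ) := by
    intro φ hφ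
    rw [WithLp.prod_inner_apply, ← hφ.inner_toLTwo, ← hφ.deriv.inner_toLTwo]
    rfl
  rw [Submodule.mem_orthogonal]
  constructor
  · intro h
    refine ⟨LTwo.locallyIntegrable _, LTwo.locallyIntegrable _, fun φ hφ => ?_⟩
    have h1 := h _ (Submodule.subset_span ⟨φ, hφ, rfl⟩)
    rw [h0] at h1
    exact eq_neg_of_add_eq_zero_left h1
  · intro h u hu
    induction hu using Submodule.span_induction with
    | mem x hx =>
      obtain ⟨φ, hφ, rfl⟩ := hx
      rw [h0, h.2.2 φ hφ]
      ring
    | zero => simp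
    | add x y _ _ hx hy => rw [inner_add_left, hx, hy, add_zero]
    | smul c x _ hx => rw [inner_smul_left, hx, mul_zero]

theorem hasWeakDeriv_coe (u : HOne) : HasWeakDeriv u.1.fst u.1.snd := (mem_HOne_iff u.1).1 u.2

/-- `H¹` as an energy space over `L²`. -/
noncomputable def sobolevEnergySpace : EnergySpace HOne LTwo where
  J := WithLp.fstL 2 ℂ LTwo LTwo ∘L Submodule.subtypeL _
  D := WithLp.sndL 2 ℂ LTwo LTwo ∘L Submodule.subtypeL _
  inner_eq u w := WithLp.prod_inner_apply u.1 w.1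
  injective u hu := by
    have h1 : u.1.fst = 0 := hu
    have h2 := (hasWeakDeriv_coe u).ae_eq_zero (by rw [h1]; exact Lp.coeFn_zero _ _ _)
    have h3 : u.1.snd = 0 := Lp.ext (h2.trans (Lp.coeFn_zero _ _ _).symm)
    refine Subtype.ext ?_
    rw [← WithLp.toLp_ofLp 2 u.1]
    exact congrArg (WithLp.toLp 2) (Prod.ext h1 h3)

/-- The function part of an element of `H¹`. -/
local notation "𝐉" => EnergySpace.J sobolevEnergySpace

/-- The derivative part of an element of `H¹`. -/
local notation "𝐃" => EnergySpace.D sobolevEnergySpace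

namespace HOne

theorem hasWeakDeriv (u : HOne) : HasWeakDeriv (𝐉 u) (𝐃 u) := hasWeakDeriv_coe u

theorem exists_of_hasWeakDeriv {f g : ℝ → ℂ} (hf : MemLp f 2) (hg : MemLp g 2)
    (h : HasWeakDeriv f g) : ∃ u : HOne, 𝐉 u = hf.toLp ∧ 𝐃 u = hg.toLp :=
  ⟨⟨WithLp.toLp 2 (hf.toLp, hg.toLp), (mem_HOne_iff _).2
    (h.congr hf.coeFn_toLp.symm hg.coeFn_toLp.symm)⟩, rfl, rfl⟩

/-- The continuous representative of an element of `H¹`. -/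
theorem exists_continuous_ae_eq (u : HOne) : ∃ f : ℝ → ℂ, Continuous f ∧ 𝐉 u =ᵐ[volume] f := by
  obtain ⟨c, hc⟩ := (hasWeakDeriv u).exists_ae_eq_primitive
  exact ⟨_, continuous_const.add (intervalIntegral.continuous_primitive
    (intervalIntegrable_of_locallyIntegrable (hasWeakDeriv u).2.1) 0), hc⟩

/-- The continuous representative of an element of `H¹`. -/
noncomputable def rep (u : HOne) : ℝ → ℂ := (exists_continuous_ae_eq u).choose

theorem continuous_rep (u : HOne) : Continuous (rep u) := (exists_continuous_ae_eq u).choose_spec.1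

theorem rep_ae_eq (u : HOne) : 𝐉 u =ᵐ[volume] rep u := (exists_continuous_ae_eq u).choose_spec.2

theorem rep_eq_of_ae_eq {u : HOne} {f : ℝ → ℂ} (hf : Continuous f) (h : 𝐉 u =ᵐ[volume] f) :
    rep u = f :=
  (Continuous.ae_eq_iff_eq volume (continuous_rep u) hf).1 ((rep_ae_eq u).symm.trans h)

theorem rep_add (u w : HOne) : rep (u + w) = rep u + rep w :=
  rep_eq_of_ae_eq ((continuous_rep u).add (continuous_rep w)) (by
    rw [map_add]
    exact (Lp.coeFn_add _ _).trans ((rep_ae_eq u).add (rep_ae_eq w)))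

theorem rep_smul (c : ℂ) (u : HOne) : rep (c • u) = c • rep u :=
  rep_eq_of_ae_eq ((continuous_rep u).const_smul c) (by
    rw [map_smul]
    exact (Lp.coeFn_smul _ _).trans ((rep_ae_eq u).const_smul c))

theorem rep_sub (u w : HOne) : rep (u - w) = rep u - rep w :=
  rep_eq_of_ae_eq ((continuous_rep u).sub (continuous_rep w)) (by
    rw [map_sub]
    exact (Lp.coeFn_sub _ _).trans ((rep_ae_eq u).sub (rep_ae_eq w)))

theorem hasWeakDeriv_rep (u : HOne) : HasWeakDeriv (rep u) (𝐃 u) :=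
  (hasWeakDeriv u).congr (rep_ae_eq u) EventuallyEq.rfl

theorem memLp_rep (u : HOne) : MemLp (rep u) 2 := (memLp_congr_ae (rep_ae_eq u)).1 (Lp.memLp _)

theorem isH1Pair_rep (u : HOne) : IsH1Pair (rep u) (𝐃 u) :=
  ⟨continuous_rep u, memLp_rep u, hasWeakDeriv_rep u, Lp.memLp _⟩

theorem norm_rep_sub_le (u : HOne) (x y : ℝ) : ‖rep u x - rep u y‖ ≤ √|x - y| * ‖u‖ := by
  rw [(hasWeakDeriv_rep u).sub_eq_integral (continuous_rep u) y x]
  exact (LTwo.norm_integral_le _ _ _).trans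
    (mul_le_mul_of_nonneg_left (sobolevEnergySpace.norm_D_le u) (Real.sqrt_nonneg _))

/-- The Sobolev embedding `H¹ ⊆ L^∞`. -/
theorem norm_rep_le (u : HOne) (x : ℝ) : ‖rep u x‖ ≤ 2 * ‖u‖ := by
  have hi : IntervalIntegrable (rep u) volume x (x + 1) := (continuous_rep u).intervalIntegrable _ _
  -- The value at `x` is compared with the mean over `[x, x + 1]`: both the mean and the oscillation
  -- are at most `‖u‖`.
  have h1 : ‖∫ t in x..x + 1, rep u t‖ ≤ ‖u‖ := by
    rw [← intervalIntegral.integral_congr_ae ((rep_ae_eq u).mono fun t ht _ => ht)]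
    refine (LTwo.norm_integral_le _ _ _).trans ?_
    rw [add_sub_cancel_left, abs_one, Real.sqrt_one, one_mul]
    exact sobolevEnergySpace.norm_J_le u
  have h2 : ‖∫ t in x..x + 1, (rep u x - rep u t)‖ ≤ ‖u‖ * |x + 1 - x| := by
    refine intervalIntegral.norm_integral_le_of_norm_le_const fun t ht => ?_
    rw [Set.uIoc_of_le (by linarith)] at ht
    refine (norm_rep_sub_le u x t).trans (mul_le_of_le_one_left (norm_nonneg _) ?_)
    rw [Real.sqrt_le_left zero_le_one, one_pow, abs_le]
    constructor <;> linarith [ht.1, ht.2]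
  rw [intervalIntegral.integral_sub (by simp) hi] at h2
  simp only [intervalIntegral.integral_const, add_sub_cancel_left, one_smul, abs_one, mul_one] at h2
  linarith [norm_le_norm_add_norm_sub' (rep u x) (∫ t in x..x + 1, rep u t)]

/-- Evaluation at a point. -/
noncomputable def evalL (x : ℝ) : HOne →L[ℂ] ℂ :=
  LinearMap.mkContinuous
    { toFun := fun u => rep u x
      map_add' := fun u w => by rw [rep_add]; rfl
      map_smul' := fun c u => by rw [rep_smul]; rfl } 2 fun u => norm_rep_le u x

theorem evalL_apply (x : ℝ) (u : HOne) : evalL x u = rep u x := rfl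

/-- Evaluation at a point is a bounded functional, so weak convergence in `H¹` implies pointwise
convergence. -/
theorem tendsto_rep_of_forall_tendsto_inner {ι : Type*} {l : Filter ι} {v : ι → HOne} {w : HOne}
    (hv : ∀ h, Tendsto (fun n => inner ℂ (v n) h) l (𝓝 (inner ℂ w h))) (x : ℝ) :
    Tendsto (fun n => rep (v n) x) l (𝓝 (rep w x)) := by
  have h1 : ∀ u : HOne, rep u x =
      starRingEnd ℂ (inner ℂ u ((InnerProductSpace.toDual ℂ HOne).symm (evalL x))) := fun u => by
    rw [inner_conj_symm, InnerProductSpace.toDual_symm_apply, evalL_apply]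
  simp only [h1]
  exact (Complex.continuous_conj.tendsto _).comp (hv _)

/-- On compact sets, weak convergence of a bounded family in `H¹` is uniform. -/
theorem eventually_forall_norm_rep_sub_le {l : Filter ℕ} {v : ℕ → HOne} {w : HOne} {R : ℝ}
    (hR : ∀ n, ‖v n‖ ≤ R)
    (hv : ∀ h, Tendsto (fun n => inner ℂ (v n) h) l (𝓝 (inner ℂ w h))) {K : Set ℝ}
    (hK : IsCompact K) {ε : ℝ} (hε : 0 < ε) :
    ∀ᶠ n in l, ∀ x ∈ K, ‖rep (v n) x - rep w x‖ ≤ ε := by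
  refine eventually_forall_norm_sub_le_of_modulus hK (m := fun τ => √τ * R) ?_
    (fun n s _ t _ => (norm_rep_sub_le (v n) s t).trans
      (mul_le_mul_of_nonneg_left (hR n) (Real.sqrt_nonneg _)))
    (fun s _ => tendsto_rep_of_forall_tendsto_inner hv s) hε
  have : Continuous fun τ => √τ * R := by fun_prop
  simpa using this.tendsto 0

theorem exists_test {φ : ℝ → ℝ} (hφ : IsTestFunction φ) :
    ∃ u : HOne, 𝐉 u = hφ.toLTwo ∧ 𝐃 u = hφ.deriv.toLTwo :=
  exists_of_hasWeakDeriv hφ.memLp hφ.deriv.memLp hφ.hasWeakDeriv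

/-- A test function as an element of `H¹`. -/
noncomputable def test {φ : ℝ → ℝ} (hφ : IsTestFunction φ) : HOne := (exists_test hφ).choose

theorem J_test {φ : ℝ → ℝ} (hφ : IsTestFunction φ) : 𝐉 (test hφ) = hφ.toLTwo :=
  (exists_test hφ).choose_spec.1

theorem D_test {φ : ℝ → ℝ} (hφ : IsTestFunction φ) : 𝐃 (test hφ) = hφ.deriv.toLTwo :=
  (exists_test hφ).choose_spec.2

/-- The test functions, as a subset of `H¹`. -/
def tests : Set HOne := {u | ∃ (φ : ℝ → ℝ) (hφ : IsTestFunction φ), u = test hφ}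

theorem inner_D_test {φ : ℝ → ℝ} (hφ : IsTestFunction φ) (u : HOne) :
    inner ℂ (𝐃 (test hφ)) (𝐃 u) = -inner ℂ hφ.deriv.deriv.toLTwo (𝐉 u) := by
  rw [D_test, IsTestFunction.inner_toLTwo, IsTestFunction.inner_toLTwo,
    (hasWeakDeriv u).2.2 _ hφ.deriv, neg_neg]

/-- Test functions are dense in `H¹`. -/
theorem topologicalClosure_span_tests : (Submodule.span ℂ tests).topologicalClosure = ⊤ := by
  rw [Submodule.topologicalClosure_eq_top_iff, Submodule.eq_bot_iff]
  intro u hu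
  have h1 : ∀ (φ : ℝ → ℝ) (hφ : IsTestFunction φ),
      (∫ x, 𝐉 u x * (φ x : ℂ)) + ∫ x, 𝐃 u x * ((deriv φ x : ℝ) : ℂ) = 0 := by
    intro φ hφ
    have := (Submodule.mem_orthogonal _ _).1 hu (test hφ) (Submodule.subset_span ⟨φ, hφ, rfl⟩)
    rwa [sobolevEnergySpace.inner_eq, J_test, D_test, IsTestFunction.inner_toLTwo,
      IsTestFunction.inner_toLTwo] at this
  -- A vector `u` orthogonal to all test functions satisfies `u'' = u`. So `u + u'` and `u - u'`
  -- solve `f' = f` and `f' = -f`, and both vanish.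
  have h2 : HasWeakDeriv (𝐃 u) (𝐉 u) :=
    ⟨(hasWeakDeriv u).2.1, (hasWeakDeriv u).1, fun φ hφ => eq_neg_of_add_eq_zero_right (h1 φ hφ)⟩
  have h3 := HasWeakDeriv.ae_eq_zero_of_eq_const_mul (c := 1) one_ne_zero
    (((hasWeakDeriv u).add h2).congr EventuallyEq.rfl
      (Eventually.of_forall fun x => by simp only [Complex.ofReal_one, one_mul]; ring))
    ((Lp.memLp (𝐉 u)).add (Lp.memLp (𝐃 u)))
  have h4 := HasWeakDeriv.ae_eq_zero_of_eq_const_mul (c := -1) (by norm_num)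
    (((hasWeakDeriv u).sub h2).congr EventuallyEq.rfl
      (Eventually.of_forall fun x => by simp only [Complex.ofReal_neg, Complex.ofReal_one]; ring))
    ((Lp.memLp (𝐉 u)).sub (Lp.memLp (𝐃 u)))
  refine sobolevEnergySpace.injective u (Lp.ext ?_)
  filter_upwards [h3, h4, Lp.coeFn_zero ℂ 2 (volume : Measure ℝ)] with x h3 h4 h5
  rw [h5]
  simp only [Pi.zero_apply] at *
  linear_combination (h3 + h4) / 2

end HOne

/-! ### The truncated force and potential. -/

/-- `|z|²`, truncated from below. -/
noncomputable def truncSq (z : ℂ) : ℝ := max (‖z‖ ^ 2) (1 / 4)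

/-- The force `ω z (1 / |z|² - 1)`, truncated near `z = 0` so as to be globally Lipschitz. -/
noncomputable def truncForce (ω : ℝ) (z : ℂ) : ℂ := ((ω * ((truncSq z)⁻¹ - 1) : ℝ) : ℂ) * z

/-- The potential `(ω / 2) (|z|² - 1 - ln |z|²)`, truncated near `z = 0`. -/
noncomputable def truncPotential (ω : ℝ) (z : ℂ) : ℝ :=
  -- For `|z| ≥ 1/2` the quotient is `1`; for `|z| < 1/2` the logarithm of `|z|²` is replaced by its
  -- tangent line at `1/4`.
  ω / 2 * (‖z‖ ^ 2 - ‖z‖ ^ 2 / truncSq z - Real.log (truncSq z))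

theorem truncSq_ge (z : ℂ) : 1 / 4 ≤ truncSq z := le_max_right _ _

theorem truncSq_pos (z : ℂ) : 0 < truncSq z := lt_of_lt_of_le (by norm_num) (truncSq_ge z)

theorem truncSq_of_half_le {z : ℂ} (hz : 1 / 2 ≤ ‖z‖) : truncSq z = ‖z‖ ^ 2 :=
  max_eq_left (by nlinarith)

theorem truncSq_of_lt_half {z : ℂ} (hz : ‖z‖ < 1 / 2) : truncSq z = 1 / 4 :=
  max_eq_right (by nlinarith [norm_nonneg z])

theorem truncSq_eq_sq (z : ℂ) : truncSq z = max ‖z‖ (1 / 2) ^ 2 := by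
  rcases le_or_gt (1 / 2) ‖z‖ with h | h
  · rw [truncSq_of_half_le h, max_eq_left h]
  · rw [truncSq_of_lt_half h, max_eq_right h.le]; norm_num

theorem truncForce_of_half_le {ω : ℝ} {z : ℂ} (hz : 1 / 2 ≤ ‖z‖) :
    truncForce ω z = ω * (z / ((‖z‖ ^ 2 : ℝ) : ℂ)) - ω * z := by
  rw [truncForce, truncSq_of_half_le hz]
  push_cast
  ring

theorem continuous_truncSq : Continuous truncSq := by unfold truncSq; fun_prop

theorem continuous_truncPotential (ω : ℝ) : Continuous (truncPotential ω) := by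
  have h := continuous_truncSq
  have h0 : ∀ z, truncSq z ≠ 0 := fun z => (truncSq_pos z).ne'
  exact continuous_const.mul (((continuous_norm.pow 2).sub ((continuous_norm.pow 2).div h h0)).sub
    (h.log h0))

theorem norm_inv_truncSq_mul_sub_le (z w : ℂ) :
    ‖((truncSq z)⁻¹ : ℂ) * z - ((truncSq w)⁻¹ : ℂ) * w‖ ≤ 12 * ‖z - w‖ := by
  rw [truncSq_eq_sq, truncSq_eq_sq]
  set s := max ‖z‖ (1 / 2) with hs
  set t := max ‖w‖ (1 / 2) with ht
  have hs2 : 1 / 2 ≤ s := le_max_right _ _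
  have ht2 : 1 / 2 ≤ t := le_max_right _ _
  have hs0 : 0 < s := by linarith
  have ht0 : 0 < t := by linarith
  have hwt : ‖w‖ ≤ t := le_max_left _ _
  have hst : |t - s| ≤ ‖z - w‖ := by
    refine (abs_max_sub_max_le_abs _ _ _).trans ?_
    rw [norm_sub_rev]
    exact abs_norm_sub_norm_le w z
  have hinvs : s⁻¹ ≤ 2 := by
    rw [inv_le_comm₀ hs0 two_pos]; linarith
  have hinvt : t⁻¹ ≤ 2 := by
    rw [inv_le_comm₀ ht0 two_pos]; linarith
  -- Since `s, t ≥ 1/2` and `‖w‖ ≤ t`, the two terms contribute Lipschitz constants `4` and `8`.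
  have h1 : (((s ^ 2 : ℝ) : ℂ)⁻¹) * z - (((t ^ 2 : ℝ) : ℂ)⁻¹) * w =
      ((s⁻¹ * s⁻¹ : ℝ) : ℂ) * (z - w) +
        (((t - s) * (s⁻¹ * (s⁻¹ * t⁻¹) + s⁻¹ * (t⁻¹ * t⁻¹)) : ℝ) : ℂ) * w := by
    have hs' : (s : ℂ) ≠ 0 := by exact_mod_cast hs0.ne'
    have ht' : (t : ℂ) ≠ 0 := by exact_mod_cast ht0.ne'
    push_cast
    field_simp
    ring
  rw [h1]
  refine (norm_add_le _ _).trans ?_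
  rw [norm_mul, norm_mul, Complex.norm_real, Complex.norm_real,
    Real.norm_of_nonneg (by positivity : 0 ≤ s⁻¹ * s⁻¹), norm_mul,
    Real.norm_of_nonneg (by positivity : 0 ≤ s⁻¹ * (s⁻¹ * t⁻¹) + s⁻¹ * (t⁻¹ * t⁻¹)),
    Real.norm_eq_abs]
  have h2 : s⁻¹ * s⁻¹ ≤ 2 * 2 := by gcongr
  have h3 : (s⁻¹ * (s⁻¹ * t⁻¹) + s⁻¹ * (t⁻¹ * t⁻¹)) * ‖w‖ ≤ 8 := by
    calc _ ≤ (s⁻¹ * (s⁻¹ * t⁻¹) + s⁻¹ * (t⁻¹ * t⁻¹)) * t := by gcongr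
      _ = s⁻¹ * s⁻¹ + s⁻¹ * t⁻¹ := by field_simp
      _ ≤ 2 * 2 + 2 * 2 := by gcongr
      _ = 8 := by norm_num
  calc _ ≤ 2 * 2 * ‖z - w‖ + ‖z - w‖ * 8 := by
        rw [mul_assoc |t - s|]
        gcongr
    _ = 12 * ‖z - w‖ := by ring

theorem norm_truncForce_sub_le {ω : ℝ} (hω : 0 ≤ ω) (z w : ℂ) :
    ‖truncForce ω z - truncForce ω w‖ ≤ 13 * ω * ‖z - w‖ := by
  have h1 : truncForce ω z - truncForce ω w =
      ω * ((((truncSq z)⁻¹ : ℂ) * z - ((truncSq w)⁻¹ : ℂ) * w) - (z - w)) := by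
    simp only [truncForce]; push_cast; ring
  rw [h1, norm_mul, Complex.norm_real, Real.norm_of_nonneg hω]
  have h2 := (norm_sub_le _ _).trans
    (add_le_add_left (norm_inv_truncSq_mul_sub_le z w) ‖z - w‖)
  calc _ ≤ ω * (12 * ‖z - w‖ + ‖z - w‖) := by gcongr
    _ = _ := by ring

theorem continuous_truncForce (ω : ℝ) : Continuous (truncForce ω) := by
  have h := continuous_truncSq
  have h0 : ∀ z, truncSq z ≠ 0 := fun z => (truncSq_pos z).ne'
  exact (Complex.continuous_ofReal.comp (continuous_const.mul
    ((h.inv₀ h0).sub continuous_const))).mul continuous_id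

/-- Coercivity of the potential. For `r = |z| ≥ 1/2` it is `ln r ≤ r - 1`; below, the difference is
a concave quadratic in `r`, positive at `0` and at `1/2`. -/
theorem sq_norm_sub_one_le (z : ℂ) :
    (‖z‖ - 1) ^ 2 ≤ ‖z‖ ^ 2 - ‖z‖ ^ 2 / truncSq z - Real.log (truncSq z) := by
  rcases le_or_gt (1 / 2) ‖z‖ with h | h
  · have h0 : 0 < ‖z‖ := by linarith
    rw [truncSq_of_half_le h, div_self (by positivity), Real.log_pow]
    have := Real.log_le_sub_one_of_pos h0
    push_cast
    nlinarith
  · rw [truncSq_of_lt_half h]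
    have h1 : Real.log (1 / 4) = -(2 * Real.log 2) := by
      rw [one_div, Real.log_inv, show (4 : ℝ) = 2 ^ 2 by norm_num, Real.log_pow]; norm_num
    rw [h1]
    have := Real.log_two_gt_d9
    have h0 := norm_nonneg z
    nlinarith

theorem truncPotential_ge {ω : ℝ} (hω : 0 ≤ ω) (z : ℂ) :
    ω / 2 * (‖z‖ - 1) ^ 2 ≤ truncPotential ω z :=
  mul_le_mul_of_nonneg_left (sq_norm_sub_one_le z) (by positivity)

theorem truncPotential_nonneg {ω : ℝ} (hω : 0 ≤ ω) (z : ℂ) : 0 ≤ truncPotential ω z :=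
  le_trans (by positivity) (truncPotential_ge hω z)

/-- The tangent line of the logarithm lies above it, so truncation only lowers the energy. -/
theorem truncPotential_le {ω : ℝ} (hω : 0 ≤ ω) {z : ℂ} (hz : z ≠ 0) :
    truncPotential ω z ≤ ω / 2 * (‖z‖ ^ 2 - 1 - Real.log (‖z‖ ^ 2)) := by
  refine mul_le_mul_of_nonneg_left ?_ (by positivity)
  have h0 : 0 < ‖z‖ := norm_pos_iff.2 hz
  have h1 := truncSq_pos z
  have h2 := Real.log_le_sub_one_of_pos (div_pos (pow_pos h0 2) h1)
  rw [Real.log_div (by positivity) h1.ne'] at h2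
  linarith

/-- Both sides are compared with `(|z| - 1)²`. This makes the force square integrable at finite
energy. -/
theorem norm_truncForce_sq_le {ω : ℝ} (hω : 0 ≤ ω) (z : ℂ) :
    ‖truncForce ω z‖ ^ 2 ≤ 18 * ω * truncPotential ω z := by
  have key : ‖z‖ ^ 2 * ((truncSq z)⁻¹ - 1) ^ 2 ≤ 9 * (‖z‖ - 1) ^ 2 := by
    rcases le_or_gt (1 / 2) ‖z‖ with h | h
    · rw [truncSq_of_half_le h]
      have h0 : 0 < ‖z‖ := by linarith
      have h1 : ‖z‖ ^ 2 * ((‖z‖ ^ 2)⁻¹ - 1) ^ 2 = (‖z‖⁻¹ + 1) ^ 2 * (‖z‖ - 1) ^ 2 := by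
        field_simp; ring
      have h2 : ‖z‖⁻¹ ≤ 2 := by rw [inv_le_comm₀ h0 two_pos]; linarith
      rw [h1]
      gcongr
      have : 0 < ‖z‖⁻¹ := inv_pos.2 h0
      nlinarith
    · rw [truncSq_of_lt_half h]
      nlinarith [norm_nonneg z]
  have h1 := truncPotential_ge hω z
  rw [truncForce, norm_mul, mul_pow, Complex.norm_real, Real.norm_eq_abs, sq_abs, mul_pow]
  calc _ = ω ^ 2 * (‖z‖ ^ 2 * ((truncSq z)⁻¹ - 1) ^ 2) := by ring
    _ ≤ ω ^ 2 * (9 * (‖z‖ - 1) ^ 2) := by gcongr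
    _ = 18 * ω * (ω / 2 * (‖z‖ - 1) ^ 2) := by ring
    _ ≤ _ := by gcongr

/-- `-truncForce` is the gradient of `truncPotential`, with a quadratic remainder. -/
theorem abs_truncPotential_add_sub_le {ω : ℝ} (hω : 0 ≤ ω) (z h : ℂ) :
    |truncPotential ω (z + h) - truncPotential ω z + (inner ℂ (truncForce ω z) h).re| ≤
      15 * ω * ‖h‖ ^ 2 := by
  -- `|w|² / truncSq w + ln (truncSq w)` is a concave function of `|w|²` with slope `1 / truncSq w`.
  -- Its tangent inequalities at `z` and at `w` bound the remainder on both sides.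
  have tangent : ∀ z w : ℂ, ‖w‖ ^ 2 / truncSq w + Real.log (truncSq w) ≤
      ‖z‖ ^ 2 / truncSq z + Real.log (truncSq z) + (‖w‖ ^ 2 - ‖z‖ ^ 2) / truncSq z := by
    intro z w
    have hz := truncSq_pos z
    have hw := truncSq_pos w
    have h1 := Real.log_le_sub_one_of_pos (div_pos hw hz)
    rw [Real.log_div hw.ne' hz.ne'] at h1
    have h2 : truncSq w / truncSq z - 1 + ‖w‖ ^ 2 / truncSq w - ‖w‖ ^ 2 / truncSq z ≤ 0 := by
      have h3 : truncSq w / truncSq z - 1 + ‖w‖ ^ 2 / truncSq w - ‖w‖ ^ 2 / truncSq z =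
          (truncSq w - truncSq z) * (truncSq w - ‖w‖ ^ 2) / (truncSq z * truncSq w) := by
        field_simp; ring
      rw [h3]
      refine div_nonpos_of_nonpos_of_nonneg ?_ (by positivity)
      rcases le_or_gt (1 / 2) ‖w‖ with h | h
      · rw [truncSq_of_half_le h, sub_self, mul_zero]
      · refine mul_nonpos_of_nonpos_of_nonneg ?_ (sub_nonneg.2 (le_max_left _ _))
        rw [truncSq_of_lt_half h]
        linarith [truncSq_ge z]
    have h4 : (‖w‖ ^ 2 - ‖z‖ ^ 2) / truncSq z = ‖w‖ ^ 2 / truncSq z - ‖z‖ ^ 2 / truncSq z :=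
      sub_div _ _ _
    linarith
  set w := z + h with hw
  set P := (inner ℂ z h).re with hP
  have hexp : ‖w‖ ^ 2 = ‖z‖ ^ 2 + 2 * P + ‖h‖ ^ 2 := by
    rw [hw, @norm_add_sq ℂ]; rfl
  have hinv : (truncSq z)⁻¹ ≤ 4 := by
    rw [inv_le_comm₀ (truncSq_pos z) (by norm_num)]; linarith [truncSq_ge z]
  have hinv' : (truncSq w)⁻¹ ≤ 4 := by
    rw [inv_le_comm₀ (truncSq_pos w) (by norm_num)]; linarith [truncSq_ge w]
  have hforce : (inner ℂ (truncForce ω z) h).re = ω * ((truncSq z)⁻¹ - 1) * P := by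
    rw [truncForce, ← smul_eq_mul, inner_smul_left, Complex.conj_ofReal, Complex.re_ofReal_mul]
  have hlip : |(truncSq w)⁻¹ * (inner ℂ w h).re - (truncSq z)⁻¹ * P| ≤ 12 * ‖h‖ ^ 2 := by
    have h1 : (truncSq w)⁻¹ * (inner ℂ w h).re - (truncSq z)⁻¹ * P =
        (inner ℂ (((truncSq w)⁻¹ : ℂ) * w - ((truncSq z)⁻¹ : ℂ) * z) h).re := by
      rw [inner_sub_left, ← smul_eq_mul (_ : ℂ) w, ← smul_eq_mul (_ : ℂ) z, inner_smul_left,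
        inner_smul_left, ← Complex.ofReal_inv, ← Complex.ofReal_inv, Complex.conj_ofReal,
        Complex.conj_ofReal,
        Complex.sub_re, Complex.re_ofReal_mul, Complex.re_ofReal_mul]
    rw [h1]
    refine (Complex.abs_re_le_norm _).trans ((norm_inner_le_norm _ _).trans ?_)
    have h2 := norm_inv_truncSq_mul_sub_le w z
    rw [hw, add_sub_cancel_left, ← hw] at h2
    calc _ ≤ 12 * ‖h‖ * ‖h‖ := by gcongr
      _ = _ := by ring
  have hwP : (inner ℂ w h).re = P + ‖h‖ ^ 2 := by
    rw [hw, inner_add_left, Complex.add_re, hP]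
    congr 1
    exact inner_self_eq_norm_sq (𝕜 := ℂ) h
  have t1 := tangent z w
  have t2 := tangent w z
  have e1 : (‖w‖ ^ 2 - ‖z‖ ^ 2) / truncSq z =
      (truncSq z)⁻¹ * (2 * P) + (truncSq z)⁻¹ * ‖h‖ ^ 2 := by
    rw [hexp, div_eq_mul_inv]; ring
  have e2 : (‖z‖ ^ 2 - ‖w‖ ^ 2) / truncSq w =
      -2 * ((truncSq w)⁻¹ * (inner ℂ w h).re) + (truncSq w)⁻¹ * ‖h‖ ^ 2 := by
    rw [hexp, hwP, div_eq_mul_inv]; ring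
  have b1 : (truncSq z)⁻¹ * ‖h‖ ^ 2 ≤ 4 * ‖h‖ ^ 2 := by gcongr
  have b2 : (truncSq w)⁻¹ * ‖h‖ ^ 2 ≤ 4 * ‖h‖ ^ 2 := by gcongr
  have hl := abs_le.1 hlip
  have hh := sq_nonneg ‖h‖
  rw [hforce]
  have e3 : truncPotential ω w - truncPotential ω z + ω * ((truncSq z)⁻¹ - 1) * P =
      ω / 2 * (‖h‖ ^ 2 + 2 * ((truncSq z)⁻¹ * P) -
        (‖w‖ ^ 2 / truncSq w + Real.log (truncSq w)) +
        (‖z‖ ^ 2 / truncSq z + Real.log (truncSq z))) := by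
    simp only [truncPotential]
    rw [hexp]
    ring
  rw [e3, abs_mul, abs_of_nonneg (by positivity : 0 ≤ ω / 2)]
  have e4 : |‖h‖ ^ 2 + 2 * ((truncSq z)⁻¹ * P) -
        (‖w‖ ^ 2 / truncSq w + Real.log (truncSq w)) +
        (‖z‖ ^ 2 / truncSq z + Real.log (truncSq z))| ≤ 30 * ‖h‖ ^ 2 := by
    rw [abs_le]
    constructor <;> linarith [hl.1, hl.2]
  calc _ ≤ ω / 2 * (30 * ‖h‖ ^ 2) := by gcongr
    _ = _ := by ring

/-! ### The profile equation around a reference configuration of finite energy. -/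

/-- A reference configuration of finite (truncated) energy. -/
structure FiniteEnergy (ω : ℝ) (Φ₀ Φ₀' : ℝ → ℂ) : Prop where
  pos : 0 < ω
  continuous : Continuous Φ₀
  hasWeakDeriv : HasWeakDeriv Φ₀ Φ₀'
  memLp : MemLp Φ₀' 2
  integrable : Integrable fun x => truncPotential ω (Φ₀ x)

namespace FiniteEnergy

variable {ω : ℝ} {Φ₀ Φ₀' : ℝ → ℂ}

theorem memLp_truncForce (hΦ : FiniteEnergy ω Φ₀ Φ₀') : MemLp (fun x => truncForce ω (Φ₀ x)) 2 := by
  refine (memLp_two_iff_integrable_sq_norm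
    ((continuous_truncForce ω).comp hΦ.continuous).aestronglyMeasurable).2 ?_
  refine (hΦ.integrable.const_mul (18 * ω)).mono'
    (((continuous_truncForce ω).comp hΦ.continuous).norm.pow 2).aestronglyMeasurable
    (Eventually.of_forall fun x => ?_)
  rw [Real.norm_of_nonneg (by positivity)]
  exact norm_truncForce_sq_le hΦ.pos.le _

theorem aestronglyMeasurable_add (hΦ : FiniteEnergy ω Φ₀ Φ₀') (u : LTwo) :
    AEStronglyMeasurable (fun x => Φ₀ x + u x) :=
  hΦ.continuous.aestronglyMeasurable.add (Lp.aestronglyMeasurable u)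

theorem memLp_truncForce_add (hΦ : FiniteEnergy ω Φ₀ Φ₀') (u : LTwo) :
    MemLp (fun x => truncForce ω (Φ₀ x + u x)) 2 := by
  have h1 : MemLp (fun x => truncForce ω (Φ₀ x + u x) - truncForce ω (Φ₀ x)) 2 := by
    refine MemLp.of_le_mul (c := 13 * ω) (Lp.memLp u)
      (((continuous_truncForce ω).comp_aestronglyMeasurable (hΦ.aestronglyMeasurable_add u)).sub
        ((continuous_truncForce ω).comp hΦ.continuous).aestronglyMeasurable)
      (Eventually.of_forall fun x => ?_)
    refine (norm_truncForce_sub_le hΦ.pos.le _ _).trans_eq ?_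
    rw [add_sub_cancel_left]
  have h2 := hΦ.memLp_truncForce.add h1
  refine h2.ae_eq (Eventually.of_forall fun x => ?_)
  simp

/-- The first-order term of the expansion at `Φ₀` is a product of two `L²` functions and the
remainder is quadratic. -/
theorem integrable_truncPotential_add (hΦ : FiniteEnergy ω Φ₀ Φ₀') (u : LTwo) :
    Integrable fun x => truncPotential ω (Φ₀ x + u x) := by
  have h1 : Integrable fun x => ‖u x‖ ^ 2 := (Lp.memLp u).integrable_norm_pow (by norm_num)
  have h2 : Integrable fun x => ‖truncForce ω (Φ₀ x)‖ ^ 2 :=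
    hΦ.memLp_truncForce.integrable_norm_pow (by norm_num)
  refine (hΦ.integrable.add ((h1.const_mul (15 * ω + 1)).add h2)).mono'
    ((continuous_truncPotential ω).comp_aestronglyMeasurable (hΦ.aestronglyMeasurable_add u))
    (Eventually.of_forall fun x => ?_)
  have h3 := (abs_le.1 (abs_truncPotential_add_sub_le hΦ.pos.le (Φ₀ x) (u x))).2
  have h4 := (abs_le.1 ((Complex.abs_re_le_norm (inner ℂ (truncForce ω (Φ₀ x)) (u x))).trans
    (norm_inner_le_norm _ _))).1
  rw [Real.norm_of_nonneg (truncPotential_nonneg hΦ.pos.le _)]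
  simp only [Pi.add_apply]
  nlinarith [sq_nonneg (‖truncForce ω (Φ₀ x)‖ - ‖u x‖), sq_nonneg (‖truncForce ω (Φ₀ x)‖),
    sq_nonneg ‖u x‖]

theorem integral_mul_eq_setIntegral {φ : ℝ → ℝ} {R : ℝ} (hR : ∀ x, R ≤ |x| → φ x = 0)
    (f : ℝ → ℂ) : ∫ x, f x * (φ x : ℂ) = ∫ x in Set.Icc (-R) R, f x * (φ x : ℂ) := by
  refine (setIntegral_eq_integral_of_forall_compl_eq_zero fun x hx => ?_).symm
  have : R ≤ |x| := by
    by_contra hlt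
    exact hx (abs_le.1 (not_le.1 hlt).le)
  rw [hR x this, Complex.ofReal_zero, mul_zero]

/-- The force as an operator in `L²`. -/
noncomputable def force (hΦ : FiniteEnergy ω Φ₀ Φ₀') (u : LTwo) : LTwo :=
  (hΦ.memLp_truncForce_add u).toLp

theorem coe_force (hΦ : FiniteEnergy ω Φ₀ Φ₀') (u : LTwo) :
    hΦ.force u =ᵐ[volume] fun x => truncForce ω (Φ₀ x + u x) :=
  (hΦ.memLp_truncForce_add u).coeFn_toLp

theorem coe_force_J (hΦ : FiniteEnergy ω Φ₀ Φ₀') (v : HOne) :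
    hΦ.force (𝐉 v) =ᵐ[volume] fun x => truncForce ω (Φ₀ x + HOne.rep v x) := by
  filter_upwards [hΦ.coe_force (𝐉 v), HOne.rep_ae_eq v] with x h1 h2
  rw [h1, h2]

/-- Only the compact support of `φ` matters, and there weak convergence in `H¹` is uniform. -/
theorem weak_force (hΦ : FiniteEnergy ω Φ₀ Φ₀') {φ : ℝ → ℝ} (hφ : IsTestFunction φ)
    {l : Filter ℕ} {v : ℕ → HOne} {w : HOne} {R : ℝ} (hR : ∀ n, ‖v n‖ ≤ R)
    (hv : ∀ h, Tendsto (fun n => inner ℂ (v n) h) l (𝓝 (inner ℂ w h))) :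
    Tendsto (fun n => inner ℂ (𝐉 (HOne.test hφ)) (hΦ.force (𝐉 (v n)))) l
      (𝓝 (inner ℂ (𝐉 (HOne.test hφ)) (hΦ.force (𝐉 w)))) := by
  obtain ⟨B, -, hB⟩ := hφ.exists_support_subset
  obtain ⟨A, hA⟩ := hφ.continuous.bounded_above_of_compact_support hφ.2
  have hA0 : 0 ≤ A := (norm_nonneg _).trans (hA 0)
  have hinner : ∀ u : HOne, inner ℂ (𝐉 (HOne.test hφ)) (hΦ.force (𝐉 u)) =
      ∫ x in Set.Icc (-B) B, truncForce ω (Φ₀ x + HOne.rep u x) * (φ x : ℂ) := by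
    intro u
    rw [HOne.J_test, hφ.inner_toLTwo, ← integral_mul_eq_setIntegral hB]
    exact integral_congr_ae ((hΦ.coe_force_J u).mono fun x hx => by simp only [hx])
  have hcont : ∀ u : HOne, Continuous fun x => truncForce ω (Φ₀ x + HOne.rep u x) * (φ x : ℂ) :=
    fun u => ((continuous_truncForce ω).comp (hΦ.continuous.add (HOne.continuous_rep u))).mul
      hφ.continuous_ofReal
  simp only [hinner]
  refine tendsto_setIntegral_of_eventually_forall_norm_sub_le (by simp)
    (fun n => (hcont _).integrableOn_Icc) (hcont _).integrableOn_Icc fun ε hε => ?_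
  have hω := hΦ.pos
  filter_upwards [HOne.eventually_forall_norm_rep_sub_le hR hv (isCompact_Icc (a := -B) (b := B))
    (ε := ε / (13 * ω * (A + 1))) (by positivity)] with n hn x hx
  rw [← sub_mul, norm_mul, Complex.norm_real]
  have h1 := norm_truncForce_sub_le hω.le (Φ₀ x + HOne.rep (v n) x) (Φ₀ x + HOne.rep w x)
  rw [add_sub_add_left_eq_sub] at h1
  calc _ ≤ (13 * ω * ‖HOne.rep (v n) x - HOne.rep w x‖) * (A + 1) := by
        gcongr
        linarith [hA x]
    _ ≤ (13 * ω * (ε / (13 * ω * (A + 1)))) * (A + 1) := by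
        gcongr
        exact hn x hx
    _ = ε := by field_simp

/-- On each `[-B, B]` the integrals converge by uniform convergence and are bounded by the full ones
since the potential is nonnegative; then `B → ∞`. -/
theorem weak_potential (hΦ : FiniteEnergy ω Φ₀ Φ₀') {l : Filter ℕ} [l.NeBot]
    {v : ℕ → HOne} {w : HOne} {R p : ℝ} (hR : ∀ n, ‖v n‖ ≤ R)
    (hv : ∀ h, Tendsto (fun n => inner ℂ (v n) h) l (𝓝 (inner ℂ w h)))
    (hp : Tendsto (fun n => ∫ x, truncPotential ω (Φ₀ x + 𝐉 (v n) x)) l (𝓝 p)) :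
    ∫ x, truncPotential ω (Φ₀ x + 𝐉 w x) ≤ p := by
  have hω := hΦ.pos
  have hae : ∀ u : HOne, (fun x => truncPotential ω (Φ₀ x + 𝐉 u x)) =ᵐ[volume]
      fun x => truncPotential ω (Φ₀ x + HOne.rep u x) := fun u =>
    (HOne.rep_ae_eq u).mono fun x hx => by simp only [hx]
  have hcont : ∀ u : HOne, Continuous fun x => Φ₀ x + HOne.rep u x := fun u =>
    hΦ.continuous.add (HOne.continuous_rep u)
  have hcontP := fun u => (continuous_truncPotential ω).comp (hcont u)
  have hint : ∀ u : HOne, Integrable fun x => truncPotential ω (Φ₀ x + HOne.rep u x) := fun u =>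
    (hΦ.integrable_truncPotential_add (𝐉 u)).congr (hae u)
  simp only [integral_congr_ae (hae _)] at hp ⊢
  have key : ∀ B : ℝ, ∫ x in Set.Icc (-B) B, truncPotential ω (Φ₀ x + HOne.rep w x) ≤ p := by
    intro B
    have hlim : Tendsto
        (fun n => ∫ x in Set.Icc (-B) B, truncPotential ω (Φ₀ x + HOne.rep (v n) x)) l
        (𝓝 (∫ x in Set.Icc (-B) B, truncPotential ω (Φ₀ x + HOne.rep w x))) := by
      refine tendsto_setIntegral_of_eventually_forall_norm_sub_le (by simp)
        (fun n => (hcontP _).integrableOn_Icc) (hcontP _).integrableOn_Icc fun ε hε => ?_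
      obtain ⟨A, hA⟩ := (isCompact_Icc (a := -B) (b := B)).exists_bound_of_continuousOn
        ((continuous_truncForce ω).comp (hcont w)).continuousOn
      have hpos : 0 < |A| + 15 * ω := by positivity
      filter_upwards [HOne.eventually_forall_norm_rep_sub_le hR hv
        (isCompact_Icc (a := -B) (b := B)) (ε := min 1 (ε / (|A| + 15 * ω)))
        (by positivity)] with n hn x hx
      set h := HOne.rep (v n) x - HOne.rep w x with hh
      have h1 := abs_truncPotential_add_sub_le hω.le (Φ₀ x + HOne.rep w x) h
      have h2 : Φ₀ x + HOne.rep w x + h = Φ₀ x + HOne.rep (v n) x := by rw [hh]; ring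
      rw [h2] at h1
      have h3 := (Complex.abs_re_le_norm
        (inner ℂ (truncForce ω (Φ₀ x + HOne.rep w x)) h)).trans (norm_inner_le_norm _ _)
      have h4 : ‖truncForce ω (Φ₀ x + HOne.rep w x)‖ ≤ |A| := (hA x hx).trans (le_abs_self A)
      have h5 : ‖h‖ ≤ 1 := (hn x hx).trans (min_le_left _ _)
      have h6 : ‖h‖ * (|A| + 15 * ω) ≤ ε := by
        rw [← le_div_iff₀ hpos]; exact (hn x hx).trans (min_le_right _ _)
      have h7 : ‖truncForce ω (Φ₀ x + HOne.rep w x)‖ * ‖h‖ ≤ |A| * ‖h‖ := by gcongr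
      have h8 : 15 * ω * ‖h‖ ^ 2 ≤ 15 * ω * ‖h‖ := by
        gcongr; nlinarith [norm_nonneg h]
      rw [Real.norm_eq_abs, abs_le]
      have h9 := abs_le.1 h1
      have h10 := abs_le.1 h3
      constructor <;> nlinarith [h9.1, h9.2, h10.1, h10.2]
    refine le_of_tendsto_of_tendsto hlim hp (Eventually.of_forall fun n => ?_)
    exact setIntegral_le_integral (hint _)
      (Eventually.of_forall fun x => truncPotential_nonneg hω.le _)
  have hcover : AECover volume atTop fun B : ℝ => Set.Icc (-B) B :=
    aecover_Icc tendsto_neg_atTop_atBot tendsto_id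
  exact le_of_tendsto (hcover.integral_tendsto_of_countably_generated (hint w))
    (Eventually.of_forall key)

/-- The semilinear equation `i v' + v'' + Φ₀'' + truncForce (Φ₀ + v) = 0` in `H¹`. -/
noncomputable def data (hΦ : FiniteEnergy ω Φ₀ Φ₀') : SemilinearData sobolevEnergySpace where
  a := hΦ.memLp.toLp
  N := hΦ.force
  V u := ∫ x, truncPotential ω (Φ₀ x + u x)
  K := Real.toNNReal (13 * ω)
  B := 15 * ω
  C := 18 * ω
  tests := HOne.tests
  lipschitz_N := by
    have hω := hΦ.pos
    refine LipschitzWith.of_dist_le_mul fun u w => ?_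
    rw [dist_eq_norm, dist_eq_norm, Real.coe_toNNReal _ (by positivity)]
    refine Lp.norm_le_mul_norm_of_ae_le_mul ?_
    filter_upwards [hΦ.coe_force u, hΦ.coe_force w, Lp.coeFn_sub (hΦ.force u) (hΦ.force w),
      Lp.coeFn_sub u w] with x h1 h2 h3 h4
    rw [h3, h4, Pi.sub_apply, Pi.sub_apply, h1, h2]
    refine (norm_truncForce_sub_le hω.le _ _).trans_eq ?_
    rw [add_sub_add_left_eq_sub]
  V_nonneg u := integral_nonneg fun x => truncPotential_nonneg hΦ.pos.le _
  C_nonneg := by have := hΦ.pos; positivity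
  norm_N_sq_le u := by
    rw [LTwo.norm_sq_eq, ← integral_const_mul]
    refine integral_mono_ae ((Lp.memLp _).integrable_norm_pow (by norm_num))
      ((hΦ.integrable_truncPotential_add u).const_mul _) ?_
    filter_upwards [hΦ.coe_force u] with x hx
    simp only [hx]
    exact norm_truncForce_sq_le hΦ.pos.le _
  V_quadratic u h := by
    have hu := hΦ.integrable_truncPotential_add u
    have huh := hΦ.integrable_truncPotential_add (u + h)
    have hin := L2.integrable_inner (𝕜 := ℂ) (hΦ.force u) h
    have h1 : (inner ℂ (hΦ.force u) h).re = ∫ x, (inner ℂ (hΦ.force u x) (h x)).re := by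
      rw [L2.inner_def]
      exact (integral_re hin).symm
    have h2 := integral_add (huh.sub hu) hin.re
    simp only [Pi.sub_apply, RCLike.re_to_complex] at h2
    rw [h1, ← integral_sub huh hu, ← h2, LTwo.norm_sq_eq, ← integral_const_mul]
    refine abs_integral_le_integral_abs.trans (integral_mono_ae ?_ ?_ ?_)
    · exact ((huh.sub hu).add hin.re).abs
    · exact ((Lp.memLp h).integrable_norm_pow (by norm_num)).const_mul _
    · filter_upwards [hΦ.coe_force u, Lp.coeFn_add u h] with x hx hx'
      simp only [hx, hx', Pi.add_apply, ← add_assoc]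
      exact abs_truncPotential_add_sub_le hΦ.pos.le _ _
  dense_tests := HOne.topologicalClosure_span_tests
  test_deriv := by
    rintro _ ⟨φ, hφ, rfl⟩
    exact ⟨-hφ.deriv.deriv.toLTwo, fun w => by rw [HOne.inner_D_test, inner_neg_left]⟩
  weak_N := by
    rintro _ ⟨φ, hφ, rfl⟩ l v w R hR hv
    exact hΦ.weak_force hφ hR hv
  weak_V := fun l v w R p hR hv hp => hΦ.weak_potential hR hv hp

end FiniteEnergy

/-! ### Curves in `H¹`: local uniqueness, continuity, decay at infinity. -/

/-- A continuous curve that satisfies the equation near `t₀` when tested against the total set of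
test vectors coincides near `t₀` with the weak solution through the same point. -/
theorem SemilinearData.IsWeakSolution.eq_on_ball_of_tests {H L : Type*} [NormedAddCommGroup H]
    [InnerProductSpace ℂ H] [CompleteSpace H] [NormedAddCommGroup L] [InnerProductSpace ℂ L]
    [CompleteSpace L] {S : EnergySpace H L} {W : SemilinearData S} {v w : ℝ → H}
    (hv : W.IsWeakSolution v) (hw : Continuous w) {t₀ r : ℝ} (h0 : w t₀ = v t₀)
    (heq : ∀ φ ∈ W.tests, ∀ t ∈ Metric.ball t₀ r,
      Complex.I * inner ℂ (S.J φ) (S.J (w t) - S.J (w t₀)) =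
        ∫ τ in t₀..t, inner ℂ φ (W.gradient (w τ))) :
    ∀ t ∈ Metric.ball t₀ r, w t = v t := by
  obtain ⟨KG, hKG⟩ := W.exists_lipschitz_gradient
  have hgrad : Continuous fun τ => W.gradient (w τ) := hKG.continuous.comp hw
  have hall : ∀ φ, ∀ t ∈ Metric.ball t₀ r,
      Complex.I * inner ℂ (S.J φ) (S.J (w t) - S.J (w t₀)) =
        ∫ τ in t₀..t, inner ℂ φ (W.gradient (w τ)) := by
    intro φ t ht
    have hlhs : ∀ φ, Complex.I * inner ℂ (S.J φ) (S.J (w t) - S.J (w t₀)) =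
        inner ℂ φ (Complex.I • ContinuousLinearMap.adjoint S.J (S.J (w t) - S.J (w t₀))) := by
      intro φ
      rw [inner_smul_right, ContinuousLinearMap.adjoint_inner_right]
    obtain ⟨C, hC⟩ := (isCompact_uIcc (a := t₀) (b := t)).exists_bound_of_continuousOn
      hgrad.continuousOn
    rw [hlhs]
    refine inner_eq_integral_of_total W.dense_tests (C := C)
      (fun φ => (continuous_const.inner hgrad).continuousOn) hC (fun φ hφ => ?_) φ
    rw [← hlhs]
    exact heq φ hφ t ht
  have hwJ : Continuous fun t => S.J (w t) := S.J.continuous.comp hw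
  have h := S.eq_zero_of_weak_equation (d := fun t => w t - v t)
    (n := fun t => W.N (S.J (w t)) - W.N (S.J (v t))) (C := W.K) (t₀ := t₀) (r := r)
    W.K.coe_nonneg
    (by simp only [map_sub]; exact (hwJ.sub hv.continuous_J).continuousOn)
    ((W.lipschitz_N.continuous.comp hwJ).sub
      (W.lipschitz_N.continuous.comp hv.continuous_J)).continuousOn
    (fun t _ => by rw [map_sub]; exact W.lipschitz_N.norm_sub_le _ _)
    (fun φ t ht => by
      have h1 := hall φ t ht
      have h2 := hv.equation_between φ t₀ t
      have h3 : inner ℂ (S.J φ) (S.J (w t - v t)) =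
          inner ℂ (S.J φ) (S.J (w t) - S.J (w t₀)) - inner ℂ (S.J φ) (S.J (v t) - S.J (v t₀)) := by
        rw [h0, ← inner_sub_right, map_sub]; congr 1; abel
      rw [h3, mul_sub, h1, h2, ← intervalIntegral.integral_sub
        ((continuous_const.inner hgrad).intervalIntegrable _ _)
        ((hv.continuous_inner_gradient φ).intervalIntegrable _ _)]
      congr 1
      funext τ
      simp only [W.inner_gradient, map_sub, inner_sub_right, inner_add_right]
      ring)
  exact fun t ht => sub_eq_zero.1 (h t ht)

namespace HOne

theorem continuous_rep_uncurry {v : ℝ → HOne} (hv : Continuous v) :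
    Continuous fun p : ℝ × ℝ => rep (v p.1) p.2 := by
  rw [continuous_iff_continuousAt]
  rintro ⟨t, x⟩
  rw [ContinuousAt, tendsto_iff_norm_sub_tendsto_zero]
  have hb : Continuous fun p : ℝ × ℝ => 2 * ‖v p.1 - v t‖ + √|p.2 - x| * ‖v t‖ := by fun_prop
  have hlim := hb.tendsto (t, x)
  simp only [sub_self, norm_zero, mul_zero, abs_zero, Real.sqrt_zero, zero_mul, add_zero] at hlim
  refine squeeze_zero (fun p => norm_nonneg _) (fun p => ?_) hlim
  have h1 : rep (v p.1) p.2 - rep (v t) x =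
      rep (v p.1 - v t) p.2 + (rep (v t) p.2 - rep (v t) x) := by
    rw [rep_sub, Pi.sub_apply]; ring
  rw [h1]
  exact (norm_add_le _ _).trans (add_le_add (norm_rep_le _ _) (norm_rep_sub_le _ _ _))

theorem continuousInH1_rep {v : ℝ → HOne} (hv : Continuous v) :
    ContinuousInH1 fun t => rep (v t) := by
  refine ⟨fun t => 𝐃 (v t), fun t => isH1Pair_rep _, fun t₀ => ?_⟩
  have h1 : ∀ t, eLpNorm (rep (v t) - rep (v t₀)) 2 volume = ‖𝐉 (v t - v t₀)‖ₑ := fun t => by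
    rw [← rep_sub, ← eLpNorm_congr_ae (rep_ae_eq _), Lp.enorm_def]
  have h2 : ∀ t, eLpNorm (𝐃 (v t) - 𝐃 (v t₀) : ℝ → ℂ) 2 volume = ‖𝐃 (v t - v t₀)‖ₑ := fun t => by
    rw [map_sub, Lp.enorm_def]
    exact eLpNorm_congr_ae (Lp.coeFn_sub _ _).symm
  simp only [h1, h2]
  have h3 : Continuous fun t => ‖𝐉 (v t - v t₀)‖ₑ + ‖𝐃 (v t - v t₀)‖ₑ :=
    ((𝐉.continuous.comp (hv.sub continuous_const)).enorm).add
      ((𝐃.continuous.comp (hv.sub continuous_const)).enorm)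
  simpa using h3.tendsto t₀

theorem exists_rep_eq_of_isH1Pair {f g : ℝ → ℂ} (h : IsH1Pair f g) :
    ∃ u : HOne, rep u = f ∧ 𝐃 u =ᵐ[volume] g := by
  obtain ⟨hf, hf2, hfg, hg2⟩ := h
  obtain ⟨u, hJ, hD⟩ := exists_of_hasWeakDeriv hf2 hg2 hfg
  exact ⟨u, rep_eq_of_ae_eq hf (by rw [hJ]; exact hf2.coeFn_toLp), by rw [hD]; exact hg2.coeFn_toLp⟩

/-- Translates `ContinuousInH1`, phrased with functions and chosen derivatives, into continuity for
the Hilbert norm, as uniqueness requires. -/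
theorem exists_continuous_of_continuousInH1 {u : ℝ → ℝ → ℂ} (hu : ContinuousInH1 u) :
    ∃ v : ℝ → HOne, Continuous v ∧ ∀ t, rep (v t) = u t := by
  obtain ⟨w, hw, hlim⟩ := hu
  choose v hv hvw using fun t => exists_rep_eq_of_isH1Pair (hw t)
  refine ⟨v, ?_, hv⟩
  rw [continuous_iff_continuousAt]
  intro t₀
  rw [ContinuousAt, tendsto_iff_norm_sub_tendsto_zero]
  have h1 : ∀ t, eLpNorm (u t - u t₀) 2 volume = ‖𝐉 (v t - v t₀)‖ₑ := fun t => by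
    rw [← hv, ← hv, ← rep_sub, ← eLpNorm_congr_ae (rep_ae_eq _), Lp.enorm_def]
  have h2 : ∀ t, eLpNorm (w t - w t₀) 2 volume = ‖𝐃 (v t - v t₀)‖ₑ := fun t => by
    rw [map_sub, Lp.enorm_def]
    exact eLpNorm_congr_ae (((hvw t).sub (hvw t₀)).symm.trans (Lp.coeFn_sub _ _).symm)
  have h3 := hlim t₀
  simp only [h1, h2] at h3
  have h4 : Tendsto (fun t => ‖𝐉 (v t - v t₀)‖ + ‖𝐃 (v t - v t₀)‖) (𝓝 t₀) (𝓝 0) := by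
    have := (ENNReal.tendsto_toReal ENNReal.zero_ne_top).comp h3
    refine this.congr fun t => ?_
    simp only [Function.comp_apply]
    rw [ENNReal.toReal_add enorm_ne_top enorm_ne_top, toReal_enorm, toReal_enorm]
  exact squeeze_zero (fun t => norm_nonneg _) (fun t => sobolevEnergySpace.norm_le_add _) h4

/-- Elements of `H¹` vanish at infinity. -/
theorem tendsto_rep_cocompact (u : HOne) : Tendsto (rep u) (cocompact ℝ) (𝓝 0) := by
  rw [Metric.tendsto_nhds]
  intro ε hε
  -- Compactly supported elements are dense, and the sup norm is at most twice the `H¹` norm.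
  obtain ⟨φ, hφ, hclose⟩ : ∃ w ∈ Submodule.span ℂ tests, ‖u - w‖ < ε / 2 := by
    have hmem : u ∈ closure (Submodule.span ℂ tests : Set HOne) := by
      rw [← Submodule.topologicalClosure_coe, topologicalClosure_span_tests]
      trivial
    obtain ⟨w, hw, h⟩ := Metric.mem_closure_iff.1 hmem (ε / 2) (by positivity)
    exact ⟨w, hw, by rwa [← dist_eq_norm]⟩
  have hcomp : HasCompactSupport (rep φ) := by
    clear hclose
    induction hφ using Submodule.span_induction with
    | mem x hx =>
      obtain ⟨ψ, hψ, rfl⟩ := hx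
      rw [rep_eq_of_ae_eq hψ.continuous_ofReal (by rw [J_test]; exact hψ.coe_toLTwo)]
      exact hψ.hasCompactSupport_ofReal
    | zero =>
      have : rep 0 = 0 := by
        have := rep_smul 0 (0 : HOne)
        simpa using this
      rw [this]
      exact HasCompactSupport.zero
    | add x y _ _ hx hy => rw [rep_add]; exact hx.add hy
    | smul c x _ hx => rw [rep_smul]; exact hx.smul_left
  have hev : ∀ᶠ x in cocompact ℝ, rep φ x = 0 := by
    filter_upwards [hcomp.isCompact.compl_mem_cocompact] with x hx
    exact image_eq_zero_of_notMem_tsupport hx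
  filter_upwards [hev] with x hx
  have h1 : rep u x = rep (u - φ) x := by rw [rep_sub, Pi.sub_apply, hx, sub_zero]
  rw [dist_zero_right, h1]
  linarith [norm_rep_le (u - φ) x]

end HOne

/-! ### Consequences of small energy, and the weak form in terms of functions. -/

namespace FiniteEnergy

variable {ω : ℝ} {Φ₀ Φ₀' : ℝ → ℂ}

/-- Smallness of the energy keeps `|Φ|` close to `1`. -/
theorem abs_norm_sub_one_le (hΦ : FiniteEnergy ω Φ₀ Φ₀') {u : HOne}
    (hu : hΦ.data.energy u ≤ 1 / 200 * √ω) (x : ℝ) :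
    |‖Φ₀ x + HOne.rep u x‖ - 1| ≤ 1 / 4 := by
  have hω := hΦ.pos
  set M := 1 / 200 * √ω with hM
  have hM0 : 0 < M := by positivity
  have hMsq : M ^ 2 = ω / 40000 := by
    rw [hM, mul_pow, Real.sq_sqrt hω.le]; ring
  set Φ : ℝ → ℂ := fun x => Φ₀ x + HOne.rep u x with hΦdef
  have hΦc : Continuous Φ := hΦ.continuous.add (HOne.continuous_rep u)
  have hD : ‖hΦ.data.a + 𝐃 u‖ ≤ √(2 * M) := hΦ.data.norm_deriv_le hu
  have hV : ∫ x, truncPotential ω (Φ x) ≤ M := by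
    have := (hΦ.data.V_le_energy u).trans hu
    refine le_trans (le_of_eq ?_) this
    exact integral_congr_ae ((HOne.rep_ae_eq u).mono fun x hx => by simp only [hΦdef, hx])
  have hVint : Integrable fun x => truncPotential ω (Φ x) :=
    (hΦ.integrable_truncPotential_add (𝐉 u)).congr
      ((HOne.rep_ae_eq u).mono fun x hx => by simp only [hΦdef, hx])
  have hweak : HasWeakDeriv Φ (hΦ.data.a + 𝐃 u : LTwo) :=
    (hΦ.hasWeakDeriv.add (HOne.hasWeakDeriv_rep u)).congr EventuallyEq.rfl (by
      filter_upwards [Lp.coeFn_add hΦ.data.a (𝐃 u), hΦ.memLp.coeFn_toLp] with x h1 h2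
      rw [h1, Pi.add_apply]
      congr 1
      exact h2.symm)
  have hhold : ∀ x y, ‖Φ y - Φ x‖ ≤ √|y - x| * √(2 * M) := fun x y => by
    rw [hweak.sub_eq_integral hΦc x y]
    exact (LTwo.norm_integral_le _ _ _).trans (by gcongr)
  by_contra! hlt
  -- Chosen so that `√(ℓ · 2M) = 1/8`: within distance `ℓ` of `x` the deviation of the modulus from
  -- `1` stays above `1/8`, and the potential above `(ω/2) / 64`.
  set ℓ := 1 / (128 * M) with hℓ
  have hℓ0 : 0 < ℓ := by positivity
  have hlow : ∀ y ∈ Set.Icc (x - ℓ) (x + ℓ), ω / 128 ≤ truncPotential ω (Φ y) := by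
    intro y hy
    have h1 : ‖Φ y - Φ x‖ ≤ 1 / 8 := by
      refine (hhold x y).trans ?_
      rw [← Real.sqrt_mul (abs_nonneg _), Real.sqrt_le_left (by norm_num)]
      have h2 : |y - x| ≤ ℓ := by rw [abs_le]; constructor <;> linarith [hy.1, hy.2]
      calc _ ≤ ℓ * (2 * M) := by gcongr
        _ = (1 / 8) ^ 2 := by rw [hℓ]; field_simp; norm_num
    have h3 := (abs_norm_sub_norm_le (Φ y) (Φ x)).trans h1
    have h4 : 1 / 8 ≤ |‖Φ y‖ - 1| := by
      have h5 := abs_sub_abs_le_abs_sub (‖Φ x‖ - 1) (‖Φ y‖ - 1)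
      rw [sub_sub_sub_cancel_right, abs_sub_comm ‖Φ x‖ ‖Φ y‖] at h5
      have h6 : 1 / 4 < |‖Φ x‖ - 1| := hlt
      linarith
    have h6 := truncPotential_ge hω.le (Φ y)
    rw [← sq_abs (‖Φ y‖ - 1)] at h6
    have h7 : (1 / 8 : ℝ) ^ 2 ≤ |‖Φ y‖ - 1| ^ 2 := by gcongr
    nlinarith
  have hint : ω / 128 * (2 * ℓ) ≤ ∫ y in Set.Icc (x - ℓ) (x + ℓ), truncPotential ω (Φ y) := by
    have h1 : ∫ _ in Set.Icc (x - ℓ) (x + ℓ), ω / 128 = ω / 128 * (2 * ℓ) := by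
      rw [setIntegral_const, Measure.real, Real.volume_Icc, ENNReal.toReal_ofReal (by linarith),
        smul_eq_mul]
      ring
    rw [← h1]
    exact setIntegral_mono_on (by simp) hVint.integrableOn measurableSet_Icc hlow
  have htot := hint.trans ((setIntegral_le_integral hVint
    (Eventually.of_forall fun y => truncPotential_nonneg hω.le _)).trans hV)
  have h8 : ω / 128 * (2 * ℓ) = ω / (8192 * M) := by rw [hℓ]; field_simp; norm_num
  rw [h8, div_le_iff₀ (by positivity)] at htot
  -- The inequality `ω ≤ 8192 M²` contradicts `M² = ω / 40000`.
  nlinarith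

/-- The truncated potential is dominated by the original one, also at zeros of `Φ₀`, where the
latter is infinite. Finiteness of the energy supplies the integrability. -/
theorem of_energy_le (hω : 0 < ω) (hc : Continuous Φ₀) (hd : HasWeakDeriv Φ₀ Φ₀') {M : ℝ}
    (hM : 0 ≤ M) (hE : energy ω Φ₀ Φ₀' ≤ ENNReal.ofReal M) :
    ∃ hΦ : FiniteEnergy ω Φ₀ Φ₀', hΦ.data.energy 0 ≤ M := by
  have hhalf : ENNReal.ofReal (1 / 2) ≠ 0 := by simp
  have h1 : (∫⁻ σ, ‖Φ₀' σ‖ₑ ^ 2) < ∞ := by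
    by_contra hinf
    rw [energy, not_lt_top_iff.1 hinf, ENNReal.mul_top hhalf, top_add] at hE
    exact absurd hE (by simp)
  have hmem : MemLp Φ₀' 2 := by
    refine ⟨hd.2.1.aestronglyMeasurable, ?_⟩
    rw [eLpNorm_lt_top_iff_lintegral_rpow_enorm_lt_top (by norm_num) (by norm_num)]
    simpa using h1
  have hle : ∀ σ, ENNReal.ofReal (truncPotential ω (Φ₀ σ)) ≤
      ENNReal.ofReal (ω / 2) * potential (Φ₀ σ) := by
    intro σ
    rw [potential]
    split_ifs with h
    · rw [ENNReal.mul_top (by simpa using hω)]; exact le_top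
    · rw [← ENNReal.ofReal_mul (by positivity)]
      exact ENNReal.ofReal_le_ofReal (truncPotential_le hω.le h)
  have hlint : ∫⁻ σ, ENNReal.ofReal (truncPotential ω (Φ₀ σ)) ≤
      ENNReal.ofReal (ω / 2) * ∫⁻ σ, potential (Φ₀ σ) := by
    rw [← lintegral_const_mul' _ _ ENNReal.ofReal_ne_top]
    exact lintegral_mono hle
  have hcont : Continuous fun σ => truncPotential ω (Φ₀ σ) :=
    (continuous_truncPotential ω).comp hc
  have hint : Integrable fun σ => truncPotential ω (Φ₀ σ) := by
    refine ⟨hcont.aestronglyMeasurable, ?_⟩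
    rw [hasFiniteIntegral_iff_ofReal
      (Eventually.of_forall fun σ => truncPotential_nonneg hω.le _)]
    exact (hlint.trans (le_add_self.trans hE)).trans_lt ENNReal.ofReal_lt_top
  refine ⟨⟨hω, hc, hd, hmem, hint⟩, ?_⟩
  rw [← ENNReal.ofReal_le_ofReal_iff hM]
  refine le_trans (le_of_eq ?_) ((add_le_add_right hlint _).trans hE)
  have ha : ‖hmem.toLp‖ ^ 2 = ∫ σ, ‖Φ₀' σ‖ ^ 2 := by
    rw [LTwo.norm_sq_eq]
    exact integral_congr_ae (hmem.coeFn_toLp.mono fun σ h => by simp only [h])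
  have hV0 : ∫ σ, truncPotential ω (Φ₀ σ + (0 : LTwo) σ) = ∫ σ, truncPotential ω (Φ₀ σ) :=
    integral_congr_ae ((Lp.coeFn_zero ℂ 2 volume).mono fun σ h => by
      simp only [h, Pi.zero_apply, add_zero])
  rw [SemilinearData.energy, map_zero, map_zero, add_zero]
  change ENNReal.ofReal (1 / 2 * ‖hmem.toLp‖ ^ 2 + ∫ σ, truncPotential ω (Φ₀ σ + (0 : LTwo) σ)) = _
  rw [ha, hV0, ENNReal.ofReal_add (by positivity)
    (integral_nonneg fun σ => truncPotential_nonneg hω.le _), ENNReal.ofReal_mul (by norm_num),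
    ofReal_integral_eq_lintegral_ofReal (hmem.integrable_norm_pow (by norm_num))
      (Eventually.of_forall fun σ => by positivity),
    ofReal_integral_eq_lintegral_ofReal hint
      (Eventually.of_forall fun σ => truncPotential_nonneg hω.le _)]
  congr 3
  funext σ
  rw [ENNReal.ofReal_pow (norm_nonneg _), ofReal_norm]

/-- The weak form of the gradient in terms of functions. -/
theorem inner_test_gradient (hΦ : FiniteEnergy ω Φ₀ Φ₀') {φ : ℝ → ℝ} (hφ : IsTestFunction φ)
    (u : HOne) : inner ℂ (HOne.test hφ) (hΦ.data.gradient u) =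
      -((∫ σ, (Φ₀ σ + HOne.rep u σ) * ((iteratedDeriv 2 φ σ : ℝ) : ℂ)) +
        ∫ σ, truncForce ω (Φ₀ σ + HOne.rep u σ) * (φ σ : ℂ)) := by
  rw [hΦ.data.inner_gradient, HOne.D_test, HOne.J_test, hφ.deriv.inner_toLTwo, hφ.inner_toLTwo]
  have h1 : ∫ σ, (hΦ.data.a + 𝐃 u : LTwo) σ * ((deriv φ σ : ℝ) : ℂ) =
      ∫ σ, (Φ₀' σ + 𝐃 u σ) * ((deriv φ σ : ℝ) : ℂ) := by
    refine integral_congr_ae ?_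
    filter_upwards [Lp.coeFn_add hΦ.data.a (𝐃 u), hΦ.memLp.coeFn_toLp] with x h1 h2
    rw [h1, Pi.add_apply]
    congr 2
  have h2 : ∫ σ, (hΦ.data.N (𝐉 u)) σ * (φ σ : ℂ) =
      ∫ σ, truncForce ω (Φ₀ σ + HOne.rep u σ) * (φ σ : ℂ) :=
    integral_congr_ae ((hΦ.coe_force_J u).mono fun x hx => by
      change hΦ.force (𝐉 u) x * _ = _
      rw [hx])
  have h3 := (hΦ.hasWeakDeriv.add (HOne.hasWeakDeriv_rep u)).2.2 _ hφ.deriv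
  rw [h1, h2, iteratedDeriv_succ, iteratedDeriv_one, h3]
  ring

theorem inner_test_sub (hΦ : FiniteEnergy ω Φ₀ Φ₀') {φ : ℝ → ℝ} (hφ : IsTestFunction φ)
    (u w : HOne) : inner ℂ (𝐉 (HOne.test hφ)) (𝐉 u - 𝐉 w) =
      (∫ σ, (Φ₀ σ + HOne.rep u σ) * (φ σ : ℂ)) - ∫ σ, (Φ₀ σ + HOne.rep w σ) * (φ σ : ℂ) := by
  have h1 : ∀ u : HOne, ∫ σ, (Φ₀ σ + HOne.rep u σ) * (φ σ : ℂ) =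
      (∫ σ, Φ₀ σ * (φ σ : ℂ)) + inner ℂ hφ.toLTwo (𝐉 u) := by
    intro u
    simp only [add_mul]
    rw [integral_add (hφ.integrable_mul hΦ.continuous.locallyIntegrable)
      (hφ.integrable_mul (HOne.continuous_rep u).locallyIntegrable), hφ.inner_toLTwo]
    congr 1
    exact integral_congr_ae ((HOne.rep_ae_eq u).mono fun x hx => by simp only [hx])
  rw [HOne.J_test, inner_sub_right, h1, h1]
  ring

theorem continuous_integral_mul (hΦ : FiniteEnergy ω Φ₀ Φ₀') {φ : ℝ → ℝ} (hφ : IsTestFunction φ)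
    {v : ℝ → HOne} (hv : Continuous v) :
    Continuous fun t => ∫ σ, (Φ₀ σ + HOne.rep (v t) σ) * (φ σ : ℂ) := by
  have h : ∀ t, ∫ σ, (Φ₀ σ + HOne.rep (v t) σ) * (φ σ : ℂ) =
      inner ℂ (𝐉 (HOne.test hφ)) (𝐉 (v t) - 𝐉 (v 0)) +
        ∫ σ, (Φ₀ σ + HOne.rep (v 0) σ) * (φ σ : ℂ) := fun t => by
    rw [hΦ.inner_test_sub hφ]; ring
  exact ((continuous_const.inner ((𝐉.continuous.comp hv).sub continuous_const)).add
    continuous_const).congr fun t => (h t).symm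

end FiniteEnergy

/-! ### Roots of unity and the rotating polygon. -/

/-- The map `η ↦ ξ² / η`, the reflection in the line through `0` and `ξ`, permutes the roots of
unity. For `η ≠ ξ` the terms of `η` and of its mirror image add up to exactly `ξ`, so twice the sum
is `(card - 1) ξ`. -/
theorem sum_nthRootsFinset_div_norm_sq {N : ℕ} (hN : 0 < N) {ξ : ℂ} (hξ : ξ ^ N = 1) :
    ∑ η ∈ Polynomial.nthRootsFinset N (1 : ℂ), (ξ - η) / ((‖ξ - η‖ ^ 2 : ℝ) : ℂ) =
      (((Polynomial.nthRootsFinset N (1 : ℂ)).card : ℂ) - 1) / 2 * ξ := by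
  set T := Polynomial.nthRootsFinset N (1 : ℂ)
  have hT : ∀ η, η ∈ T ↔ η ^ N = 1 := fun η => Polynomial.mem_nthRootsFinset hN 1
  have hnorm : ∀ η : ℂ, η ^ N = 1 → ‖η‖ = 1 := fun η h => Complex.norm_eq_one_of_pow_eq_one h hN.ne'
  have hne : ∀ η : ℂ, η ^ N = 1 → η ≠ 0 := fun η h h0 => by
    have := hnorm η h
    rw [h0, norm_zero] at this
    exact zero_ne_one this
  have hconj : ∀ η : ℂ, η ^ N = 1 → starRingEnd ℂ η = η⁻¹ := fun η h => by
    rw [Complex.inv_def, Complex.normSq_eq_norm_sq, hnorm η h]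
    simp
  have hterm : ∀ η : ℂ, η ^ N = 1 → η ≠ ξ →
      (ξ - η) / ((‖ξ - η‖ ^ 2 : ℝ) : ℂ) = ξ * η / (η - ξ) := by
    intro η h hηξ
    have h0 : ξ - η ≠ 0 := sub_ne_zero.2 (Ne.symm hηξ)
    have h1 : η - ξ ≠ 0 := sub_ne_zero.2 hηξ
    have h2 := hne η h
    have h3 := hne ξ hξ
    have h4 : ((‖ξ - η‖ ^ 2 : ℝ) : ℂ) = (ξ - η) * (ξ⁻¹ - η⁻¹) := by
      rw [← hconj ξ hξ, ← hconj η h, ← map_sub, Complex.mul_conj, Complex.normSq_eq_norm_sq]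
    rw [h4]
    have h5 : ξ⁻¹ - η⁻¹ = (η - ξ) / (ξ * η) := by field_simp
    rw [h5]
    field_simp
  have hrefl : ∑ η ∈ T, (ξ - η) / ((‖ξ - η‖ ^ 2 : ℝ) : ℂ) =
      ∑ η ∈ T, (ξ - ξ ^ 2 / η) / ((‖ξ - ξ ^ 2 / η‖ ^ 2 : ℝ) : ℂ) := by
    have hmem : ∀ η ∈ T, ξ ^ 2 / η ∈ T := fun η h => by
      rw [hT] at *
      rw [div_pow, ← pow_mul, mul_comm 2 N, pow_mul, hξ, h]
      simp
    have hinv : ∀ η ∈ T, ξ ^ 2 / (ξ ^ 2 / η) = η := fun η h => by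
      have h1 := hne η ((hT η).1 h)
      have h2 := hne ξ hξ
      field_simp
    refine Finset.sum_nbij' (fun η => ξ ^ 2 / η) (fun η => ξ ^ 2 / η) hmem hmem hinv hinv ?_
    intro η h
    rw [hinv η h]
  have hsum : ∑ η ∈ T, ((ξ - η) / ((‖ξ - η‖ ^ 2 : ℝ) : ℂ) +
      (ξ - ξ ^ 2 / η) / ((‖ξ - ξ ^ 2 / η‖ ^ 2 : ℝ) : ℂ)) = ((T.card : ℂ) - 1) * ξ := by
    -- The term `η = ξ` is `0 / 0 = 0`, whence the `-1`.
    rw [← Finset.add_sum_erase T _ ((hT ξ).2 hξ)]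
    have h3 := hne ξ hξ
    have h4 : ξ ^ 2 / ξ = ξ := by field_simp
    rw [h4]
    simp only [sub_self, zero_div, zero_add]
    rw [Finset.sum_congr rfl (g := fun _ => ξ), Finset.sum_const,
      Finset.card_erase_of_mem ((hT ξ).2 hξ), nsmul_eq_mul, Nat.cast_pred
        (Finset.card_pos.2 ⟨ξ, (hT ξ).2 hξ⟩)]
    intro η hη
    obtain ⟨hηξ, hmem⟩ := Finset.mem_erase.1 hη
    have hη1 := (hT η).1 hmem
    have h2 := hne η hη1
    have h1 : η - ξ ≠ 0 := sub_ne_zero.2 hηξ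
    have h1' : ξ - η ≠ 0 := sub_ne_zero.2 (Ne.symm hηξ)
    rw [hterm η hη1 hηξ, hterm (ξ ^ 2 / η)]
    · have h5 : ξ ^ 2 / η - ξ = ξ * (ξ - η) / η := by field_simp
      have h6 : ξ - η = -(η - ξ) := by ring
      rw [h5, h6]
      field_simp
      ring
    · rw [div_pow, ← pow_mul, mul_comm 2 N, pow_mul, hξ, hη1]
      simp
    · intro h
      rw [div_eq_iff h2, sq] at h
      exact hηξ (mul_left_cancel₀ h3 h).symm
  rw [Finset.sum_add_distrib, ← hrefl] at hsum
  linear_combination hsum / 2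

theorem IsPrimitiveRoot.sum_Icc_pow {N : ℕ} {ζ : ℂ} (hζ : IsPrimitiveRoot ζ N) (f : ℂ → ℂ) :
    ∑ k ∈ Finset.Icc 1 N, f (ζ ^ k) = ∑ k ∈ Finset.range N, f (ζ ^ k) := by
  have h := Finset.sum_range_succ (fun k => f (ζ ^ k)) N
  rw [Finset.sum_range_succ', hζ.pow_eq_one, pow_zero] at h
  rw [← add_right_cancel h, Finset.range_eq_Ico, Finset.sum_Ico_add' (fun k => f (ζ ^ k)) 0 N 1]
  rfl

/-- Sums over the vertices of the polygon are sums over roots of unity. -/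
theorem sum_Icc_pow_eq_sum_nthRootsFinset {N : ℕ} (hN : 0 < N) {ζ : ℂ} (hζ : IsPrimitiveRoot ζ N)
    (f : ℂ → ℂ) :
    ∑ k ∈ Finset.Icc 1 N, f (ζ ^ k) = ∑ η ∈ Polynomial.nthRootsFinset N (1 : ℂ), f η := by
  rw [hζ.sum_Icc_pow]
  refine Finset.sum_nbij (fun k => ζ ^ k) (fun k _ => ?_) (fun k hk l hl h => ?_) (fun η hη => ?_)
    (fun _ _ => rfl)
  · rw [Polynomial.mem_nthRootsFinset hN, ← pow_mul, mul_comm, pow_mul, hζ.pow_eq_one, one_pow]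
  · exact hζ.pow_inj (Finset.mem_range.1 hk) (Finset.mem_range.1 hl) h
  · have : NeZero N := ⟨hN.ne'⟩
    obtain ⟨i, hi, h⟩ := hζ.eq_pow_of_pow_eq_one
      ((Polynomial.mem_nthRootsFinset hN (1 : ℂ)).1 (Finset.mem_coe.1 hη))
    exact ⟨i, Finset.mem_coe.2 (Finset.mem_range.2 hi), h⟩

theorem rotatingPolygon_eq {N j : ℕ} (hj : j ≠ 0) (ω θ₀ t : ℝ) :
    rotatingPolygon N ω θ₀ j t = Complex.exp (((ω * t + θ₀ : ℝ) : ℂ) * Complex.I) *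
      Complex.exp (2 * Real.pi * Complex.I / N) ^ j := by
  rw [rotatingPolygon, if_neg hj, ← Complex.exp_nat_mul, ← Complex.exp_add]
  congr 1
  push_cast
  ring

theorem norm_rotatingPolygon {N j : ℕ} (hj : j ≠ 0) (ω θ₀ t : ℝ) :
    ‖rotatingPolygon N ω θ₀ j t‖ = 1 := by
  rw [rotatingPolygon, if_neg hj, Complex.norm_exp_ofReal_mul_I]

theorem hasDerivAt_rotatingPolygon (N : ℕ) (ω θ₀ : ℝ) (j : ℕ) (t : ℝ) :
    HasDerivAt (rotatingPolygon N ω θ₀ j) (Complex.I * ω * rotatingPolygon N ω θ₀ j t) t := by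
  rcases eq_or_ne j 0 with h | h
  · have h0 : rotatingPolygon N ω θ₀ j = fun _ => 0 := by
      funext s; rw [rotatingPolygon, if_pos h]
    rw [h0, mul_zero]
    exact hasDerivAt_const _ _
  · have h0 : rotatingPolygon N ω θ₀ j = fun s => Complex.exp
        (((ω * s + θ₀ + 2 * Real.pi * (j : ℝ) / (N : ℝ) : ℝ) : ℂ) * Complex.I) := by
      funext s; rw [rotatingPolygon, if_neg h]
    rw [h0]
    have h1 : HasDerivAt (fun s : ℝ => ω * s + θ₀ + 2 * Real.pi * (j : ℝ) / (N : ℝ)) ω t := by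
      simpa using (((hasDerivAt_id t).const_mul ω).add_const θ₀).add_const
        (2 * Real.pi * (j : ℝ) / (N : ℝ))
    refine ((h1.ofReal_comp.mul_const Complex.I).cexp).congr_deriv ?_
    ring

theorem rotatingPolygon_ne {N : ℕ} (hN : 3 ≤ N) (ω θ₀ t : ℝ) {j k : ℕ} (hj : j ≤ N) (hk : k ≤ N)
    (hjk : j ≠ k) : rotatingPolygon N ω θ₀ j t ≠ rotatingPolygon N ω θ₀ k t := by
  have hζ := Complex.isPrimitiveRoot_exp N (by omega)
  intro h
  rcases eq_or_ne j 0 with h0 | h0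
  · have h1 := norm_rotatingPolygon (N := N) (j := k) (by omega) ω θ₀ t
    rw [← h, rotatingPolygon, if_pos h0, norm_zero] at h1
    exact zero_ne_one h1
  rcases eq_or_ne k 0 with h0' | h0'
  · have h1 := norm_rotatingPolygon (N := N) h0 ω θ₀ t
    rw [h, rotatingPolygon, if_pos h0', norm_zero] at h1
    exact zero_ne_one h1
  rw [rotatingPolygon_eq h0, rotatingPolygon_eq h0'] at h
  have h1 := mul_left_cancel₀ (Complex.exp_ne_zero _) h
  -- Injectivity of powers holds for exponents below `N`, while indices run up to `N`; one factor is
  -- cancelled to shift them.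
  obtain ⟨j, rfl⟩ := Nat.exists_eq_succ_of_ne_zero h0
  obtain ⟨k, rfl⟩ := Nat.exists_eq_succ_of_ne_zero h0'
  rw [pow_succ, pow_succ] at h1
  have h2 := hζ.pow_inj (by omega) (by omega) (mul_right_cancel₀ (Complex.exp_ne_zero _) h1)
  omega

theorem sum_rotatingPolygon {N : ℕ} (hN : 3 ≤ N) (ω θ₀ t : ℝ) :
    ∑ k ∈ Finset.Icc 1 N, rotatingPolygon N ω θ₀ k t = 0 := by
  have hζ := Complex.isPrimitiveRoot_exp N (by omega)
  rw [Finset.sum_congr rfl fun k hk =>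
    rotatingPolygon_eq (by have := (Finset.mem_Icc.1 hk).1; omega) ω θ₀ t, ← Finset.mul_sum,
    hζ.sum_Icc_pow fun η => η, hζ.geom_sum_eq_zero (by omega), mul_zero]

theorem sum_div_norm_sq_rotatingPolygon {N : ℕ} (hN : 3 ≤ N) (ω θ₀ t : ℝ) {j : ℕ}
    (hj : j ∈ Finset.Icc 1 N) :
    ∑ k ∈ Finset.Icc 1 N, (rotatingPolygon N ω θ₀ j t - rotatingPolygon N ω θ₀ k t) /
        ((‖rotatingPolygon N ω θ₀ j t - rotatingPolygon N ω θ₀ k t‖ ^ 2 : ℝ) : ℂ) =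
      ((N : ℂ) - 1) / 2 * rotatingPolygon N ω θ₀ j t := by
  have hζ := Complex.isPrimitiveRoot_exp N (by omega)
  have hne : ∀ k ∈ Finset.Icc 1 N, k ≠ 0 := fun k hk => by
    have := (Finset.mem_Icc.1 hk).1; omega
  set c := Complex.exp (((ω * t + θ₀ : ℝ) : ℂ) * Complex.I) with hc
  have hcn : ‖c‖ = 1 := Complex.norm_exp_ofReal_mul_I _
  rw [rotatingPolygon_eq (hne j hj), ← hc]
  set ζ := Complex.exp (2 * Real.pi * Complex.I / N)
  rw [Finset.sum_congr rfl (g := fun k => c * ((ζ ^ j - ζ ^ k) / ((‖ζ ^ j - ζ ^ k‖ ^ 2 : ℝ) : ℂ)))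
    (fun k hk => by
      rw [rotatingPolygon_eq (hne k hk), ← hc, ← mul_sub, norm_mul, hcn, one_mul, mul_div_assoc]),
    ← Finset.mul_sum, sum_Icc_pow_eq_sum_nthRootsFinset (by omega) hζ
      fun η => (ζ ^ j - η) / ((‖ζ ^ j - η‖ ^ 2 : ℝ) : ℂ),
    sum_nthRootsFinset_div_norm_sq (by omega) (by
      rw [← pow_mul, mul_comm, pow_mul, hζ.pow_eq_one, one_pow]), hζ.card_nthRootsFinset]
  ring

/-- Homogeneity of the interaction. The self-interaction term is `0 / 0 = 0` and may be included in
the sum. -/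
theorem interaction_mul {J : Finset ℕ} (Γ : J → ℝ) (x : J → ℂ) (z : ℂ) (j : J) :
    interaction Γ (fun k => x k * z) j =
      (∑ k : J, (Γ k : ℂ) * ((x j - x k) / ((‖x j - x k‖ ^ 2 : ℝ) : ℂ))) *
        (z / ((‖z‖ ^ 2 : ℝ) : ℂ)) := by
  rw [interaction, Finset.sum_erase _ (by simp), Finset.sum_mul]
  refine Finset.sum_congr rfl fun k _ => ?_
  rw [← sub_mul, norm_mul, mul_pow, Complex.ofReal_mul, mul_div_mul_comm, mul_assoc]

/-- The polygon is a relative equilibrium. -/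
theorem interaction_rotatingPolygon {N : ℕ} (hN : 3 ≤ N) {J : Finset ℕ}
    (hJ : J = Finset.Icc 1 N ∨ J = Finset.Icc 0 N) {Γ₀ ω θ₀ : ℝ} (hω : ω = angularVelocity N J Γ₀)
    {Γ : J → ℝ} (hΓ : ∀ j : J, Γ j = circulation Γ₀ j) (t : ℝ) (z : ℂ) (j : J) :
    interaction Γ (fun k : J => rotatingPolygon N ω θ₀ k t * z) j =
      ω * rotatingPolygon N ω θ₀ j t * (z / ((‖z‖ ^ 2 : ℝ) : ℂ)) := by
  have hmem : ∀ k ∈ J, k ≤ N := by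
    intro k hk
    rcases hJ with h | h <;> rw [h] at hk <;> exact (Finset.mem_Icc.1 hk).2
  rw [interaction_mul]
  congr 1
  set x := fun k => rotatingPolygon N ω θ₀ k t with hx
  have hx0 : x 0 = 0 := by simp only [hx, rotatingPolygon, if_pos]
  have hsum : ∑ k : J, (Γ k : ℂ) * ((x j - x k) / ((‖x j - x k‖ ^ 2 : ℝ) : ℂ)) =
      ∑ k ∈ J, (circulation Γ₀ k : ℂ) * ((x j - x k) / ((‖x j - x k‖ ^ 2 : ℝ) : ℂ)) := by
    simp only [hΓ]
    exact Finset.sum_coe_sort J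
      (fun k => (circulation Γ₀ k : ℂ) * ((x j - x k) / ((‖x j - x k‖ ^ 2 : ℝ) : ℂ)))
  have hvert : ∑ k ∈ Finset.Icc 1 N,
      (circulation Γ₀ k : ℂ) * ((x j - x k) / ((‖x j - x k‖ ^ 2 : ℝ) : ℂ)) =
      ((N : ℂ) - 1) / 2 * x j := by
    rw [Finset.sum_congr rfl (g := fun k => (x j - x k) / ((‖x j - x k‖ ^ 2 : ℝ) : ℂ))
      (fun k hk => by
        rw [circulation, if_neg (by have := (Finset.mem_Icc.1 hk).1; omega), Complex.ofReal_one,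
          one_mul])]
    rcases eq_or_ne (j : ℕ) 0 with h0 | h0
    -- At the centre the vertices pull with total force `-∑ x_k = 0`.
    · rw [h0, hx0, mul_zero]
      rw [Finset.sum_congr rfl (g := fun k => -x k) (fun k hk => by
        have h1 : ‖x k‖ = 1 := norm_rotatingPolygon
          (by have := (Finset.mem_Icc.1 hk).1; omega) ω θ₀ t
        rw [zero_sub, norm_neg, h1]; simp), Finset.sum_neg_distrib, sum_rotatingPolygon hN,
        neg_zero]
    · refine sum_div_norm_sq_rotatingPolygon hN ω θ₀ t (Finset.mem_Icc.2 ⟨by omega, hmem j j.2⟩)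
  change ∑ k : J, (Γ k : ℂ) * ((x j - x k) / ((‖x j - x k‖ ^ 2 : ℝ) : ℂ)) = ω * x j
  rw [hsum, hω, angularVelocity]
  rcases hJ with h | h
  · have hJ' : ∀ f : ℕ → ℂ, ∑ k ∈ J, f k = ∑ k ∈ Finset.Icc 1 N, f k := fun f => by rw [h]
    rw [hJ', hvert, if_neg (by rw [h]; simp)]
    push_cast
    ring
  · have hJ' : ∀ f : ℕ → ℂ, ∑ k ∈ J, f k = f 0 + ∑ k ∈ Finset.Icc 1 N, f k := fun f => by
      have h0 : Finset.Icc 0 N = insert 0 (Finset.Icc 1 N) := by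
        ext k; simp only [Finset.mem_Icc, Finset.mem_insert]; omega
      rw [h, h0, Finset.sum_insert (by simp)]
    rw [hJ', hvert, if_pos (by rw [h]; simp), hx0, sub_zero, circulation, if_pos rfl]
    -- The centre acts on a vertex by `Γ₀ x_j / |x_j|² = Γ₀ x_j`, and not on itself.
    rcases eq_or_ne (j : ℕ) 0 with h1 | h1
    · rw [h1, hx0]; simp
    · have h2 : ‖x j‖ = 1 := norm_rotatingPolygon h1 ω θ₀ t
      rw [h2]
      push_cast
      ring

/-! ### Passage between filament solutions and the profile equation. -/

/-- Variation of constants: multiplying by an exponential factor `x` with `x' = c x`. -/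
theorem mul_sub_mul_eq_integral {c : ℂ} {x n h : ℝ → ℂ} (hx : ∀ t, HasDerivAt x (c * x t) t)
    (hn : Continuous n) (hh : Continuous h) {t₀ r : ℝ}
    (heq : ∀ t ∈ Metric.ball t₀ r, n t - n t₀ = ∫ s in t₀..t, h s) :
    ∀ t ∈ Metric.ball t₀ r, x t * n t - x t₀ * n t₀ = ∫ s in t₀..t, x s * (h s + c * n s) := by
  intro t ht
  have hxc : Continuous x := continuous_iff_continuousAt.2 fun t => (hx t).continuousAt
  have hr : 0 < r := dist_nonneg.trans_lt ht
  have hsub : Set.uIcc t₀ t ⊆ Metric.ball t₀ r :=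
    (convex_ball t₀ r).ordConnected.uIcc_subset (Metric.mem_ball_self hr) ht
  refine (intervalIntegral.integral_eq_sub_of_hasDerivAt (f := fun s => x s * n s)
    (fun s hs => ?_) (Continuous.intervalIntegrable (by fun_prop) _ _)).symm
  have h1 : HasDerivAt (fun s => n t₀ + ∫ τ in t₀..s, h τ) (h s) s :=
    (intervalIntegral.integral_hasDerivAt_right (hh.intervalIntegrable _ _)
      hh.aestronglyMeasurable.stronglyMeasurableAtFilter hh.continuousAt).const_add _
  have h2 : HasDerivAt n (h s) s := h1.congr_of_eventuallyEq <| by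
    filter_upwards [Metric.isOpen_ball.mem_nhds (hsub hs)] with τ hτ
    rw [← heq τ hτ]; ring
  refine ((hx s).mul h2).congr_deriv ?_
  ring

/-- By Fubini, local integrability of the interaction on the plane lets the time integrals of an
arbitrary solution be split at an intermediate time. -/
theorem IsTestFunction.intervalIntegrable_integral_mul {φ : ℝ → ℝ} (hφ : IsTestFunction φ)
    {F : ℝ × ℝ → ℂ} (hF : LocallyIntegrable F) (a b : ℝ) :
    IntervalIntegrable (fun s => ∫ σ, F (s, σ) * (φ σ : ℂ)) volume a b := by
  obtain ⟨R, -, hR⟩ := hφ.exists_support_subset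
  have hK : IsCompact (Set.uIcc a b ×ˢ Set.Icc (-R) R) := isCompact_uIcc.prod isCompact_Icc
  have h1 : IntegrableOn (fun p : ℝ × ℝ => F p * (φ p.2 : ℂ)) (Set.uIcc a b ×ˢ Set.Icc (-R) R) :=
    (hF.integrableOn_isCompact hK).mul_continuousOn
      (hφ.continuous_ofReal.comp continuous_snd).continuousOn hK
  rw [IntegrableOn, Measure.volume_eq_prod, ← Measure.prod_restrict] at h1
  have h2 := h1.integral_prod_left
  rw [intervalIntegrable_iff']
  refine h2.congr (Eventually.of_forall fun s => ?_)
  refine setIntegral_eq_integral_of_forall_compl_eq_zero fun x hx => ?_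
  rw [hR x (by
    by_contra h
    exact hx (abs_le.1 (not_le.1 h).le)), Complex.ofReal_zero, mul_zero]

/-- Configurations `X` that rotate with angular velocity `ω`, all of whose dilations are governed
by the same profile equation. -/
structure IsRotatingEquilibrium {ι : Type*} [Fintype ι] [DecidableEq ι] (Γ : ι → ℝ) (ω : ℝ)
    (X : ι → ℝ → ℂ) : Prop where
  hasDerivAt : ∀ j t, HasDerivAt (X j) (Complex.I * ω * X j t) t
  ne : ∀ j k, j ≠ k → ∀ t, X j t ≠ X k t
  interaction_mul : ∀ j t z,
    interaction Γ (fun k => X k t * z) j = ω * X j t * (z / ((‖z‖ ^ 2 : ℝ) : ℂ))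
  -- At a vertex the circulation is `1`, at the centre `X` is `0`; hence all filaments share the
  -- same second-order term.
  circulation_mul : ∀ j t, (Γ j : ℂ) * X j t = X j t

namespace IsRotatingEquilibrium

variable {ι : Type*} [Fintype ι] [DecidableEq ι] {Γ : ι → ℝ} {ω : ℝ} {X : ι → ℝ → ℂ}
  {Φ₀ Φ₀' : ℝ → ℂ}

theorem continuous (hX : IsRotatingEquilibrium Γ ω X) (j : ι) : Continuous (X j) :=
  continuous_iff_continuousAt.2 fun t => (hX.hasDerivAt j t).continuousAt

/-- For dilation-rotations of `X`, the force on a filament reduces to that on the profile. -/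
theorem force_eq (hX : IsRotatingEquilibrium Γ ω X) (hΦ : FiniteEnergy ω Φ₀ Φ₀') {φ : ℝ → ℝ}
    (hφ : IsTestFunction φ) {u : HOne} (hu : ∀ σ, 1 / 2 ≤ ‖Φ₀ σ + HOne.rep u σ‖) (j : ι) (s : ℝ) :
    (Γ j : ℂ) * (∫ σ, X j s * (Φ₀ σ + HOne.rep u σ) * ((iteratedDeriv 2 φ σ : ℝ) : ℂ)) +
        ∫ σ, interaction Γ (fun k => X k s * (Φ₀ σ + HOne.rep u σ)) j * (φ σ : ℂ) =
      X j s * (-inner ℂ (HOne.test hφ) (hΦ.data.gradient u) +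
        ω * ∫ σ, (Φ₀ σ + HOne.rep u σ) * (φ σ : ℂ)) := by
  have hc : Continuous fun σ => Φ₀ σ + HOne.rep u σ := hΦ.continuous.add (HOne.continuous_rep u)
  have hF : Continuous fun σ => truncForce ω (Φ₀ σ + HOne.rep u σ) :=
    (continuous_truncForce ω).comp hc
  have h1 : ∀ σ, interaction Γ (fun k => X k s * (Φ₀ σ + HOne.rep u σ)) j * (φ σ : ℂ) =
      X j s * (truncForce ω (Φ₀ σ + HOne.rep u σ) * (φ σ : ℂ) +
        ω * ((Φ₀ σ + HOne.rep u σ) * (φ σ : ℂ))) := fun σ => by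
    rw [hX.interaction_mul, truncForce_of_half_le (hu σ)]
    ring
  simp only [h1, mul_assoc (X j s)]
  rw [integral_const_mul, integral_const_mul, integral_add
    (hφ.integrable_mul hF.locallyIntegrable)
    ((hφ.integrable_mul hc.locallyIntegrable).const_mul _), integral_const_mul,
    hΦ.inner_test_gradient hφ, ← mul_assoc, hX.circulation_mul]
  ring

/-- Differentiating the factor `X j` produces `-ω Φ`, which is exactly the linear part of the
truncated force; above modulus `1/2` the rest is the true interaction. -/
theorem isFilamentSolution (hX : IsRotatingEquilibrium Γ ω X) (hΦ : FiniteEnergy ω Φ₀ Φ₀')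
    {v : ℝ → HOne} (hvc : Continuous v) (hv0 : v 0 = 0) (hv : hΦ.data.IsWeakSolution v)
    (hhalf : ∀ t σ, 1 / 2 ≤ ‖Φ₀ σ + HOne.rep (v t) σ‖) :
    IsFilamentSolution Γ (fun j σ => X j 0 * Φ₀ σ)
      fun j t σ => X j t * (Φ₀ σ + HOne.rep (v t) σ) := by
  have hc : Continuous fun p : ℝ × ℝ => Φ₀ p.2 + HOne.rep (v p.1) p.2 :=
    (hΦ.continuous.comp continuous_snd).add (HOne.continuous_rep_uncurry hvc)
  have hne : ∀ t σ, Φ₀ σ + HOne.rep (v t) σ ≠ 0 := fun t σ h => by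
    have := hhalf t σ
    rw [h, norm_zero] at this
    norm_num at this
  have hrep0 : ∀ σ, HOne.rep (v 0) σ = 0 := fun σ => by
    have := HOne.rep_smul 0 (v 0)
    rw [zero_smul, hv0] at this
    rw [hv0, this]
    simp
  refine ⟨fun j => ((hX.continuous j).comp continuous_fst).mul hc, fun j σ => ?_, fun j k hjk =>
    Eventually.of_forall fun p h => hX.ne j k hjk p.1 (mul_right_cancel₀ (hne p.1 p.2) h),
    fun j => ?_, fun j φ hφ t => ?_⟩
  · rw [hrep0, add_zero]
  · refine Continuous.locallyIntegrable ?_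
    simp only [hX.interaction_mul]
    refine (continuous_const.mul ((hX.continuous j).comp continuous_fst)).mul
      (hc.div (Complex.continuous_ofReal.comp (hc.norm.pow 2)) fun p => ?_)
    exact_mod_cast pow_ne_zero 2 (norm_ne_zero_iff.2 (hne p.1 p.2))
  · have hm := hΦ.continuous_integral_mul hφ hvc
    have hg := hv.continuous_inner_gradient (HOne.test hφ)
    simp only [hX.force_eq hΦ hφ (hhalf _)]
    set m : ℝ → ℂ := fun t => ∫ σ, (Φ₀ σ + HOne.rep (v t) σ) * (φ σ : ℂ) with hmdef
    set g : ℝ → ℂ := fun t => inner ℂ (HOne.test hφ) (hΦ.data.gradient (v t))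
    have h1 : ∀ τ ∈ Metric.ball (0 : ℝ) (|t| + 1), m τ - m 0 =
        ∫ s in (0 : ℝ)..τ, -Complex.I * g s := by
      intro τ _
      rw [intervalIntegral.integral_const_mul, ← hv.equation (HOne.test hφ) τ,
        hΦ.inner_test_sub hφ, ← mul_assoc]
      simp [hmdef]
    have h2 := mul_sub_mul_eq_integral (h := fun s => -Complex.I * g s) (hX.hasDerivAt j) hm
      (continuous_const.mul hg) h1 t (by simp)
    have h3 : ∫ σ, X j 0 * Φ₀ σ * (φ σ : ℂ) = X j 0 * m 0 := by
      simp only [hmdef, hrep0, add_zero, mul_assoc]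
      rw [integral_const_mul]
    have h4 : ∫ s in (0 : ℝ)..t, X j s * (-Complex.I * g s + Complex.I * ω * m s) =
        Complex.I * ∫ s in (0 : ℝ)..t, X j s * (-g s + ω * m s) := by
      rw [← intervalIntegral.integral_const_mul]
      refine intervalIntegral.integral_congr fun s _ => ?_
      ring
    have h5 : ∫ σ, X j t * (Φ₀ σ + HOne.rep (v t) σ) * (φ σ : ℂ) = X j t * m t := by
      simp only [mul_assoc]
      rw [integral_const_mul]
    change Complex.I * (_ - _) + ∫ s in (0 : ℝ)..t, X j s * (-g s + ω * m s) = 0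
    rw [h3, h5, h2, h4, ← mul_assoc, Complex.I_mul_I]
    ring

/-- Two solutions that agree at one time agree nearby, as long as one of them stays away from
collisions. -/
theorem eventually_eq_of_eq (hX : IsRotatingEquilibrium Γ ω X) (hΦ : FiniteEnergy ω Φ₀ Φ₀')
    {j : ι} (hj : ∀ t, X j t ≠ 0) {v w : ℝ → HOne} (hv : hΦ.data.IsWeakSolution v)
    (hw : Continuous w)
    (hsol : IsFilamentSolution Γ (fun j σ => X j 0 * Φ₀ σ)
      fun j t σ => X j t * (Φ₀ σ + HOne.rep (w t) σ))
    {t₀ : ℝ} (h0 : w t₀ = v t₀) (hv34 : ∀ σ, 3 / 4 ≤ ‖Φ₀ σ + HOne.rep (v t₀) σ‖) :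
    ∀ᶠ t in 𝓝 t₀, w t = v t := by
  -- A change below `1/8` in `H¹` moves the values by at most `1/4`, so the modulus stays above `3/4
  -- - 1/4 = 1/2`.
  obtain ⟨r, hr, hball⟩ := Metric.continuousAt_iff.1 hw.continuousAt (1 / 8) (by norm_num)
  have hhalf : ∀ t ∈ Metric.ball t₀ r, ∀ σ, 1 / 2 ≤ ‖Φ₀ σ + HOne.rep (w t) σ‖ := by
    intro t ht σ
    have h1 := HOne.norm_rep_le (w t - w t₀) σ
    rw [HOne.rep_sub, Pi.sub_apply] at h1
    have h2 := hball ht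
    rw [dist_eq_norm] at h2
    have h3 := hv34 σ
    rw [← h0] at h3
    have h4 := norm_sub_norm_le (Φ₀ σ + HOne.rep (w t₀) σ) (Φ₀ σ + HOne.rep (w t) σ)
    rw [add_sub_add_left_eq_sub, norm_sub_rev] at h4
    linarith
  filter_upwards [Metric.ball_mem_nhds t₀ hr] with t ht
  refine hv.eq_on_ball_of_tests hw h0 ?_ t ht
  rintro _ ⟨φ, hφ, rfl⟩
  obtain ⟨K, hK⟩ := hΦ.data.exists_lipschitz_gradient
  have hm := hΦ.continuous_integral_mul hφ hw
  have hg : Continuous fun t => inner ℂ (HOne.test hφ) (hΦ.data.gradient (w t)) :=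
    continuous_const.inner (hK.continuous.comp hw)
  set m : ℝ → ℂ := fun t => ∫ σ, (Φ₀ σ + HOne.rep (w t) σ) * (φ σ : ℂ) with hmdef
  set g : ℝ → ℂ := fun t => inner ℂ (HOne.test hφ) (hΦ.data.gradient (w t))
  have hXc := hX.continuous j
  set Q : ℝ → ℂ := fun s =>
    (Γ j : ℂ) * (∫ σ, X j s * (Φ₀ σ + HOne.rep (w s) σ) * ((iteratedDeriv 2 φ σ : ℝ) : ℂ)) +
      ∫ σ, interaction Γ (fun k => X k s * (Φ₀ σ + HOne.rep (w s) σ)) j * (φ σ : ℂ)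
  have hQ : ∀ a b, IntervalIntegrable Q volume a b := by
    intro a b
    refine IntervalIntegrable.add (Continuous.intervalIntegrable ?_ a b)
      (hφ.intervalIntegrable_integral_mul (hsol.locallyIntegrable j) a b)
    have h2 : iteratedDeriv 2 φ = deriv (deriv φ) := by
      rw [iteratedDeriv_succ, iteratedDeriv_one]
    have h1 := hΦ.continuous_integral_mul hφ.deriv.deriv hw
    simp only [mul_assoc (X j _), integral_const_mul, h2]
    exact continuous_const.mul (hXc.mul h1)
  have hcoef : ∀ t, ∫ σ, X j t * (Φ₀ σ + HOne.rep (w t) σ) * (φ σ : ℂ) = X j t * m t := fun t => by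
    simp only [mul_assoc]
    rw [integral_const_mul]
  have hQt : ∀ t ∈ Metric.ball t₀ r,
      X j t * m t - X j t₀ * m t₀ = ∫ s in t₀..t, Complex.I * (X j s * (-g s + ω * m s)) := by
    intro t ht
    have hsub : Set.uIcc t₀ t ⊆ Metric.ball t₀ r :=
      (convex_ball t₀ r).ordConnected.uIcc_subset (Metric.mem_ball_self hr) ht
    have e1 := hsol.equation j φ hφ t
    have e2 := hsol.equation j φ hφ t₀
    rw [hcoef] at e1 e2
    have e3 : ∫ s in t₀..t, Q s = ∫ s in t₀..t, X j s * (-g s + ω * m s) :=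
      intervalIntegral.integral_congr fun s hs => hX.force_eq hΦ hφ (hhalf s (hsub hs)) j s
    rw [intervalIntegral.integral_const_mul, ← e3,
      ← intervalIntegral.integral_interval_sub_left (hQ 0 t) (hQ 0 t₀)]
    change _ + (∫ s in (0 : ℝ)..t, Q s) = 0 at e1
    change _ + (∫ s in (0 : ℝ)..t₀, Q s) = 0 at e2
    linear_combination (-Complex.I) * e1 + Complex.I * e2 +
      (X j t * m t - X j t₀ * m t₀) * Complex.I_mul_I
  -- The rotation is undone by variation of constants with `1 / X j`, possible only for a filament
  -- that is not the centre.
  have hinv : ∀ t, HasDerivAt (fun s => (X j s)⁻¹) (-(Complex.I * ω) * (X j t)⁻¹) t := fun t => by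
    refine ((hX.hasDerivAt j t).inv (hj t)).congr_deriv ?_
    have := hj t
    field_simp
  have hfin := mul_sub_mul_eq_integral (n := fun s => X j s * m s)
    (h := fun s => Complex.I * (X j s * (-g s + ω * m s))) hinv (hXc.mul hm)
    (continuous_const.mul (hXc.mul (hg.neg.add (continuous_const.mul hm)))) hQt
  intro t ht
  have h1 := hfin t ht
  rw [inv_mul_cancel_left₀ (hj t), inv_mul_cancel_left₀ (hj t₀)] at h1
  rw [hΦ.inner_test_sub hφ]
  change Complex.I * (m t - m t₀) = ∫ τ in t₀..t, g τ
  rw [h1, ← intervalIntegral.integral_const_mul]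
  refine intervalIntegral.integral_congr fun s _ => ?_
  have := hj s
  field_simp
  rw [Complex.I_sq]
  ring

/-- The times of agreement form a closed set by continuity and an open one by local uniqueness,
where the lower bound `3/4` on the constructed solution restarts the argument. -/
theorem eq_of_isFilamentSolution (hX : IsRotatingEquilibrium Γ ω X) (hΦ : FiniteEnergy ω Φ₀ Φ₀')
    {j : ι} (hj : ∀ t, X j t ≠ 0) {v : ℝ → HOne} (hvc : Continuous v) (hv0 : v 0 = 0)
    (hv : hΦ.data.IsWeakSolution v) (hv34 : ∀ t σ, 3 / 4 ≤ ‖Φ₀ σ + HOne.rep (v t) σ‖)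
    {Ψ : ι → ℝ → ℝ → ℂ} (hsol : IsFilamentSolution Γ (fun j σ => X j 0 * Φ₀ σ) Ψ)
    (hform : IsDilationRotation X Φ₀ Ψ) :
    Ψ = fun j t σ => X j t * (Φ₀ σ + HOne.rep (v t) σ) := by
  obtain ⟨Φ, hΨ, hH1⟩ := hform
  obtain ⟨w, hw, hwrep⟩ := HOne.exists_continuous_of_continuousInH1 hH1
  have hΨw : Ψ = fun j t σ => X j t * (Φ₀ σ + HOne.rep (w t) σ) := by
    funext k t σ
    rw [hΨ, hwrep]
    ring
  subst hΨw
  have hw0 : w 0 = v 0 := by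
    have h1 : HOne.rep (w 0) = HOne.rep (v 0) := by
      funext σ
      have h2 := mul_left_cancel₀ (hj 0) (hsol.initial j σ)
      have h3 := HOne.rep_smul 0 (v 0)
      rw [zero_smul, hv0, zero_smul] at h3
      rw [hv0, h3, Pi.zero_apply]
      exact add_eq_left.1 h2
    rw [← sub_eq_zero]
    refine sobolevEnergySpace.injective _ ?_
    rw [map_sub, sub_eq_zero]
    refine Lp.ext ((HOne.rep_ae_eq (w 0)).trans ?_)
    rw [h1]
    exact (HOne.rep_ae_eq (v 0)).symm
  have hclopen : IsClopen {t | w t = v t} :=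
    ⟨isClosed_eq hw hvc, isOpen_iff_mem_nhds.2 fun t ht =>
      hX.eventually_eq_of_eq hΦ hj hv hw hsol ht (hv34 t)⟩
  have huniv := hclopen.eq_univ ⟨0, hw0⟩
  have hall : ∀ t, w t = v t := fun t => (huniv ▸ Set.mem_univ t : t ∈ {t | w t = v t})
  simp only [hall]

end IsRotatingEquilibrium

theorem isRotatingEquilibrium_rotatingPolygon {N : ℕ} (hN : 3 ≤ N) {J : Finset ℕ}
    (hJ : J = Finset.Icc 1 N ∨ J = Finset.Icc 0 N) {Γ₀ ω θ₀ : ℝ} (hω : ω = angularVelocity N J Γ₀)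
    {Γ : J → ℝ} (hΓ : ∀ j : J, Γ j = circulation Γ₀ j) :
    IsRotatingEquilibrium Γ ω fun (j : J) t => rotatingPolygon N ω θ₀ j t := by
  have hmem : ∀ k ∈ J, k ≤ N := by
    intro k hk
    rcases hJ with h | h <;> rw [h] at hk <;> exact (Finset.mem_Icc.1 hk).2
  refine ⟨fun j t => hasDerivAt_rotatingPolygon N ω θ₀ j t, fun j k hjk t =>
    rotatingPolygon_ne hN ω θ₀ t (hmem j j.2) (hmem k k.2) fun h => hjk (Subtype.ext h),
    fun j t z => interaction_rotatingPolygon hN hJ hω hΓ t z j, fun j t => ?_⟩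
  rcases eq_or_ne (j : ℕ) 0 with h | h
  · simp only [rotatingPolygon, if_pos h, mul_zero]
  · rw [hΓ, circulation, if_neg h, Complex.ofReal_one, one_mul]

/-! ### The main theorem. -/

theorem theorem1 :
    ∃ η₁ : ℝ, 0 < η₁ ∧
      ∀ (N : ℕ), 3 ≤ N →
      -- the indices of the filaments: the polygon without, or with, its centre
      ∀ (J : Finset ℕ), (J = Finset.Icc 1 N ∨ J = Finset.Icc 0 N) →
      ∀ (Γ₀ ω θ₀ : ℝ), ω = angularVelocity N J Γ₀ → 0 < ω →
      ∀ (Γ : J → ℝ), (∀ j : J, Γ j = circulation Γ₀ j) →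
      ∀ (X : J → ℝ → ℂ), (∀ (j : J) (t : ℝ), X j t = rotatingPolygon N ω θ₀ j t) →
      ∀ (Φ₀ Φ₀' : ℝ → ℂ), Continuous Φ₀ → HasWeakDeriv Φ₀ Φ₀' →
        energy ω Φ₀ Φ₀' ≤ ENNReal.ofReal (η₁ * Real.sqrt ω) →
      ∃ Ψ : J → ℝ → ℝ → ℂ,
        -- existence
        (IsFilamentSolution Γ (fun j σ => X j 0 * Φ₀ σ) Ψ ∧ IsDilationRotation X Φ₀ Ψ) ∧
        -- uniqueness
        (∀ Ψ' : J → ℝ → ℝ → ℂ,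
          IsFilamentSolution Γ (fun j σ => X j 0 * Φ₀ σ) Ψ' ∧ IsDilationRotation X Φ₀ Ψ' →
            Ψ' = Ψ) ∧
        -- control of the mutual distances
        (∀ j k : J, j ≠ k → ∀ t σ : ℝ,
          3 / 4 ≤ ‖Ψ j t σ - Ψ k t σ‖ / ‖X j t - X k t‖ ∧
            ‖Ψ j t σ - Ψ k t σ‖ / ‖X j t - X k t‖ ≤ 5 / 4) ∧
        -- limits at infinity
        (Tendsto Φ₀ (cocompact ℝ) (𝓝 1) →
          ∀ (j : J) (t : ℝ), Tendsto (Ψ j t) (cocompact ℝ) (𝓝 (X j t))) ∧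
        -- perturbations in `H¹`
        (MemH1 (fun σ => Φ₀ σ - 1) →
          ∀ j : J, ContinuousInH1 (fun t σ => Ψ j t σ - X j t)) := by
  refine ⟨1 / 200, by norm_num, ?_⟩
  intro N hN J hJ Γ₀ ω θ₀ hω hpos Γ hΓ X hXeq Φ₀ Φ₀' hc hd hE
  obtain rfl : X = fun (j : J) t => rotatingPolygon N ω θ₀ j t := by
    funext j t
    exact hXeq j t
  have hX := isRotatingEquilibrium_rotatingPolygon (θ₀ := θ₀) hN hJ hω hΓ
  -- A vertex is needed to recover the profile; the centre carries no information.
  have h1J : 1 ∈ J := by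
    rcases hJ with h | h <;> rw [h, Finset.mem_Icc] <;> omega
  have hX1 : ∀ t, rotatingPolygon N ω θ₀ ((⟨1, h1J⟩ : J) : ℕ) t ≠ 0 := fun t h => by
    have := norm_rotatingPolygon (N := N) one_ne_zero ω θ₀ t
    rw [h, norm_zero] at this
    exact zero_ne_one this
  obtain ⟨hΦ, hE0⟩ := FiniteEnergy.of_energy_le hpos hc hd (by positivity) hE
  -- The perturbation starts at zero because `Φ₀` itself is the reference configuration;
  -- conservation propagates its small energy to all times.
  obtain ⟨v, hv0, hvc, hv, hcons⟩ := hΦ.data.exists_continuous_weakSolution 0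
  have hbound : ∀ t σ, |‖Φ₀ σ + HOne.rep (v t) σ‖ - 1| ≤ 1 / 4 := fun t σ =>
    hΦ.abs_norm_sub_one_le ((hcons t).trans_le hE0) σ
  have h34 : ∀ t σ, 3 / 4 ≤ ‖Φ₀ σ + HOne.rep (v t) σ‖ := fun t σ => by
    have := (abs_le.1 (hbound t σ)).1; linarith
  have h54 : ∀ t σ, ‖Φ₀ σ + HOne.rep (v t) σ‖ ≤ 5 / 4 := fun t σ => by
    have := (abs_le.1 (hbound t σ)).2; linarith
  refine ⟨fun j t σ => rotatingPolygon N ω θ₀ j t * (Φ₀ σ + HOne.rep (v t) σ),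
    ⟨hX.isFilamentSolution hΦ hvc hv0 hv fun t σ => by linarith [h34 t σ],
      fun t σ => Φ₀ σ + HOne.rep (v t) σ, fun _ _ _ => rfl, ?_⟩, fun Ψ hΨ =>
    hX.eq_of_isFilamentSolution hΦ hX1 hvc hv0 hv h34 hΨ.1 hΨ.2, fun j k hjk t σ => ?_,
    fun hlim j t => ?_, fun hmem j => ?_⟩
  · simp only [add_sub_cancel_left]
    exact HOne.continuousInH1_rep hvc
  · have h1 : ‖rotatingPolygon N ω θ₀ j t - rotatingPolygon N ω θ₀ k t‖ ≠ 0 :=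
      norm_ne_zero_iff.2 (sub_ne_zero.2 (hX.ne j k hjk t))
    rw [← sub_mul, norm_mul, mul_div_cancel_left₀ _ h1]
    exact ⟨h34 t σ, h54 t σ⟩
  · have h1 := (hlim.add (HOne.tendsto_rep_cocompact (v t))).const_mul (rotatingPolygon N ω θ₀ j t)
    rwa [add_zero, mul_one] at h1
  · obtain ⟨g, hg⟩ := hmem
    obtain ⟨u, hu, -⟩ := HOne.exists_rep_eq_of_isH1Pair hg
    -- With `Φ₀ = 1 + u` the difference is `X_j (u + v)`, a continuous scalar times a continuous
    -- curve in `H¹`.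
    have h1 : (fun t σ => rotatingPolygon N ω θ₀ j t * (Φ₀ σ + HOne.rep (v t) σ) -
        rotatingPolygon N ω θ₀ j t) =
        fun t => HOne.rep (rotatingPolygon N ω θ₀ j t • (u + v t)) := by
      funext t σ
      rw [HOne.rep_smul, HOne.rep_add, hu]
      simp only [Pi.smul_apply, Pi.add_apply, smul_eq_mul]
      ring
    rw [h1]
    exact HOne.continuousInH1_rep ((hX.continuous j).smul (continuous_const.add hvc))
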